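/- Let $n \ge 1$ and $p > 2$, and let $f \in L^2(\mathbb{R}^n) \cap \dot W^{1,p}(\mathbb{R}^n)$, meaning that $f \in L^2(\mathbb{R}^n)$ is real-valued with weak gradient $\nabla f \in L^p(\mathbb{R}^n)^n$. An *energy solution* to the Cauchy problem $$\dot u - \operatorname{div}(|\nabla u|^{p-2}\nabla u) = 0 \ \text{ in } (0,\infty)\times\mathbb{R}^n, \qquad u|_{t=0} = f \ \text{ in } \mathbb{R}^n,$$ is a measurable function $u$ on $(0,\infty)\times\mathbb{R}^n$, modulo equality almost everywhere, such that (i) $u \in W^{1,2}(0,T;L^2(\mathbb{R}^n)) \cap L^\infty(0,T;\dot W^{1,p}(\mathbb{R}^n))$ for every $T>0$ (in particular $u$ is identified with its representative in $C([0,\infty);L^2(\mathbb{R}^n))$); (ii) for almost every $t>0$, $$\int_{\mathbb{R}^n} \dot u(t,x)\varphi(x) + |\nabla u(t,x)|^{p-2}\nabla u(t,x)\cdot\nabla\varphi(x)\,dx = 0 \quad\text{for all } \varphi\in C_c^\infty(\mathbb{R}^n);$$ (iii) $\lim_{t\to 0}\int_{\mathbb{R}^n}|u(t,x)-f(x)|^2\,dx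 = 0$. Then there exists a unique energy solution $u$. For every $t>0$ the function $u(t,\cdot)$ (of the continuous representative) belongs to $L^2(\mathbb{R}^n)\cap\dot W^{1,p}(\mathbb{R}^n)$ and satisfies the energy estimates $$\|u(t,\cdot)\|_{L^2(\mathbb{R}^n)}^2 + 2\int_0^t \|\nabla u(s,\cdot)\|_{L^p(\mathbb{R}^n)}^p\,ds \le \|f\|_{L^2(\mathbb{R}^n)}^2$$ and $$\int_0^t \|\dot u(s,\cdot)\|_{L^2(\mathbb{R}^n)}^2\,ds + \frac1p\|\nabla u(t,\cdot)\|_{L^p(\mathbb{R}^n)}^p \le \frac1p\|\nabla f\|_{L^p(\mathbb{R}^n)}^p .$$ Moreover, if $f\ge 0$ almost everywhere in $\mathbb{R}^n$, then $u\ge 0$ almost everywhere in $(0,\infty)\times\mathbb{R}^n$. -/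

import Mathlib

open MeasureTheory Set Filter Topology
open scoped ENNReal NNReal ContDiff Gradient

/-- `HasWeakGradient v G`: the locally integrable function `v` on `ℝⁿ` is weakly differentiable and
its weak gradient is (represented by) the locally integrable vector field `G`, that is
`∫ v ∇φ = - ∫ φ G` for all test functions `φ ∈ C_c^∞(ℝⁿ)`. -/
structure HasWeakGradient {n : ℕ} (v : EuclideanSpace ℝ (Fin n) → ℝ)
    (G : EuclideanSpace ℝ (Fin n) → EuclideanSpace ℝ (Fin n)) : Prop where
  locallyIntegrable : LocallyIntegrable v volume
  locallyIntegrable_grad : LocallyIntegrable G volume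
  integral_eq : ∀ φ : EuclideanSpace ℝ (Fin n) → ℝ, ContDiff ℝ ∞ φ → HasCompactSupport φ →
    ∫ x, v x • ∇ φ x = - ∫ x, φ x • G x

/-- `HasWeakTimeDeriv u u'`: the weak derivative in `t ∈ (0, ∞)` of `u`, regarded as a function of
time with values in a space of functions on `ℝⁿ`, is `u'`. This means
`∫ φ'(t) u(t) dt = - ∫ φ(t) u'(t) dt`, as an identity between functions on `ℝⁿ` modulo null sets,
for all scalar test functions `φ ∈ C_c^∞(0, ∞)`. -/
def HasWeakTimeDeriv {n : ℕ} (u u' : ℝ → EuclideanSpace ℝ (Fin n) → ℝ) : Prop :=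
  ∀ φ : ℝ → ℝ, ContDiff ℝ ∞ φ → HasCompactSupport φ → tsupport φ ⊆ Ioi 0 →
    ∀ᵐ x : EuclideanSpace ℝ (Fin n),
      ∫ t in Ioi (0 : ℝ), deriv φ t * u t x = - ∫ t in Ioi (0 : ℝ), φ t * u' t x

/-- `IsEnergySolution p f u u' Du`: the function `u = u(t, x)` on `(0, ∞) × ℝⁿ`, with weak time
derivative `u'` and weak spatial gradient `Du`, is an energy solution of the Cauchy problem
`∂ₜ u - div (|∇u|^(p-2) ∇u) = 0`, `u(0) = f`. Only `t > 0` matters, and the notion does not change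
if `u`, `u'`, `Du` are modified on null sets of `(0, ∞) × ℝⁿ`.
The space `L²(0,T; L²(ℝⁿ))` is `L²((0,T) × ℝⁿ)`. -/
structure IsEnergySolution {n : ℕ} (p : ℝ) (f : EuclideanSpace ℝ (Fin n) → ℝ)
    (u u' : ℝ → EuclideanSpace ℝ (Fin n) → ℝ)
    (Du : ℝ → EuclideanSpace ℝ (Fin n) → EuclideanSpace ℝ (Fin n)) : Prop where
  /-- `u ∈ L²(0,T; L²(ℝⁿ))` for every finite `T`. -/
  memLp : ∀ T : ℝ, 0 < T →
    MemLp (fun z : ℝ × EuclideanSpace ℝ (Fin n) => u z.1 z.2) 2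
      ((volume.restrict (Ioo 0 T)).prod volume)
  /-- `∂ₜ u ∈ L²(0,T; L²(ℝⁿ))` for every finite `T`. -/
  memLp_deriv : ∀ T : ℝ, 0 < T →
    MemLp (fun z : ℝ × EuclideanSpace ℝ (Fin n) => u' z.1 z.2) 2
      ((volume.restrict (Ioo 0 T)).prod volume)
  hasWeakTimeDeriv : HasWeakTimeDeriv u u'
  aestronglyMeasurable_grad :
    AEStronglyMeasurable (fun z : ℝ × EuclideanSpace ℝ (Fin n) => Du z.1 z.2)
      ((volume.restrict (Ioi 0)).prod volume)
  hasWeakGradient : ∀ᵐ t ∂(volume.restrict (Ioi (0 : ℝ))), HasWeakGradient (u t) (Du t)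
  /-- `∇u ∈ L^∞(0,T; L^p(ℝⁿ))` for every finite `T`. -/
  bounded_grad : ∀ T : ℝ, 0 < T → ∃ C : ℝ≥0, ∀ᵐ t ∂(volume.restrict (Ioo 0 T)),
    eLpNorm (Du t) (ENNReal.ofReal p) volume ≤ C
  /-- The equation, tested for almost every time with all `φ ∈ C_c^∞(ℝⁿ)`. -/
  equation : ∀ᵐ t ∂(volume.restrict (Ioi (0 : ℝ))),
    ∀ φ : EuclideanSpace ℝ (Fin n) → ℝ, ContDiff ℝ ∞ φ → HasCompactSupport φ →
      ∫ x, (u' t x * φ x + ‖Du t x‖ ^ (p - 2) * inner ℝ (Du t x) (∇ φ x)) = 0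
  /-- The initial value is attained in `L²(ℝⁿ)`. Since `u` is only given up to null sets, the limit
  is along `t → 0`, `t > 0`, outside a set of times of measure zero; it is the limit of the
  representative of `u` that is continuous with values in `L²(ℝⁿ)`. -/
  initial : Tendsto (fun t => ∫⁻ x, ‖u t x - f x‖ₑ ^ 2) (𝓝[>] (0 : ℝ) ⊓ ae volume) (𝓝 0)

/-- `u ∈ C([0, ∞); L²(ℝⁿ))`. -/
def IsContinuousL2 {n : ℕ} (u : ℝ → EuclideanSpace ℝ (Fin n) → ℝ) : Prop :=
  ∀ t : ℝ, 0 ≤ t → MemLp (u t) 2 volume ∧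
    Tendsto (fun s => eLpNorm (u s - u t) 2 volume) (𝓝[Ici 0] t) (𝓝 0)

/-! The equation is the gradient flow in `L²` of the energy `E v = (1/p) ∫ |∇v|^p`, with domain the
`L²` functions whose weak gradient lies in `L^p`. The initial value lies in this domain, so the
theory of gradient flows of convex lower semicontinuous functionals on a Hilbert space yields a
curve with square integrable velocity.

Existence. The subdifferential of `E` is replaced by its Yosida approximation, which is Lipschitz,
so the regularised flows exist globally. Two of them with parameters `l`, `m` differ by at most `((l
+ m) / 2 * E f)^(1/2)` (`IsYosidaFlow.norm_sub_sq_le`), hence they converge; evolution variational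
inequalities pass to the limit by lower semicontinuity, and the velocities converge weakly in
`L²(0,∞; H)`. Differentiating the variational inequality at almost every time shows that minus the
velocity is a subgradient of `E` (`IsConvexEnergy.exists_gradientFlow`). Its first variation along
test functions is the weak equation (`euler_lagrange_of_subgradient`). The dissipation of `E` along
the flow is the second energy estimate.

Lower semicontinuity (`isConvexEnergy_dirichletEnergy`) rests on uniform convexity: Clarkson's
inequality for `p > 2` makes the gradients of almost minimising sequences Cauchy in `L^p`, and the
weak gradient is a closed operator.

Everything else follows by testing the equation with `θ(u)`. In space this is `integral_test_comp`,
by mollification and cutoff; mollified `L²` functions are bounded and so lie in `L^p`. In time it is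
the chain rule for `∫ Θ(u(t))` with `Θ' = θ` (`IsTimePrimitive.integral_comp`), which holds because
for almost every `x` the function `t ↦ u(t, x)` is a primitive of the weak time derivative. The
choice `Θ(s) = s²/2` gives the `L²` energy identity at almost every time, hence the first estimate
at every time by continuity in `L²`. Applied to a difference of solutions it gives uniqueness,
because `a ↦ |a|^(p-2) a` is monotone. A convex `Θ` vanishing exactly on `[0, ∞)` gives
non-negativity. -/

set_option linter.unusedSectionVars false

/-! ### Resolvents, Yosida approximation and Moreau envelope of a convex energy -/

section ConvexEnergy

variable {H : Type*} [NormedAddCommGroup H] [InnerProductSpace ℝ H]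

/-- A proper, nonnegative, convex and lower semicontinuous functional `E` with effective domain
`D`. -/
structure IsConvexEnergy (D : Set H) (E : H → ℝ) : Prop where
  convexOn : ConvexOn ℝ D E
  nonneg : ∀ x ∈ D, 0 ≤ E x
  nonempty : D.Nonempty
  -- The values of `E` off `D` carry no meaning, so the lower semicontinuity of the extension by
  -- `+∞` is phrased through convergent upper bounds, and membership of the limit in `D` belongs to
  -- the conclusion.
  lsc : ∀ (x : ℕ → H) (c : ℕ → ℝ) (x₀ : H) (c₀ : ℝ), (∀ k, x k ∈ D ∧ E (x k) ≤ c k) →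
    Tendsto x atTop (𝓝 x₀) → Tendsto c atTop (𝓝 c₀) → x₀ ∈ D ∧ E x₀ ≤ c₀

/-- The point `y` minimises `F z = l * E z + ‖z - x‖² / 2`. The quadratic term makes `F` uniformly
convex, so minimising sequences are Cauchy; lower semicontinuity makes the limit a minimiser. The
inequality is the first-order condition along segments starting at `y`. -/
lemma IsConvexEnergy.exists_resolvent [CompleteSpace H] {D : Set H} {E : H → ℝ}
    (h : IsConvexEnergy D E) {l : ℝ} (hl : 0 < l) (x : H) :
    ∃ y ∈ D, ∀ z ∈ D, inner ℝ (x - y) (z - y) ≤ l * (E z - E y) := by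
  set F : H → ℝ := fun z => l * E z + ‖z - x‖ ^ 2 / 2 with hF
  have hF0 : ∀ z ∈ D, 0 ≤ F z := fun z hz => by
    have := h.nonneg z hz
    simp only [hF]; positivity
  set m := sInf (F '' D) with hm
  have hbdd : BddBelow (F '' D) := ⟨0, by rintro _ ⟨z, hz, rfl⟩; exact hF0 z hz⟩
  have hmle : ∀ z ∈ D, m ≤ F z := fun z hz => csInf_le hbdd ⟨z, hz, rfl⟩
  -- By the parallelogram law the midpoint value is at most `(F a + F b) / 2 - ‖a - b‖² / 8`, and it
  -- is at least `m`.
  have hmid : ∀ a ∈ D, ∀ b ∈ D, ‖a - b‖ ^ 2 ≤ 4 * (F a + F b - 2 * m) := by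
    intro a ha b hb
    have h1 : (1 / 2 : ℝ) • a + (1 / 2 : ℝ) • b ∈ D :=
      h.convexOn.1 ha hb (by norm_num) (by norm_num) (by norm_num)
    have h2 := h.convexOn.2 ha hb (by norm_num : (0 : ℝ) ≤ 1 / 2) (by norm_num : (0 : ℝ) ≤ 1 / 2)
      (by norm_num)
    have h3 := hmle _ h1
    have h4 : ‖(1 / 2 : ℝ) • a + (1 / 2 : ℝ) • b - x‖ ^ 2
        = (‖a - x‖ ^ 2 + ‖b - x‖ ^ 2) / 2 - ‖a - b‖ ^ 2 / 4 := by
      have e1 : (1 / 2 : ℝ) • a + (1 / 2 : ℝ) • b - x = (1 / 2 : ℝ) • ((a - x) + (b - x)) := by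
        module
      have e2 := parallelogram_law_with_norm ℝ (a - x) (b - x)
      rw [e1, norm_smul, mul_pow]
      have e3 : a - x - (b - x) = a - b := by abel
      rw [e3] at e2
      norm_num
      linarith [sq (‖a - x + (b - x)‖)]
    simp only [hF] at h3 ⊢
    rw [h4] at h3
    simp only [smul_eq_mul] at h2
    have h5 := mul_le_mul_of_nonneg_left h2 hl.le
    linarith
  have hex : ∀ k : ℕ, ∃ z ∈ D, F z < m + 1 / ((k : ℝ) + 1) := fun k => by
    obtain ⟨_, ⟨z, hz, rfl⟩, h2⟩ := exists_lt_of_csInf_lt (h.nonempty.image F)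
      (lt_add_of_pos_right m (Nat.one_div_pos_of_nat (n := k)))
    exact ⟨z, hz, h2⟩
  choose z hzD hzF using hex
  have hlim0 : Tendsto (fun k : ℕ => 1 / ((k : ℝ) + 1)) atTop (𝓝 0) :=
    tendsto_one_div_add_atTop_nhds_zero_nat
  have hcau : CauchySeq z := by
    refine cauchySeq_of_le_tendsto_0 (fun k : ℕ => Real.sqrt (8 * (1 / ((k : ℝ) + 1)))) ?_ ?_
    · intro a b N ha hb
      rw [dist_eq_norm]
      refine Real.le_sqrt_of_sq_le ((hmid _ (hzD a) _ (hzD b)).trans ?_)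
      have h1 := hzF a
      have h2 := hzF b
      have h3 : 1 / ((a : ℝ) + 1) ≤ 1 / ((N : ℝ) + 1) := Nat.one_div_le_one_div ha
      have h4 : 1 / ((b : ℝ) + 1) ≤ 1 / ((N : ℝ) + 1) := Nat.one_div_le_one_div hb
      linarith
    · have := (hlim0.const_mul 8).sqrt
      simpa using this
  obtain ⟨y, hy⟩ := cauchySeq_tendsto_of_complete hcau
  -- The upper bounds for `E (z k)` come from solving `F (z k) < m + 1 / (k + 1)` for the energy.
  have hlsc := h.lsc z (fun k => (m + 1 / ((k : ℝ) + 1) - ‖z k - x‖ ^ 2 / 2) / l) y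
    ((m + 0 - ‖y - x‖ ^ 2 / 2) / l)
    (fun k => ⟨hzD k, by
      rw [le_div_iff₀ hl]
      have := hzF k
      simp only [hF] at this
      linarith⟩) hy
    (((hlim0.const_add m).sub (((hy.sub_const x).norm.pow 2).div_const 2)).div_const l)
  obtain ⟨hyD, hyE⟩ := hlsc
  have hyF : F y ≤ m := by
    rw [le_div_iff₀ hl] at hyE
    simp only [hF]
    linarith
  refine ⟨y, hyD, fun w hw => ?_⟩
  -- Minimality is compared with the point at parameter `s` of the segment from `y` to `w` and
  -- divided by `s`; the quadratic error of order `s` then disappears as `s → 0`.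
  have key : ∀ s : ℝ, 0 < s → s ≤ 1 →
      inner ℝ (x - y) (w - y) ≤ l * (E w - E y) + s * (‖w - y‖ ^ 2 / 2) := by
    intro s hs hs1
    have h1 : (1 - s) • y + s • w ∈ D := h.convexOn.1 hyD hw (by linarith) hs.le (by ring)
    have h2 := h.convexOn.2 hyD hw (by linarith : (0 : ℝ) ≤ 1 - s) hs.le (by ring)
    have h3 := hyF.trans (hmle _ h1)
    have h4 : ‖(1 - s) • y + s • w - x‖ ^ 2
        = ‖y - x‖ ^ 2 - 2 * s * inner ℝ (x - y) (w - y) + s ^ 2 * ‖w - y‖ ^ 2 := by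
      have e1 : (1 - s) • y + s • w - x = s • (w - y) - (x - y) := by module
      rw [e1, @norm_sub_sq_real, norm_smul, inner_smul_left, real_inner_comm, mul_pow,
        norm_sub_rev y x]
      simp
      ring
    simp only [hF] at h3
    rw [h4] at h3
    simp only [smul_eq_mul] at h2
    have h5 := mul_le_mul_of_nonneg_left h2 hl.le
    have h6 : s * inner ℝ (x - y) (w - y) ≤ s * (l * (E w - E y) + s * (‖w - y‖ ^ 2 / 2)) := by
      linarith
    exact le_of_mul_le_mul_left h6 hs
  have hc : Tendsto (fun s : ℝ => l * (E w - E y) + s * (‖w - y‖ ^ 2 / 2)) (𝓝[>] 0)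
      (𝓝 (l * (E w - E y) + 0 * (‖w - y‖ ^ 2 / 2))) :=
    ((continuous_const.add (continuous_id.mul continuous_const)).tendsto 0).mono_left
      nhdsWithin_le_nhds
  rw [zero_mul, add_zero] at hc
  refine ge_of_tendsto hc ?_
  filter_upwards [Ioc_mem_nhdsGT (zero_lt_one' ℝ)] with s hs
  exact key s hs.1 hs.2

/-- `IsResolvent D E l J`: the map `J` is the resolvent `(1 + l ∂E)⁻¹`. -/
def IsResolvent (D : Set H) (E : H → ℝ) (l : ℝ) (J : H → H) : Prop :=
  ∀ x, J x ∈ D ∧ ∀ z ∈ D, inner ℝ (x - J x) (z - J x) ≤ l * (E z - E (J x))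

/-- The Yosida approximation of `∂E` associated with the resolvent `J`. -/
noncomputable def yosida (l : ℝ) (J : H → H) (x : H) : H := l⁻¹ • (x - J x)

/-- The Moreau envelope of `E` associated with the resolvent `J`. -/
noncomputable def moreau (E : H → ℝ) (l : ℝ) (J : H → H) (x : H) : ℝ :=
  E (J x) + l / 2 * ‖yosida l J x‖ ^ 2

namespace IsResolvent

variable {D : Set H} {E : H → ℝ} {l : ℝ} {J : H → H}

lemma sub_eq (hl : 0 < l) (x : H) : x - J x = l • yosida l J x := by
  simp [yosida, smul_smul, hl.ne']

/-- The Yosida value at `x` is a subgradient of `E` at `J x`, not at `x` itself. -/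
lemma inner_yosida_le (hJ : IsResolvent D E l J) (hl : 0 < l) (x : H) {z : H} (hz : z ∈ D) :
    inner ℝ (yosida l J x) (z - J x) ≤ E z - E (J x) := by
  have := (hJ x).2 z hz
  rw [sub_eq hl, inner_smul_left] at this
  exact le_of_mul_le_mul_left (by simpa using this) hl

/-- Monotonicity of the subdifferential: add the subgradient inequalities at `J x` and `K y`. Two
different parameters are allowed because regularised flows at different scales are compared later.
-/
lemma inner_yosida_sub_nonneg (hJ : IsResolvent D E l J) (hl : 0 < l) {m : ℝ} {K : H → H}
    (hK : IsResolvent D E m K) (hm : 0 < m) (x y : H) :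
    0 ≤ inner ℝ (yosida l J x - yosida m K y) (J x - K y) := by
  have h1 := hJ.inner_yosida_le hl x (hK y).1
  have h2 := hK.inner_yosida_le hm y (hJ x).1
  have e : inner ℝ (yosida l J x) (K y - J x) = - inner ℝ (yosida l J x) (J x - K y) := by
    rw [← inner_neg_right, neg_sub]
  rw [inner_sub_left]
  linarith

/-- With `a` the difference of the Yosida values, `x - y = (J x - J y) + l • a`. Pairing with `a`
and dropping the monotone part leaves `l * ‖a‖² ≤ ⟪a, x - y⟫`. -/
lemma norm_yosida_sub_le (hJ : IsResolvent D E l J) (hl : 0 < l) (x y : H) :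
    l * ‖yosida l J x - yosida l J y‖ ≤ ‖x - y‖ := by
  have h := hJ.inner_yosida_sub_nonneg hl hJ hl x y
  set a := yosida l J x - yosida l J y with ha
  have e : x - y = (J x - J y) + l • a := by
    rw [ha, smul_sub, ← sub_eq hl, ← sub_eq hl]; abel
  have h1 : l * ‖a‖ ^ 2 ≤ inner ℝ a (x - y) := by
    rw [e, inner_add_right, inner_smul_right, real_inner_self_eq_norm_sq]; linarith
  have h2 := h1.trans (real_inner_le_norm a (x - y))
  rcases eq_or_lt_of_le (norm_nonneg a) with h0 | h0
  · rw [← h0]; simp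
  · exact le_of_mul_le_mul_left (by nlinarith) h0

lemma moreau_le (hJ : IsResolvent D E l J) (hl : 0 < l) {x : H} (hx : x ∈ D) :
    moreau E l J x ≤ E x := by
  have h := hJ.inner_yosida_le hl x hx
  rw [sub_eq hl, inner_smul_right, real_inner_self_eq_norm_sq] at h
  have : 0 ≤ l * ‖yosida l J x‖ ^ 2 := by positivity
  unfold moreau
  linarith

/-- The Yosida value is a subgradient of the envelope at `x`. This is the subgradient inequality at
`J x` combined with the square `l / 2 * ‖yosida l J y - yosida l J x‖² ≥ 0`. -/
lemma moreau_add_inner_le (hJ : IsResolvent D E l J) (hl : 0 < l) (x y : H) :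
    moreau E l J x + inner ℝ (yosida l J x) (y - x) ≤ moreau E l J y := by
  have h := hJ.inner_yosida_le hl x (hJ y).1
  have e : y - x = (J y - J x) + l • (yosida l J y - yosida l J x) := by
    rw [smul_sub, ← sub_eq hl, ← sub_eq hl]; abel
  have h2 : 0 ≤ l / 2 * ‖yosida l J y - yosida l J x‖ ^ 2 := by positivity
  rw [norm_sub_sq_real, real_inner_comm] at h2
  rw [e, inner_add_right, inner_smul_right, inner_sub_right (yosida l J x) (yosida l J y),
    real_inner_self_eq_norm_sq]
  unfold moreau
  linarith

/-- The subgradient inequalities at `x` and at `x + v` trap the remainder between `0` and the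
pairing of `v` with the increment of the Yosida map, which is at most `l⁻¹ * ‖v‖²`. -/
lemma hasFDerivAt_moreau (hJ : IsResolvent D E l J) (hl : 0 < l) (x : H) :
    HasFDerivAt (moreau E l J) (innerSL ℝ (yosida l J x)) x := by
  rw [hasFDerivAt_iff_isLittleO_nhds_zero]
  refine Asymptotics.IsBigO.trans_isLittleO (g := fun h : H => ‖h‖ ^ 2) ?_ ?_
  · refine Asymptotics.IsBigO.of_bound l⁻¹ (Eventually.of_forall fun v => ?_)
    have h1 := hJ.moreau_add_inner_le hl x (x + v)
    have h2 := hJ.moreau_add_inner_le hl (x + v) x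
    have h3 := hJ.norm_yosida_sub_le hl (x + v) x
    have e1 : x - (x + v) = -v := by abel
    rw [add_sub_cancel_left] at h1 h3
    rw [e1, inner_neg_right] at h2
    have h4 := real_inner_le_norm (yosida l J (x + v) - yosida l J x) v
    rw [inner_sub_left] at h4
    have h5 : ‖yosida l J (x + v) - yosida l J x‖ ≤ l⁻¹ * ‖v‖ := by
      rw [inv_mul_eq_div, le_div_iff₀ hl]; linarith
    have h6 := mul_le_mul_of_nonneg_right h5 (norm_nonneg v)
    rw [Real.norm_eq_abs, innerSL_apply_apply, abs_of_nonneg (by linarith), norm_pow, norm_norm]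
    nlinarith
  · have : (fun h : H => ‖h‖ ^ 2) = fun h : H => ‖h - 0‖ ^ 2 := by simp
    rw [this]
    simpa using Asymptotics.isLittleO_pow_sub_sub (0 : H) one_lt_two

end IsResolvent

end ConvexEnergy

/-! ### Global solvability of Lipschitz differential equations -/

section GlobalODE

variable {F : Type*} [NormedAddCommGroup F] [NormedSpace ℝ F]

/-- Integration gains a factor `1 / γ` in the norm weighted by `exp (γ t)`. This turns the Picard
operator into a contraction on the whole half-line at once. -/
lemma norm_intervalIntegral_le_of_norm_le_exp {g : ℝ → F} {C γ τ : ℝ} (hγ : 0 < γ) (hC : 0 ≤ C)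
    (hτ : 0 ≤ τ) (hg : ∀ s, 0 ≤ s → ‖g s‖ ≤ C * Real.exp (γ * s)) :
    ‖∫ s in (0 : ℝ)..τ, g s‖ ≤ C / γ * Real.exp (γ * τ) := by
  have hd : ∀ x ∈ uIcc 0 τ,
      HasDerivAt (fun s => C / γ * Real.exp (γ * s)) (C * Real.exp (γ * x)) x := by
    intro x _
    have := (((hasDerivAt_id x).const_mul γ).exp).const_mul (C / γ)
    convert! this using 1
    simp only [id, mul_one]
    field_simp
  have hi : IntervalIntegrable (fun s => C * Real.exp (γ * s)) volume 0 τ :=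
    (by fun_prop : Continuous fun s => C * Real.exp (γ * s)).intervalIntegrable _ _
  calc ‖∫ s in (0 : ℝ)..τ, g s‖ ≤ ∫ s in (0 : ℝ)..τ, C * Real.exp (γ * s) :=
        intervalIntegral.norm_integral_le_of_norm_le hτ
          (Eventually.of_forall fun s hs => hg s hs.1.le) hi
    _ = C / γ * Real.exp (γ * τ) - C / γ * Real.exp (γ * 0) :=
        intervalIntegral.integral_eq_sub_of_hasDerivAt hd hi
    _ ≤ _ := by
        have : 0 ≤ C / γ * Real.exp (γ * 0) := by positivity
        linarith

/-- Global forward solvability of an autonomous ODE with a Lipschitz right-hand side. -/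
theorem LipschitzWith.exists_forall_hasDerivAt [CompleteSpace F] {B : F → F} {K : ℝ≥0}
    (hB : LipschitzWith K B) (f : F) :
    ∃ u : ℝ → F, u 0 = f ∧ ∀ t, 0 ≤ t → HasDerivAt u (B (u t)) t := by
  -- Any weight larger than `K` works; this one gives the contraction constant `K / (K + 1)`.
  set γ : ℝ := K + 1 with hγ
  have hγ0 : 0 < γ := by positivity
  -- The bounded unknown is `v s = exp (-γ s) • u s`, and `w` undoes the weight. Truncation by `max
  -- s 0` freezes the weight at negative times, which play no role.
  let w : BoundedContinuousFunction ℝ F → ℝ → F := fun v s => Real.exp (γ * max s 0) • v s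
  have hw : ∀ v, Continuous fun s => B (w v s) := fun v =>
    hB.continuous.comp (by have := v.continuous; fun_prop)
  have hw0 : ∀ v s, 0 ≤ s → w v s = Real.exp (γ * s) • v s := fun v s hs => by
    simp only [w, max_eq_left hs]
  let I : BoundedContinuousFunction ℝ F → ℝ → F := fun v t => ∫ s in (0 : ℝ)..t, B (w v s)
  have hId : ∀ v t, HasDerivAt (I v) (B (w v t)) t := fun v t =>
    intervalIntegral.integral_hasDerivAt_right ((hw v).intervalIntegrable _ _)
      ((hw v).stronglyMeasurableAtFilter _ _) (hw v).continuousAt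
  have hIc : ∀ v, Continuous (I v) := fun v =>
    continuous_iff_continuousAt.2 fun t => (hId v t).continuousAt
  have hbound : ∀ v τ, 0 ≤ τ → ‖I v τ‖ ≤ (‖B 0‖ + K * ‖v‖) / γ * Real.exp (γ * τ) := by
    intro v τ hτ
    refine norm_intervalIntegral_le_of_norm_le_exp hγ0 (by positivity) hτ fun s hs => ?_
    have h1 : ‖B (w v s)‖ ≤ ‖B 0‖ + K * ‖w v s‖ := by
      have := hB.dist_le_mul (w v s) 0
      rw [dist_eq_norm, dist_eq_norm, sub_zero] at this
      have h2 := norm_le_norm_add_norm_sub (B 0) (B (w v s))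
      rw [norm_sub_rev] at h2
      linarith
    have h2 : ‖w v s‖ ≤ Real.exp (γ * s) * ‖v‖ := by
      rw [hw0 v s hs, norm_smul, Real.norm_eq_abs, abs_of_pos (Real.exp_pos _)]
      exact mul_le_mul_of_nonneg_left (v.norm_coe_le_norm s) (Real.exp_pos _).le
    have h3 : 1 ≤ Real.exp (γ * s) := Real.one_le_exp (by positivity)
    have h4 := mul_le_mul_of_nonneg_left h2 K.coe_nonneg
    have h5 := mul_le_mul_of_nonneg_left h3 (norm_nonneg (B 0))
    linarith
  let Φ : BoundedContinuousFunction ℝ F → BoundedContinuousFunction ℝ F := fun v =>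
    BoundedContinuousFunction.ofNormedAddCommGroup
      (fun t => Real.exp (-(γ * max t 0)) • (f + I v (max t 0)))
      (by have := hIc v; fun_prop) (‖f‖ + (‖B 0‖ + K * ‖v‖) / γ) (by
        intro t
        have ht : 0 ≤ max t 0 := le_max_right _ _
        rw [norm_smul, Real.norm_eq_abs, abs_of_pos (Real.exp_pos _)]
        have h1 := norm_add_le f (I v (max t 0))
        have h2 := hbound v _ ht
        have h3 : Real.exp (-(γ * max t 0)) ≤ 1 := Real.exp_le_one_iff.2 (by
          have : 0 ≤ γ * max t 0 := by positivity
          linarith)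
        have h4 : Real.exp (-(γ * max t 0)) * Real.exp (γ * max t 0) = 1 := by
          rw [← Real.exp_add]; simp
        calc Real.exp (-(γ * max t 0)) * ‖f + I v (max t 0)‖
            ≤ Real.exp (-(γ * max t 0)) *
              (‖f‖ + (‖B 0‖ + K * ‖v‖) / γ * Real.exp (γ * max t 0)) :=
              mul_le_mul_of_nonneg_left (by linarith) (Real.exp_pos _).le
          _ = Real.exp (-(γ * max t 0)) * ‖f‖ + (‖B 0‖ + K * ‖v‖) / γ *
              (Real.exp (-(γ * max t 0)) * Real.exp (γ * max t 0)) := by ring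
          _ ≤ _ := by
              rw [h4, mul_one]
              have := mul_le_mul_of_nonneg_right h3 (norm_nonneg f)
              linarith)
  have hΦ : ContractingWith (K / (K + 1)) Φ := by
    refine ⟨by rw [div_lt_one (by positivity)]; simp, LipschitzWith.of_dist_le_mul fun v v' => ?_⟩
    rw [BoundedContinuousFunction.dist_le (by positivity)]
    intro t
    have ht : 0 ≤ max t 0 := le_max_right _ _
    have hdiff : Φ v t - Φ v' t = Real.exp (-(γ * max t 0)) •
        ∫ s in (0 : ℝ)..(max t 0), (B (w v s) - B (w v' s)) := by
      rw [intervalIntegral.integral_sub ((hw v).intervalIntegrable _ _)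
        ((hw v').intervalIntegrable _ _)]
      change Real.exp (-(γ * max t 0)) • (f + I v (max t 0))
        - Real.exp (-(γ * max t 0)) • (f + I v' (max t 0)) = _
      rw [← smul_sub, add_sub_add_left_eq_sub]
    have hb : ‖∫ s in (0 : ℝ)..(max t 0), (B (w v s) - B (w v' s))‖
        ≤ (K * dist v v') / γ * Real.exp (γ * max t 0) := by
      refine norm_intervalIntegral_le_of_norm_le_exp hγ0 (by positivity) ht fun s hs => ?_
      rw [← dist_eq_norm]
      refine (hB.dist_le_mul _ _).trans ?_
      rw [hw0 v s hs, hw0 v' s hs, dist_smul₀, Real.norm_eq_abs, abs_of_pos (Real.exp_pos _)]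
      have h1 := mul_le_mul_of_nonneg_left (BoundedContinuousFunction.dist_coe_le_dist
        (f := v) (g := v') s) (Real.exp_pos (γ * s)).le
      have h2 := mul_le_mul_of_nonneg_left h1 K.coe_nonneg
      linarith
    rw [dist_eq_norm, hdiff, norm_smul, Real.norm_eq_abs, abs_of_pos (Real.exp_pos _)]
    calc _ ≤ Real.exp (-(γ * max t 0)) * ((K * dist v v') / γ * Real.exp (γ * max t 0)) :=
          mul_le_mul_of_nonneg_left hb (Real.exp_pos _).le
      _ = (K * dist v v') / γ * (Real.exp (-(γ * max t 0)) * Real.exp (γ * max t 0)) := by ring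
      _ = _ := by
          rw [← Real.exp_add]
          simp [hγ]
          ring
  set v := hΦ.fixedPoint with hv
  have hfix : Φ v = v := hΦ.fixedPoint_isFixedPt
  have hu : ∀ t, 0 ≤ t → w v t = f + I v t := by
    intro t ht
    have h1 : v t = Real.exp (-(γ * max t 0)) • (f + I v (max t 0)) := by
      conv_lhs => rw [← hfix]
      rfl
    rw [max_eq_left ht] at h1
    rw [hw0 v t ht, h1, smul_smul, ← Real.exp_add]
    simp
  -- The integral form is returned instead of `w v`, with which it agrees for `t ≥ 0`, because it
  -- has a two-sided derivative also at `t = 0`.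
  refine ⟨fun t => f + I v t, by simp [I], fun t ht => ?_⟩
  change HasDerivAt (fun t => f + I v t) (B (f + I v t)) t
  rw [← hu t ht]
  exact (hId v t).const_add f

end GlobalODE

/-! ### Weak limits of bounded sequences -/

section WeakLimit

/-- Bounded sequences in a Hilbert space converge weakly along an ultrafilter. -/
lemma exists_forall_tendsto_inner_of_bounded {K : Type*} [NormedAddCommGroup K]
    [InnerProductSpace ℝ K] [CompleteSpace K] (a : ℕ → K) {R : ℝ} (ha : ∀ k, ‖a k‖ ≤ R) :
    ∃ b : K, ∀ ψ : K,
      Tendsto (fun k => inner ℝ (a k) ψ) (hyperfilter ℕ : Filter ℕ) (𝓝 (inner ℝ b ψ)) := by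
  -- Each scalar sequence stays in a compact ball, so it converges along the ultrafilter. The same
  -- filter serves every `ψ`, which replaces a diagonal choice of subsequences. The limit is then a
  -- bounded linear functional of `ψ`, represented by Riesz.
  have hlim : ∀ ψ : K, ∃ y : ℝ, Tendsto (fun k => inner ℝ (a k) ψ) (hyperfilter ℕ : Filter ℕ)
      (𝓝 y) := by
    intro ψ
    have hc : IsCompact (Metric.closedBall (0 : ℝ) (R * ‖ψ‖)) := isCompact_closedBall _ _
    obtain ⟨y, _, hy⟩ := isCompact_iff_ultrafilter_le_nhds.1 hc
      ((hyperfilter ℕ).map fun k => inner ℝ (a k) ψ) (by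
        rw [Filter.le_principal_iff]
        refine Filter.mem_map.2 (Filter.univ_mem' fun k => ?_)
        simp only [mem_preimage, Metric.mem_closedBall, dist_zero_right]
        exact (norm_inner_le_norm (a k) ψ).trans
          (mul_le_mul_of_nonneg_right (ha k) (norm_nonneg _)))
    exact ⟨y, hy⟩
  choose L hL using hlim
  let Λ : K →ₗ[ℝ] ℝ :=
    { toFun := L
      map_add' := fun x y => tendsto_nhds_unique (hL (x + y)) (by
        simpa only [inner_add_right] using (hL x).add (hL y))
      map_smul' := fun c x => tendsto_nhds_unique (hL (c • x)) (by
        simpa only [inner_smul_right, RingHom.id_apply, smul_eq_mul] using (hL x).const_mul c) }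
  have hΛ : ∀ x, ‖Λ x‖ ≤ R * ‖x‖ := fun x =>
    le_of_tendsto (hL x).norm (Eventually.of_forall fun k => (norm_inner_le_norm (a k) x).trans
      (mul_le_mul_of_nonneg_right (ha k) (norm_nonneg _)))
  refine ⟨(InnerProductSpace.toDual ℝ K).symm (Λ.mkContinuous R hΛ), fun ψ => ?_⟩
  rw [InnerProductSpace.toDual_symm_apply]
  exact hL ψ

end WeakLimit

/-! ### The regularised gradient flow: dissipation, comparison, variational inequality -/

section YosidaFlow

variable {H : Type*} [NormedAddCommGroup H] [InnerProductSpace ℝ H]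
variable {D : Set H} {E : H → ℝ} {l m : ℝ} {J K : H → H} {u w : ℝ → H}

/-- `u` solves the regularised gradient flow `u' = - A u` for `t ≥ 0`, where `A` is the Yosida
approximation. -/
def IsYosidaFlow (l : ℝ) (J : H → H) (u : ℝ → H) : Prop :=
  ∀ t, 0 ≤ t → HasDerivAt u (-yosida l J (u t)) t

lemma IsYosidaFlow.continuousOn (hu : IsYosidaFlow l J u) : ContinuousOn u (Ici 0) :=
  fun t ht => (hu t ht).continuousAt.continuousWithinAt

lemma IsResolvent.continuous_yosida (hJ : IsResolvent D E l J) (hl : 0 < l) :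
    Continuous (yosida l J) := by
  refine (LipschitzWith.of_dist_le_mul (K := l.toNNReal⁻¹) fun x y => ?_).continuous
  rw [dist_eq_norm, dist_eq_norm, NNReal.coe_inv, Real.coe_toNNReal l hl.le, inv_mul_eq_div, le_div_iff₀ hl]
  linarith [hJ.norm_yosida_sub_le hl x y]

lemma IsResolvent.exists_isYosidaFlow [CompleteSpace H] (hJ : IsResolvent D E l J) (hl : 0 < l)
    (f : H) : ∃ u : ℝ → H, u 0 = f ∧ IsYosidaFlow l J u := by
  have hL : LipschitzWith l.toNNReal⁻¹ fun x => -yosida l J x := by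
    refine LipschitzWith.of_dist_le_mul fun x y => ?_
    rw [dist_neg_neg, dist_eq_norm, dist_eq_norm, NNReal.coe_inv, Real.coe_toNNReal l hl.le, inv_mul_eq_div,
      le_div_iff₀ hl]
    linarith [hJ.norm_yosida_sub_le hl x y]
  exact hL.exists_forall_hasDerivAt f

lemma IsYosidaFlow.hasDerivAt_moreau (hu : IsYosidaFlow l J u) (hJ : IsResolvent D E l J)
    (hl : 0 < l) {t : ℝ} (ht : 0 ≤ t) :
    HasDerivAt (fun s => moreau E l J (u s)) (-‖yosida l J (u t)‖ ^ 2) t := by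
  have := (hJ.hasFDerivAt_moreau hl (u t)).comp_hasDerivAt t (hu t ht)
  convert! this using 1
  simp [innerSL_apply_apply, inner_neg_right]

lemma antitoneOn_Ici_of_hasDerivAt_nonpos {g g' : ℝ → ℝ} {a : ℝ}
    (hg : ∀ t, a ≤ t → HasDerivAt g (g' t) t) (hg' : ∀ t, a ≤ t → g' t ≤ 0) :
    AntitoneOn g (Ici a) := by
  refine antitoneOn_of_hasDerivWithinAt_nonpos (f' := g') (convex_Ici a)
    (fun t ht => (hg t ht).continuousAt.continuousWithinAt) ?_ ?_
  · intro t ht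
    rw [interior_Ici] at ht
    exact (hg t ht.le).hasDerivWithinAt
  · intro t ht
    rw [interior_Ici] at ht
    exact hg' t ht.le

lemma IsYosidaFlow.antitoneOn_moreau (hu : IsYosidaFlow l J u) (hJ : IsResolvent D E l J)
    (hl : 0 < l) : AntitoneOn (fun s => moreau E l J (u s)) (Ici 0) :=
  antitoneOn_Ici_of_hasDerivAt_nonpos (fun _ ht => hu.hasDerivAt_moreau hJ hl ht)
    fun t _ => by have := sq_nonneg ‖yosida l J (u t)‖; linarith

lemma hasDerivAt_half_norm_sq {u : ℝ → H} {u' : H} {t : ℝ} (hu : HasDerivAt u u' t) (y : H) :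
    HasDerivAt (fun s => ‖u s - y‖ ^ 2 / 2) (inner ℝ u' (u t - y)) t := by
  have := ((hu.sub_const y).norm_sq).div_const 2
  convert! this using 1
  rw [real_inner_comm]
  ring

lemma IsConvexEnergy.moreau_nonneg (h : IsConvexEnergy D E) (hJ : IsResolvent D E l J)
    (x : H) : l / 2 * ‖yosida l J x‖ ^ 2 ≤ moreau E l J x := by
  have := h.nonneg _ (hJ x).1
  unfold moreau
  linarith

/-- Yosida flows with different parameters stay close to each other. -/
lemma IsYosidaFlow.norm_sub_sq_le (h : IsConvexEnergy D E) (hu : IsYosidaFlow l J u)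
    (hJ : IsResolvent D E l J) (hl : 0 < l) (hw : IsYosidaFlow m K w) (hK : IsResolvent D E m K)
    (hm : 0 < m) {f : H} (hf : f ∈ D) (hu0 : u 0 = f) (hw0 : w 0 = f) {t : ℝ} (ht : 0 ≤ t) :
    ‖u t - w t‖ ^ 2 ≤ (l + m) / 2 * E f := by
  -- Besides a monotone term, the derivative of `‖u - w‖² / 2` contains `-(l‖a‖² + m‖b‖² - (l +
  -- m)⟪a, b⟫)`, with `a`, `b` the Yosida values, which may be positive. The envelopes decay at
  -- rates `‖a‖²` and `‖b‖²`; the crossed weights `m / 4`, `l / 4` complete the squares `l (‖a‖ -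
  -- ‖b‖/2)²` and `m (‖b‖ - ‖a‖/2)²`.
  have hd : ∀ s, 0 ≤ s → HasDerivAt (fun s => ‖u s - w s‖ ^ 2 / 2
      + (l / 4 * moreau E m K (w s) + m / 4 * moreau E l J (u s)))
      (inner ℝ (-yosida l J (u s) - -yosida m K (w s)) (u s - w s)
        + (l / 4 * (-‖yosida m K (w s)‖ ^ 2) + m / 4 * (-‖yosida l J (u s)‖ ^ 2))) s := by
    intro s hs
    have h1 := hasDerivAt_half_norm_sq ((hu s hs).sub (hw s hs)) 0
    simp only [sub_zero] at h1
    exact h1.add (((hw.hasDerivAt_moreau hK hm hs).const_mul _).add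
      ((hu.hasDerivAt_moreau hJ hl hs).const_mul _))
  have hanti := antitoneOn_Ici_of_hasDerivAt_nonpos hd (fun s hs => by
    set a := yosida l J (u s) with ha
    set b := yosida m K (w s) with hb
    have h1 := hJ.inner_yosida_sub_nonneg hl hK hm (u s) (w s)
    have e : u s - w s = (J (u s) - K (w s)) + (l • a - m • b) := by
      rw [ha, hb, ← IsResolvent.sub_eq hl, ← IsResolvent.sub_eq hm]; abel
    have e2 : -a - -b = -(a - b) := by abel
    have h2 : inner ℝ (a - b) (l • a - m • b)
        = l * ‖a‖ ^ 2 + m * ‖b‖ ^ 2 - (l + m) * inner ℝ a b := by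
      rw [inner_sub_left, inner_sub_right, inner_sub_right, inner_smul_right, inner_smul_right,
        inner_smul_right, inner_smul_right, real_inner_self_eq_norm_sq,
        real_inner_self_eq_norm_sq, real_inner_comm a b]
      ring
    have h3 := real_inner_le_norm a b
    have h4 : (l + m) * inner ℝ a b ≤ (l + m) * (‖a‖ * ‖b‖) :=
      mul_le_mul_of_nonneg_left h3 (by linarith)
    have h5 : 0 ≤ l * (‖a‖ - ‖b‖ / 2) ^ 2 := by positivity
    have h6 : 0 ≤ m * (‖b‖ - ‖a‖ / 2) ^ 2 := by positivity
    rw [e2, inner_neg_left, e, inner_add_right, h2]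
    nlinarith)
  have h1 := hanti (mem_Ici.2 le_rfl) (mem_Ici.2 ht) ht
  simp only [hu0, hw0, sub_self, norm_zero] at h1
  have h2 := h.moreau_nonneg hK (w t)
  have h3 := h.moreau_nonneg hJ (u t)
  have h4 : 0 ≤ moreau E m K (w t) := le_trans (by positivity) h2
  have h5 : 0 ≤ moreau E l J (u t) := le_trans (by positivity) h3
  have h6 := mul_le_mul_of_nonneg_left (hK.moreau_le hm hf) (by positivity : 0 ≤ l / 4)
  have h7 := mul_le_mul_of_nonneg_left (hJ.moreau_le hl hf) (by positivity : 0 ≤ m / 4)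
  have h8 : 0 ≤ l / 4 * moreau E m K (w t) := by positivity
  have h9 : 0 ≤ m / 4 * moreau E l J (u t) := by positivity
  norm_num at h1
  linarith

/-- Evolution variational inequality for the Yosida flow. -/
lemma IsYosidaFlow.evolution_variational_ineq (hu : IsYosidaFlow l J u)
    (hJ : IsResolvent D E l J) (hl : 0 < l) {y : H} (hy : y ∈ D) {s t : ℝ} (hs : 0 ≤ s)
    (hst : s ≤ t) :
    ‖u t - y‖ ^ 2 / 2 - ‖u s - y‖ ^ 2 / 2 ≤ (t - s) * (E y - moreau E l J (u t)) := by
  -- The envelope is taken at the final time: it decreases along the flow, so the constant `c`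
  -- bounds the derivative of `‖u - y‖² / 2` on all of `[s, t]`.
  set c := E y - moreau E l J (u t) with hc
  have hd : ∀ r, s ≤ r → HasDerivAt (fun r => ‖u r - y‖ ^ 2 / 2 - r * c)
      (inner ℝ (-yosida l J (u r)) (u r - y) - c) r := fun r hr => by
    have := (hasDerivAt_half_norm_sq (hu r (hs.trans hr)) y).sub ((hasDerivAt_id r).mul_const c)
    convert! this using 1
    simp
  have hanti : AntitoneOn (fun r => ‖u r - y‖ ^ 2 / 2 - r * c) (Icc s t) := by
    refine antitoneOn_of_hasDerivWithinAt_nonpos (convex_Icc s t)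
      (fun r hr => (hd r hr.1).continuousAt.continuousWithinAt)
      (fun r hr => (hd r (interior_subset hr).1).hasDerivWithinAt) fun r hr => ?_
    have hr' := interior_subset hr
    have h1 := hJ.moreau_add_inner_le hl (u r) y
    have h2 := hJ.moreau_le hl hy
    have h3 := hu.antitoneOn_moreau hJ hl (mem_Ici.2 (hs.trans hr'.1))
      (mem_Ici.2 (hs.trans hst)) hr'.2
    have e : inner ℝ (-yosida l J (u r)) (u r - y) = inner ℝ (yosida l J (u r)) (y - u r) := by
      rw [inner_neg_left, ← inner_neg_right, neg_sub]
    simp only at h3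
    rw [e]
    linarith
  have := hanti (left_mem_Icc.2 hst) (right_mem_Icc.2 hst) hst
  simp only at this
  linarith

lemma IsYosidaFlow.integral_norm_sq (hu : IsYosidaFlow l J u)
    (hJ : IsResolvent D E l J) (hl : 0 < l) {t : ℝ} (ht : 0 ≤ t) :
    ∫ s in (0 : ℝ)..t, ‖yosida l J (u s)‖ ^ 2 = moreau E l J (u 0) - moreau E l J (u t) := by
  have hc : ContinuousOn (fun s => ‖yosida l J (u s)‖ ^ 2) (uIcc 0 t) := by
    rw [uIcc_of_le ht]
    exact (((hJ.continuous_yosida hl).comp_continuousOn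
      (hu.continuousOn.mono Icc_subset_Ici_self)).norm.pow 2)
  have := intervalIntegral.integral_eq_sub_of_hasDerivAt
    (f := fun s => - moreau E l J (u s)) (f' := fun s => ‖yosida l J (u s)‖ ^ 2) (a := 0) (b := t)
    (fun s hs => by
      rw [uIcc_of_le ht] at hs
      have := (hu.hasDerivAt_moreau hJ hl hs.1).neg
      rw [neg_neg] at this
      exact this) hc.intervalIntegrable
  rw [this]
  ring

lemma IsYosidaFlow.sub_eq_integral [CompleteSpace H] (hu : IsYosidaFlow l J u)
    (hJ : IsResolvent D E l J) (hl : 0 < l) {t : ℝ} (ht : 0 ≤ t) :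
    u t - u 0 = ∫ s in (0 : ℝ)..t, -yosida l J (u s) := by
  have hc : ContinuousOn (fun s => -yosida l J (u s)) (uIcc 0 t) := by
    rw [uIcc_of_le ht]
    exact ((hJ.continuous_yosida hl).comp_continuousOn
      (hu.continuousOn.mono Icc_subset_Ici_self)).neg
  exact (intervalIntegral.integral_eq_sub_of_hasDerivAt (fun s hs => by
      rw [uIcc_of_le ht] at hs
      exact hu s hs.1) hc.intervalIntegrable).symm

end YosidaFlow

/-! ### Passage to the limit: the gradient flow of a convex energy -/

section GradientFlow

variable {H : Type*} [NormedAddCommGroup H] [InnerProductSpace ℝ H]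
variable {D : Set H} {E : H → ℝ} {l : ℝ} {J : H → H} {u : ℝ → H} {f : H}

/-- The total dissipation is the drop of the nonnegative envelope, which starts at or below `E f`.
The bound does not depend on `l`, which yields a weak limit of the velocities. -/
lemma IsYosidaFlow.integrableOn_norm_sq (h : IsConvexEnergy D E) (hu : IsYosidaFlow l J u)
    (hJ : IsResolvent D E l J) (hl : 0 < l) (hf : f ∈ D) (hu0 : u 0 = f) :
    IntegrableOn (fun s => ‖yosida l J (u s)‖ ^ 2) (Ioi 0) ∧
      ∫ s in Ioi (0 : ℝ), ‖yosida l J (u s)‖ ^ 2 ≤ E f := by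
  have hc : ContinuousOn (fun s => ‖yosida l J (u s)‖ ^ 2) (Ici 0) :=
    ((hJ.continuous_yosida hl).comp_continuousOn hu.continuousOn).norm.pow 2
  have hb : ∀ t : ℝ, 0 ≤ t → ∫ s in (0 : ℝ)..t, ‖yosida l J (u s)‖ ^ 2 ≤ E f := by
    intro t ht
    rw [hu.integral_norm_sq hJ hl ht, hu0]
    have h1 := h.moreau_nonneg hJ (u t)
    have h2 : 0 ≤ l / 2 * ‖yosida l J (u t)‖ ^ 2 := by positivity
    linarith [hJ.moreau_le hl hf]
  have hi : IntegrableOn (fun s => ‖yosida l J (u s)‖ ^ 2) (Ioi 0) := by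
    refine integrableOn_Ioi_of_intervalIntegral_norm_bounded (l := atTop) (b := fun t : ℝ => t)
      (E f) 0 (fun t => ?_) tendsto_id ?_
    · exact ((hc.mono Icc_subset_Ici_self).integrableOn_Icc).mono_set Ioc_subset_Icc_self
    · filter_upwards [eventually_ge_atTop 0] with t ht
      simpa using hb t ht
  refine ⟨hi, le_of_tendsto (intervalIntegral_tendsto_integral_Ioi 0 hi tendsto_id) ?_⟩
  filter_upwards [eventually_ge_atTop 0] with t ht
  exact hb t ht

lemma IsYosidaFlow.memLp (h : IsConvexEnergy D E) (hu : IsYosidaFlow l J u)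
    (hJ : IsResolvent D E l J) (hl : 0 < l) (hf : f ∈ D) (hu0 : u 0 = f) :
    MemLp (fun s => -yosida l J (u s)) 2 (volume.restrict (Ioi 0)) := by
  have hm : AEStronglyMeasurable (fun s => -yosida l J (u s)) (volume.restrict (Ioi 0)) :=
    (((hJ.continuous_yosida hl).comp_continuousOn
      (hu.continuousOn.mono Ioi_subset_Ici_self)).neg).aestronglyMeasurable measurableSet_Ioi
  rw [memLp_two_iff_integrable_sq_norm hm]
  simp only [norm_neg]
  exact (hu.integrableOn_norm_sq h hJ hl hf hu0).1

/-- The gradient flow of a convex energy: existence of a curve satisfying the evolution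
variational inequality, with a square integrable velocity. -/
theorem IsConvexEnergy.exists_evolution_variational_ineq [CompleteSpace H]
    (h : IsConvexEnergy D E) (hf : f ∈ D) :
    ∃ u a : ℝ → H, u 0 = f ∧ (∀ t, 0 ≤ t → u t ∈ D) ∧
      (∀ y ∈ D, ∀ s t, 0 ≤ s → s ≤ t →
        ‖u t - y‖ ^ 2 / 2 - ‖u s - y‖ ^ 2 / 2 ≤ (t - s) * (E y - E (u t))) ∧
      MemLp a 2 (volume.restrict (Ioi 0)) ∧
      ∀ t, 0 ≤ t → u t = f + ∫ s in (0 : ℝ)..t, a s := by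
  let l : ℕ → ℝ := fun k => 1 / ((k : ℝ) + 1)
  have hl : ∀ k, 0 < l k := fun k => Nat.one_div_pos_of_nat
  have hl0 : Tendsto l atTop (𝓝 0) := tendsto_one_div_add_atTop_nhds_zero_nat
  have hJex : ∀ k, ∃ J : H → H, IsResolvent D E (l k) J := fun k => by
    choose J h1 h2 using h.exists_resolvent (hl k)
    exact ⟨J, fun x => ⟨h1 x, h2 x⟩⟩
  choose J hJ using hJex
  choose v hv0 hv using fun k => (hJ k).exists_isYosidaFlow (hl k) f
  have hEf : 0 ≤ E f := h.nonneg f hf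
  have hdist : ∀ t, 0 ≤ t → CauchySeq fun k => v k t := by
    intro t ht
    refine cauchySeq_of_le_tendsto_0 (fun k => Real.sqrt (l k * E f)) ?_ ?_
    · intro i j N hi hj
      rw [dist_eq_norm]
      refine Real.le_sqrt_of_sq_le (((hv i).norm_sub_sq_le h (hJ i) (hl i) (hv j) (hJ j) (hl j)
        hf (hv0 i) (hv0 j) ht).trans ?_)
      have h1 : l i ≤ l N := Nat.one_div_le_one_div hi
      have h2 : l j ≤ l N := Nat.one_div_le_one_div hj
      exact mul_le_mul_of_nonneg_right (by linarith) hEf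
    · simpa using (hl0.mul_const (E f)).sqrt
  have hlim : ∀ t : ℝ, ∃ x, Tendsto (fun k => v k (max t 0)) atTop (𝓝 x) := fun t =>
    cauchySeq_tendsto_of_complete (hdist _ (le_max_right _ _))
  choose u hu using hlim
  have hu' : ∀ t, 0 ≤ t → Tendsto (fun k => v k t) atTop (𝓝 (u t)) := fun t ht => by
    simpa [max_eq_left ht] using hu t
  have hu0 : u 0 = f := tendsto_nhds_unique (hu' 0 le_rfl) (by simp [hv0])
  -- Lower semicontinuity needs points of `D`, so the limit is taken along the resolvents `J k (v k
  -- t)` instead of `v k t`. Their distance satisfies `‖v - J v‖² = l² ‖yosida‖² ≤ 2 l E f`.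
  have hJlim : ∀ t, 0 ≤ t → Tendsto (fun k => J k (v k t)) atTop (𝓝 (u t)) := by
    intro t ht
    have h1 : Tendsto (fun k => v k t - J k (v k t)) atTop (𝓝 0) := by
      refine squeeze_zero_norm (a := fun k => Real.sqrt (2 * l k * E f)) (fun k => ?_) ?_
      · refine Real.le_sqrt_of_sq_le ?_
        have h2 := (h.moreau_nonneg (hJ k) (v k t)).trans
          ((hv k).antitoneOn_moreau (hJ k) (hl k) (mem_Ici.2 le_rfl) (mem_Ici.2 ht) ht)
        simp only [hv0] at h2
        have h3 := h2.trans ((hJ k).moreau_le (hl k) hf)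
        rw [IsResolvent.sub_eq (hl k), norm_smul, mul_pow, Real.norm_eq_abs, sq_abs]
        nlinarith [hl k]
      · simpa using ((hl0.const_mul 2).mul_const (E f)).sqrt
    simpa using (hu' t ht).sub h1
  have hJM : ∀ k x, E (J k x) ≤ moreau E (l k) (J k) x := fun k x => by
    have : 0 ≤ l k / 2 * ‖yosida (l k) (J k) x‖ ^ 2 := by have := hl k; positivity
    unfold moreau; linarith
  have huD : ∀ t, 0 ≤ t → u t ∈ D := fun t ht =>
    (h.lsc (fun k => J k (v k t)) (fun _ => E f) (u t) (E f) (fun k => ⟨(hJ k _).1, by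
      have h2 := (hv k).antitoneOn_moreau (hJ k) (hl k) (mem_Ici.2 le_rfl) (mem_Ici.2 ht) ht
      simp only [hv0] at h2
      exact (hJM k _).trans (h2.trans ((hJ k).moreau_le (hl k) hf))⟩) (hJlim t ht)
      tendsto_const_nhds).1
  have hevi : ∀ y ∈ D, ∀ s t, 0 ≤ s → s ≤ t →
      ‖u t - y‖ ^ 2 / 2 - ‖u s - y‖ ^ 2 / 2 ≤ (t - s) * (E y - E (u t)) := by
    intro y hy s t hs hst
    rcases eq_or_lt_of_le hst with rfl | hst'
    · simp
    have ht := hs.trans hst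
    have hpos : 0 < t - s := sub_pos.2 hst'
    -- The variational inequality of the regularised flow is solved for the energy at time `t`, and
    -- so becomes a convergent upper bound.
    have := (h.lsc (fun k => J k (v k t))
      (fun k => E y - (‖v k t - y‖ ^ 2 / 2 - ‖v k s - y‖ ^ 2 / 2) / (t - s)) (u t)
      (E y - (‖u t - y‖ ^ 2 / 2 - ‖u s - y‖ ^ 2 / 2) / (t - s)) (fun k => ⟨(hJ k _).1, by
        have h1 := (hv k).evolution_variational_ineq (hJ k) (hl k) hy hs hst
        have h2 := hJM k (v k t)
        have h3 : (‖v k t - y‖ ^ 2 / 2 - ‖v k s - y‖ ^ 2 / 2) / (t - s)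
            ≤ E y - moreau E (l k) (J k) (v k t) := by
          rw [div_le_iff₀ hpos]; linarith
        linarith⟩) (hJlim t ht)
        (((((((hu' t ht).sub_const y).norm.pow 2).div_const 2).sub
          ((((hu' s hs).sub_const y).norm.pow 2).div_const 2)).div_const _).const_sub _)).2
    have h3 : (‖u t - y‖ ^ 2 / 2 - ‖u s - y‖ ^ 2 / 2) / (t - s) ≤ E y - E (u t) := by linarith
    rw [div_le_iff₀ hpos] at h3
    linarith
  let a : ℕ → Lp H 2 (volume.restrict (Ioi (0 : ℝ))) := fun k =>
    ((hv k).memLp h (hJ k) (hl k) hf (hv0 k)).toLp _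
  have ha : ∀ k, (a k : ℝ → H) =ᵐ[volume.restrict (Ioi 0)] fun s => -yosida (l k) (J k) (v k s) :=
    fun k => MemLp.coeFn_toLp _
  have hab : ∀ k, ‖a k‖ ≤ Real.sqrt (E f) := by
    intro k
    refine Real.le_sqrt_of_sq_le ?_
    rw [← real_inner_self_eq_norm_sq, L2.inner_def]
    refine le_trans (le_of_eq (integral_congr_ae ?_))
      ((hv k).integrableOn_norm_sq h (hJ k) (hl k) hf (hv0 k)).2
    filter_upwards [ha k] with s hs
    rw [real_inner_self_eq_norm_sq, hs, norm_neg]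
  obtain ⟨b, hb⟩ := exists_forall_tendsto_inner_of_bounded a hab
  refine ⟨u, b, hu0, huD, hevi, Lp.memLp b, fun t ht => ?_⟩
  have hsub : ∀ g : ℝ → H, ∫ s in Ioc 0 t, g s ∂(volume.restrict (Ioi 0))
      = ∫ s in (0 : ℝ)..t, g s := fun g => by
    rw [intervalIntegral.integral_of_le ht, Measure.restrict_restrict measurableSet_Ioc,
      inter_eq_left.2 Ioc_subset_Ioi_self]
  have hfin : (volume.restrict (Ioi (0 : ℝ))) (Ioc 0 t) ≠ ⊤ :=
    ((Measure.restrict_apply_le _ _).trans_lt (by simp)).ne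
  rw [← sub_eq_iff_eq_add']
  refine ext_inner_left ℝ fun x => ?_
  -- Testing the weak convergence of velocities with `x` times the indicator of `(0, t]` yields the
  -- increments `v k t - f`, whose strong limit is already known.
  have h1 := hb (indicatorConstLp 2 measurableSet_Ioc hfin x)
  have h2 : ∀ k, inner ℝ (a k) (indicatorConstLp 2 measurableSet_Ioc hfin x)
      = inner ℝ x (v k t - f) := fun k => by
    rw [real_inner_comm, L2.inner_indicatorConstLp_eq_inner_setIntegral,
      integral_congr_ae (ae_restrict_of_ae (ha k)), hsub,
      ← (hv k).sub_eq_integral (hJ k) (hl k) ht, hv0]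
  simp only [h2] at h1
  rw [real_inner_comm, L2.inner_indicatorConstLp_eq_inner_setIntegral, hsub] at h1
  refine tendsto_nhds_unique (f := fun k => inner ℝ x (v k t - f))
    (l := (hyperfilter ℕ : Filter ℕ)) ?_ h1
  exact (tendsto_const_nhds.inner ((hu' t ht).sub_const f)).mono_left Nat.hyperfilter_le_atTop

/-- Left difference quotients suffice at a point of differentiability. This is how inequalities
comparing a time only with earlier times are differentiated. -/
lemma HasDerivAt.le_of_sub_le_left {g : ℝ → ℝ} {g' c t : ℝ} (hg : HasDerivAt g g' t)
    (h : ∀ᶠ s in 𝓝[<] t, g t - g s ≤ (t - s) * c) : g' ≤ c := by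
  have h1 : Tendsto (slope g t) (𝓝[<] t) (𝓝 g') :=
    (hasDerivAt_iff_tendsto_slope.1 hg).mono_left (nhdsWithin_mono _ fun x hx => ne_of_lt hx)
  refine le_of_tendsto h1 ?_
  filter_upwards [h, self_mem_nhdsWithin] with s hs hst
  have hst' : 0 < t - s := sub_pos.2 hst
  rw [slope_comm, slope_def_field, div_le_iff₀ hst']
  linarith

/-- The gradient flow of a convex energy starting in its effective domain. -/
theorem IsConvexEnergy.exists_gradientFlow [CompleteSpace H]
    (h : IsConvexEnergy D E) (hf : f ∈ D) :
    ∃ u a : ℝ → H, u 0 = f ∧ Continuous u ∧ StronglyMeasurable a ∧ MemLp a 2 volume ∧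
      (∀ t, 0 ≤ t → u t = f + ∫ s in (0 : ℝ)..t, a s) ∧
      (∀ t, 0 ≤ t → u t ∈ D) ∧
      (∀ t, 0 ≤ t → (∫ s in (0 : ℝ)..t, ‖a s‖ ^ 2) + E (u t) ≤ E f) ∧
      ∀ᵐ t ∂(volume.restrict (Ioi (0 : ℝ))), ∀ y ∈ D,
        E (u t) + inner ℝ (-a t) (y - u t) ≤ E y := by
  obtain ⟨v, b, hv0, hvD, hevi, hb, hvb⟩ := h.exists_evolution_variational_ineq hf
  -- A strongly measurable velocity defined on the whole line allows Lebesgue differentiation of its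
  -- primitive and later a jointly measurable representative.
  set a : ℝ → H := (Ioi (0 : ℝ)).indicator (hb.1.mk b) with ha
  have hab : ∀ᵐ t ∂(volume.restrict (Ioi (0 : ℝ))), b t = a t := by
    filter_upwards [hb.1.ae_eq_mk, ae_restrict_mem measurableSet_Ioi] with t ht ht0
    rw [ha, indicator_of_mem ht0, ht]
  have ham : StronglyMeasurable a := hb.1.stronglyMeasurable_mk.indicator measurableSet_Ioi
  have ha2 : MemLp a 2 volume :=
    (memLp_indicator_iff_restrict measurableSet_Ioi).2 (hb.ae_eq hb.1.ae_eq_mk)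
  have haloc : LocallyIntegrable a volume := ha2.locallyIntegrable (by norm_num)
  set u : ℝ → H := fun t => f + ∫ s in (0 : ℝ)..t, a s with hu
  have huv : ∀ t, 0 ≤ t → u t = v t := fun t ht => by
    rw [hvb t ht, hu]
    simp only [intervalIntegral.integral_of_le ht]
    congr 1
    refine integral_congr_ae ?_
    filter_upwards [ae_restrict_of_ae_restrict_of_subset Ioc_subset_Ioi_self hab] with s hs
    exact hs.symm
  have hII : ∀ x y, IntervalIntegrable a volume x y := fun x y =>
    intervalIntegrable_iff.2 ((haloc.integrableOn_isCompact isCompact_uIcc).mono_set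
      uIoc_subset_uIcc)
  have huc : Continuous u := continuous_const.add (intervalIntegral.continuous_primitive hII 0)
  have hderiv : ∀ᵐ t : ℝ, HasDerivAt u (a t) t := by
    filter_upwards [_root_.LocallyIntegrable.ae_hasDerivAt_integral haloc] with t ht
    exact (ht 0).const_add f
  have hevi' : ∀ y ∈ D, ∀ s t, 0 ≤ s → s ≤ t →
      ‖u t - y‖ ^ 2 / 2 - ‖u s - y‖ ^ 2 / 2 ≤ (t - s) * (E y - E (u t)) := by
    intro y hy s t hs hst
    rw [huv s hs, huv t (hs.trans hst)]
    exact hevi y hy s t hs hst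
  have huD : ∀ t, 0 ≤ t → u t ∈ D := fun t ht => huv t ht ▸ hvD t ht
  have hu0 : u 0 = f := by rw [huv 0 le_rfl, hv0]
  -- At a time of differentiability the left difference quotients in the variational inequality give
  -- `⟪a t, u t - y⟫ ≤ E y - E (u t)`.
  have hincl : ∀ t, 0 < t → HasDerivAt u (a t) t → ∀ y ∈ D,
      E (u t) + inner ℝ (-a t) (y - u t) ≤ E y := by
    intro t ht hd y hy
    have h1 := (hasDerivAt_half_norm_sq hd y).le_of_sub_le_left (c := E y - E (u t)) (by
      filter_upwards [Ioo_mem_nhdsLT ht] with s hs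
      exact hevi' y hy s t hs.1.le hs.2.le)
    have e : inner ℝ (-a t) (y - u t) = inner ℝ (a t) (u t - y) := by
      rw [inner_neg_left, ← inner_neg_right, neg_sub]
    linarith
  -- The variational inequality with `y = u s` shows that the energy decreases.
  have hmono : MonotoneOn (fun t => -E (u t)) (Ici 0) := by
    intro s hs t ht hst
    rcases eq_or_lt_of_le hst with rfl | hst'
    · rfl
    have h1 := hevi' (u s) (huD s hs) s t hs hst
    have h2 : 0 ≤ ‖u t - u s‖ ^ 2 := by positivity
    have h3 : 0 ≤ (t - s) * (E (u s) - E (u t)) := by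
      simp only [sub_self, norm_zero] at h1
      norm_num at h1
      linarith
    have h4 := nonneg_of_mul_nonneg_right h3 (sub_pos.2 hst')
    simp only
    linarith
  refine ⟨u, a, hu0, huc, ham, ha2, fun t _ => rfl, huD, fun t ht => ?_, ?_⟩
  · have hm : MonotoneOn (fun t => -E (u t)) (uIcc 0 t) := by
      rw [uIcc_of_le ht]; exact hmono.mono Icc_subset_Ici_self
    -- For a monotone function the integral of the derivative is at most the increment. Hence an
    -- inequality for the dissipation is available without absolute continuity of `E ∘ u`.
    have h1 := hm.intervalIntegral_deriv_mem_uIcc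
    have h0t : -E (u 0) ≤ -E (u t) := hmono (mem_Ici.2 le_rfl) (mem_Ici.2 ht) ht
    rw [uIcc_of_le (by linarith)] at h1
    have hsq : IntervalIntegrable (fun s => ‖a s‖ ^ 2) volume 0 t :=
      (ha2.integrable_norm_pow (by norm_num)).intervalIntegrable
    have h2 : ∫ s in (0 : ℝ)..t, ‖a s‖ ^ 2 ≤ ∫ s in (0 : ℝ)..t, deriv (fun t => -E (u t)) s := by
      refine intervalIntegral.integral_mono_ae_restrict ht hsq hm.intervalIntegrable_deriv ?_
      have hd := hmono.ae_differentiableWithinAt_of_mem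
      have hne : ∀ᵐ s : ℝ, s ≠ 0 := by simp [ae_iff]
      filter_upwards [ae_restrict_of_ae hderiv, ae_restrict_of_ae hd,
        ae_restrict_mem measurableSet_Icc, ae_restrict_of_ae hne] with s hs hs' hs0 hsne
      have hspos : 0 < s := lt_of_le_of_ne hs0.1 (Ne.symm hsne)
      have hE := ((hs' hs0.1).differentiableAt (Ici_mem_nhds hspos)).hasDerivAt
      -- With `s` frozen in `a s`, the subgradient inequality at `s` tested with `u r` says that `⟪a
      -- s, u r⟫ + E (u r)` is smallest at `r = s` up to sign conventions of the flow: its left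
      -- increments into `s` are nonpositive. Differentiating gives `‖a s‖² ≤ -(E ∘ u)'(s)`.
      have h3 : HasDerivAt (fun r => inner ℝ (a s) (u r) - -E (u r))
          (‖a s‖ ^ 2 - deriv (fun t => -E (u t)) s) s := by
        have := (HasDerivAt.inner ℝ (hasDerivAt_const s (a s)) hs).sub hE
        convert! this using 1
        simp
      have h4 := h3.le_of_sub_le_left (c := 0) (by
        filter_upwards [Ioo_mem_nhdsLT hspos] with r hr
        have h5 := hincl s hspos hs (u r) (huD r hr.1.le)
        rw [inner_neg_left, inner_sub_right] at h5
        linarith)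
      linarith
    rw [hu0] at h1
    linarith [h1.2]
  · filter_upwards [ae_restrict_of_ae hderiv, ae_restrict_mem measurableSet_Ioi] with t ht ht0
    exact hincl t ht0 ht

end GradientFlow

/-! ### Mollification in `L^p` -/

section Mollify

variable {V : Type*} [NormedAddCommGroup V] [InnerProductSpace ℝ V] [FiniteDimensional ℝ V]
  [MeasurableSpace V] [BorelSpace V]
  {F : Type*} [NormedAddCommGroup F] [NormedSpace ℝ F]

/-- A sequence of bump functions whose supports shrink to the origin. -/
noncomputable def shrinkingBump (V : Type*) [NormedAddCommGroup V] (k : ℕ) :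
    ContDiffBump (0 : V) :=
  ⟨1 / ((k : ℝ) + 1) / 2, 1 / ((k : ℝ) + 1), by positivity, by
    have : 0 < 1 / ((k : ℝ) + 1) := by positivity
    linarith⟩

/-- A smooth approximation of the identity. -/
noncomputable def mollifier (V : Type*) [NormedAddCommGroup V] [InnerProductSpace ℝ V]
    [FiniteDimensional ℝ V] [MeasurableSpace V] [BorelSpace V] (k : ℕ) : V → ℝ :=
  (shrinkingBump V k).normed volume

/-- The convolution of `g` with the `k`-th mollifier. -/
noncomputable def mollify (g : V → F) (k : ℕ) : V → F :=
  convolution (mollifier V k) g (ContinuousLinearMap.lsmul ℝ ℝ) volume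

lemma mollify_apply (g : V → F) (k : ℕ) (x : V) :
    mollify g k x = ∫ y, mollifier V k (x - y) • g y := by
  rw [mollify, convolution_eq_swap]; rfl

lemma mollify_apply' (g : V → F) (k : ℕ) (x : V) :
    mollify g k x = ∫ y, mollifier V k y • g (x - y) := rfl

lemma tendsto_shrinkingBump_rOut : Tendsto (fun k => (shrinkingBump V k).rOut) atTop (𝓝 0) :=
  tendsto_one_div_add_atTop_nhds_zero_nat

lemma hasCompactSupport_mollifier (k : ℕ) : HasCompactSupport (mollifier V k) :=
  (shrinkingBump V k).hasCompactSupport_normed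

lemma contDiff_mollifier (k : ℕ) : ContDiff ℝ ∞ (mollifier V k) :=
  (shrinkingBump V k).contDiff_normed

lemma mollifier_nonneg (k : ℕ) (x : V) : 0 ≤ mollifier V k x :=
  (shrinkingBump V k).nonneg_normed x

lemma integral_mollifier (k : ℕ) : ∫ x, mollifier V k x = 1 :=
  (shrinkingBump V k).integral_normed

lemma continuous_mollifier (k : ℕ) : Continuous (mollifier V k) :=
  (contDiff_mollifier k).continuous

lemma contDiff_mollify {g : V → F} (hg : LocallyIntegrable g volume) (k : ℕ) :
    ContDiff ℝ ∞ (mollify g k) :=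
  (hasCompactSupport_mollifier k).contDiff_convolution_left _ (contDiff_mollifier k) hg

lemma ae_tendsto_mollify [CompleteSpace F] {g : V → F} (hg : LocallyIntegrable g volume) :
    ∀ᵐ x, Tendsto (fun k => mollify g k x) atTop (𝓝 (g x)) :=
  ContDiffBump.ae_convolution_tendsto_right_of_locallyIntegrable (K := 2)
    tendsto_shrinkingBump_rOut (Eventually.of_forall fun k => by
      simp only [shrinkingBump]; linarith) hg

/-- Translations are continuous in `L^p`. -/
lemma tendsto_eLpNorm_translate_sub {p : ℝ≥0∞} (hp1 : 1 ≤ p) (hp : p ≠ ⊤) {g : V → F}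
    (hg : MemLp g p volume) :
    Tendsto (fun y => eLpNorm (fun x => g (x - y) - g x) p volume) (𝓝 0) (𝓝 0) := by
  have : Fact (1 ≤ p) := ⟨hp1⟩
  let T : V → C(V, V) := fun y => ⟨fun x => x - y, by fun_prop⟩
  have hT : Continuous T := ContinuousMap.continuous_of_continuous_uncurry _ (by
    change Continuous fun z : V × V => z.2 - z.1
    fun_prop)
  have hTm : ∀ y, MeasurePreserving (T y) volume volume := fun y =>
    measurePreserving_sub_right volume y
  have h1 := (continuous_const (y := hg.toLp g)).compMeasurePreservingLp hT hTm hp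
  have h2 := (h1.tendsto 0).sub_const (Lp.compMeasurePreserving (T 0) (hTm 0) (hg.toLp g))
  have h3 := h2.enorm
  rw [sub_self, enorm_zero] at h3
  refine h3.congr fun y => ?_
  rw [Lp.enorm_def]
  refine eLpNorm_congr_ae ?_
  have e1 : ∀ y, Lp.compMeasurePreserving (T y) (hTm y) (hg.toLp g)
      =ᵐ[volume] fun x => g (x - y) := fun y => by
    refine (Lp.coeFn_compMeasurePreserving _ (hTm y)).trans ?_
    exact (hTm y).quasiMeasurePreserving.ae_eq_comp hg.coeFn_toLp
  filter_upwards [Lp.coeFn_sub (Lp.compMeasurePreserving (T y) (hTm y) (hg.toLp g))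
    (Lp.compMeasurePreserving (T 0) (hTm 0) (hg.toLp g)), e1 y, e1 0] with x hx h1 h2
  rw [hx, Pi.sub_apply, h1, h2, sub_zero]

lemma mollify_congr_ae {g g' : V → F} (h : g =ᵐ[volume] g') (k : ℕ) :
    mollify g k = mollify g' k := by
  ext x
  rw [mollify_apply, mollify_apply]
  refine integral_congr_ae ?_
  filter_upwards [h] with y hy
  rw [hy]

/-- Since the kernel has mass one, the error of mollification is an average of translation
increments. -/
lemma mollify_sub_apply [CompleteSpace F] {g : V → F} (hg : LocallyIntegrable g volume) (k : ℕ)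
    (x : V) :
    mollify g k x - g x = ∫ y, mollifier V k y • (g (x - y) - g x) := by
  have h1 : Integrable (fun y => mollifier V k y • g (x - y)) volume :=
    (hasCompactSupport_mollifier k).convolutionExists_left
      (ContinuousLinearMap.lsmul ℝ ℝ) (continuous_mollifier k) hg x
  have h2 : Integrable (mollifier V k) volume :=
    (continuous_mollifier k).integrable_of_hasCompactSupport (hasCompactSupport_mollifier k)
  simp_rw [smul_sub]
  rw [integral_sub h1 (h2.smul_const _), integral_smul_const, integral_mollifier, one_smul,
    mollify_apply']

/-- The probability measure whose density is the `k`-th mollifier. -/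
noncomputable def mollifierMeasure (V : Type*) [NormedAddCommGroup V] [InnerProductSpace ℝ V]
    [FiniteDimensional ℝ V] [MeasurableSpace V] [BorelSpace V] (k : ℕ) : Measure V :=
  volume.withDensity fun y => ENNReal.ofReal (mollifier V k y)

instance (k : ℕ) : IsProbabilityMeasure (mollifierMeasure V k) := ⟨by
  rw [mollifierMeasure, withDensity_apply _ MeasurableSet.univ, Measure.restrict_univ,
    ← ofReal_integral_eq_lintegral_ofReal
      ((continuous_mollifier k).integrable_of_hasCompactSupport (hasCompactSupport_mollifier k))
      (Eventually.of_forall (mollifier_nonneg k)), integral_mollifier]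
  simp⟩

lemma ae_mollifierMeasure_norm_lt (k : ℕ) :
    ∀ᵐ y ∂(mollifierMeasure V k), ‖y‖ < (shrinkingBump V k).rOut := by
  rw [mollifierMeasure, ae_withDensity_iff (by
    exact (continuous_mollifier k).measurable.ennreal_ofReal)]
  refine Eventually.of_forall fun y hy => ?_
  have h1 : y ∈ Function.support (mollifier V k) := fun h => hy (by simp [h])
  rw [mollifier, ContDiffBump.support_normed_eq] at h1
  simpa using h1

/-- Jensen's inequality for the probability measure with density the mollifier bounds the `p`-th
power of the error by an average over translations; Tonelli then exchanges the integrals. Only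
translations shorter than the radius of the support contribute. -/
lemma eLpNorm_mollify_sub_le [CompleteSpace F] {p : ℝ≥0∞} (hp1 : 1 ≤ p) (hp : p ≠ ⊤)
    {g : V → F} (hg : LocallyIntegrable g volume) {k : ℕ} {ε : ℝ≥0∞}
    (h : ∀ y, ‖y‖ < (shrinkingBump V k).rOut →
      eLpNorm (fun x => g (x - y) - g x) p volume ≤ ε) :
    eLpNorm (fun x => mollify g k x - g x) p volume ≤ ε := by
  -- Tonelli needs `(x, y) ↦ g (x - y) - g x` to be jointly measurable, which is immediate for a
  -- strongly measurable `g`.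
  wlog hgm : StronglyMeasurable g generalizing g
  · have hae := hg.aestronglyMeasurable.ae_eq_mk
    set g' := hg.aestronglyMeasurable.mk g
    have hg' : LocallyIntegrable g' volume := hg.congr hae
    have key := this hg' (fun y hy => ?_) hg.aestronglyMeasurable.stronglyMeasurable_mk
    · rw [← mollify_congr_ae hae k] at key
      refine le_trans (le_of_eq (eLpNorm_congr_ae ?_)) key
      filter_upwards [hae] with x hx
      rw [hx]
    · refine le_trans (le_of_eq (eLpNorm_congr_ae ?_)) (h y hy)
      filter_upwards [hae,
        (measurePreserving_sub_right volume y).quasiMeasurePreserving.ae_eq_comp hae] with x hx hx'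
      simp only [Function.comp] at hx'
      rw [hx, hx']
  have hp0 : p ≠ 0 := (zero_lt_one.trans_le hp1).ne'
  have hpr : 0 < p.toReal := ENNReal.toReal_pos hp0 hp
  set P := mollifierMeasure V k with hP
  have hjm : StronglyMeasurable fun z : V × V => g (z.1 - z.2) - g z.1 :=
    (hgm.comp_measurable (measurable_fst.sub measurable_snd)).sub
      (hgm.comp_measurable measurable_fst)
  have hpt : ∀ x, ‖mollify g k x - g x‖ₑ ^ p.toReal ≤ ∫⁻ y, ‖g (x - y) - g x‖ₑ ^ p.toReal ∂P := by
    intro x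
    have hxm : StronglyMeasurable fun y => g (x - y) - g x :=
      hjm.comp_measurable (measurable_const.prodMk measurable_id)
    have h1 : ‖mollify g k x - g x‖ₑ ≤ eLpNorm (fun y => g (x - y) - g x) 1 P := by
      rw [mollify_sub_apply hg, eLpNorm_one_eq_lintegral_enorm, hP, mollifierMeasure,
        lintegral_withDensity_eq_lintegral_mul₀
          ((continuous_mollifier k).measurable.ennreal_ofReal.aemeasurable)
          hxm.enorm.aemeasurable]
      refine (enorm_integral_le_lintegral_enorm _).trans (lintegral_mono fun y => ?_)
      rw [enorm_smul, Pi.mul_apply, Real.enorm_of_nonneg (mollifier_nonneg k y)]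
    have h2 := h1.trans (eLpNorm_le_eLpNorm_of_exponent_le hp1 hxm.aestronglyMeasurable)
    rw [eLpNorm_eq_lintegral_rpow_enorm_toReal hp0 hp] at h2
    calc _ ≤ ((∫⁻ y, ‖g (x - y) - g x‖ₑ ^ p.toReal ∂P) ^ (1 / p.toReal)) ^ p.toReal :=
          ENNReal.rpow_le_rpow h2 hpr.le
      _ = _ := by rw [← ENNReal.rpow_mul, one_div_mul_cancel hpr.ne', ENNReal.rpow_one]
  rw [eLpNorm_eq_lintegral_rpow_enorm_toReal hp0 hp, one_div, ENNReal.rpow_inv_le_iff hpr]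
  calc ∫⁻ x, ‖mollify g k x - g x‖ₑ ^ p.toReal
      ≤ ∫⁻ x, ∫⁻ y, ‖g (x - y) - g x‖ₑ ^ p.toReal ∂P := lintegral_mono hpt
    _ = ∫⁻ y, (∫⁻ x, ‖g (x - y) - g x‖ₑ ^ p.toReal) ∂P :=
        lintegral_lintegral_swap (hjm.enorm.pow_const _).aemeasurable
    _ ≤ ∫⁻ _, ε ^ p.toReal ∂P := by
        refine lintegral_mono_ae ?_
        filter_upwards [ae_mollifierMeasure_norm_lt k] with y hy
        have := h y hy
        rwa [eLpNorm_eq_lintegral_rpow_enorm_toReal hp0 hp, one_div,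
          ENNReal.rpow_inv_le_iff hpr] at this
    _ = ε ^ p.toReal := by simp

lemma tendsto_eLpNorm_mollify_sub [CompleteSpace F] {p : ℝ≥0∞} (hp1 : 1 ≤ p) (hp : p ≠ ⊤)
    {g : V → F} (hg : MemLp g p volume) :
    Tendsto (fun k => eLpNorm (fun x => mollify g k x - g x) p volume) atTop (𝓝 0) := by
  rw [ENNReal.tendsto_nhds_zero]
  intro ε hε
  have h1 := ENNReal.tendsto_nhds_zero.1 (tendsto_eLpNorm_translate_sub hp1 hp hg) ε hε
  obtain ⟨δ, hδ, h2⟩ := Metric.eventually_nhds_iff.1 h1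
  have h3 : ∀ᶠ k in atTop, (shrinkingBump V k).rOut < δ :=
    tendsto_shrinkingBump_rOut.eventually_lt_const hδ
  filter_upwards [h3] with k hk
  refine eLpNorm_mollify_sub_le hp1 hp (hg.locallyIntegrable hp1) fun y hy => h2 ?_
  rw [dist_zero_right]
  exact hy.trans hk

lemma MeasureTheory.MemLp.mollify [CompleteSpace F] {p : ℝ≥0∞} (hp1 : 1 ≤ p) (hp : p ≠ ⊤)
    {g : V → F} (hg : MemLp g p volume) (k : ℕ) : MemLp (mollify g k) p volume := by
  have hgl := hg.locallyIntegrable hp1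
  have hm : AEStronglyMeasurable (_root_.mollify g k) volume :=
    (contDiff_mollify hgl k).continuous.aestronglyMeasurable
  have h1 : MemLp (fun x => _root_.mollify g k x - g x) p volume := by
    refine ⟨hm.sub hg.1, lt_of_le_of_lt (eLpNorm_mollify_sub_le hp1 hp hgl
      (ε := eLpNorm g p volume + eLpNorm g p volume) fun y _ => ?_) ?_⟩
    · have hmp := measurePreserving_sub_right (volume : Measure V) y
      have e : eLpNorm (fun x => g (x - y)) p volume = eLpNorm g p volume :=
        eLpNorm_comp_measurePreserving hg.1 hmp
      calc _ ≤ eLpNorm (fun x => g (x - y)) p volume + eLpNorm g p volume :=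
            eLpNorm_sub_le (hg.1.comp_quasiMeasurePreserving hmp.quasiMeasurePreserving) hg.1 hp1
        _ = _ := by rw [e]
    · exact ENNReal.add_lt_top.2 ⟨hg.2, hg.2⟩
  have := h1.add hg
  refine this.ae_eq (Eventually.of_forall fun x => ?_)
  simp

end Mollify

/-! ### Hölder pairings and their limits -/

section Holder

variable {α : Type*} [MeasurableSpace α] {μ : Measure α}
  {F F' F'' : Type*} [NormedAddCommGroup F] [NormedSpace ℝ F] [NormedAddCommGroup F']
  [NormedSpace ℝ F'] [NormedAddCommGroup F''] [NormedSpace ℝ F'']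

lemma integrable_bilin (B : F →L[ℝ] F' →L[ℝ] F'') {p q : ℝ≥0∞} [ENNReal.HolderConjugate p q]
    {f : α → F} {g : α → F'} (hf : MemLp f p μ) (hg : MemLp g q μ) :
    Integrable (fun x => B (f x) (g x)) μ :=
  memLp_one_iff_integrable.1 (B.memLp_of_bilin 1 hf hg)

/-- The integral of a bilinear expression passes to the limit if one factor converges in `L^p`. -/
lemma tendsto_integral_bilin (B : F →L[ℝ] F' →L[ℝ] F'') {p q : ℝ≥0∞}
    [ENNReal.HolderConjugate p q] {f : ℕ → α → F} {f₀ : α → F} {g : α → F'}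
    (hf : ∀ k, MemLp (f k) p μ) (hf₀ : MemLp f₀ p μ) (hg : MemLp g q μ)
    (h : Tendsto (fun k => eLpNorm (fun x => f k x - f₀ x) p μ) atTop (𝓝 0)) :
    Tendsto (fun k => ∫ x, B (f k x) (g x) ∂μ) atTop (𝓝 (∫ x, B (f₀ x) (g x) ∂μ)) := by
  refine tendsto_integral_of_L1 _ (integrable_bilin B hf₀ hg).1
    (Eventually.of_forall fun k => integrable_bilin B (hf k) hg) ?_
  have h1 : Tendsto (fun k => (‖B‖₊ : ℝ≥0∞) * eLpNorm (fun x => f k x - f₀ x) p μ *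
      eLpNorm g q μ) atTop (𝓝 (‖B‖₊ * 0 * eLpNorm g q μ)) :=
    ENNReal.Tendsto.mul_const (ENNReal.Tendsto.const_mul h (Or.inr ENNReal.coe_ne_top))
      (Or.inr hg.2.ne)
  rw [mul_zero, zero_mul] at h1
  refine tendsto_of_tendsto_of_tendsto_of_le_of_le tendsto_const_nhds h1 (fun _ => zero_le) ?_
  intro k
  have h2 := eLpNorm_le_eLpNorm_mul_eLpNorm_of_nnnorm (p := p) (q := q) (r := 1)
    ((hf k).sub hf₀).1 hg.1 (B · ·) ‖B‖₊ (.of_forall fun _ => B.le_opNorm₂ _ _)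
  rw [eLpNorm_one_eq_lintegral_enorm] at h2
  refine le_trans (le_of_eq (lintegral_congr fun x => ?_)) h2
  simp

end Holder

/-! ### Calculus of classical gradients -/

section Gradient

variable {V : Type*} [NormedAddCommGroup V] [InnerProductSpace ℝ V] [CompleteSpace V]

lemma inner_gradient_eq_fderiv (f : V → ℝ) (x e : V) : inner ℝ (∇ f x) e = fderiv ℝ f x e := by
  rw [gradient, InnerProductSpace.toDual_symm_apply]

lemma continuous_gradient {f : V → ℝ} (hf : ContDiff ℝ ∞ f) : Continuous (∇ f) :=
  (InnerProductSpace.toDual ℝ V).symm.continuous.comp (hf.continuous_fderiv (by simp))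

lemma HasCompactSupport.gradient {f : V → ℝ} (hf : HasCompactSupport f) :
    HasCompactSupport (∇ f) := by
  have h : ∇ f = (InnerProductSpace.toDual ℝ V).symm ∘ fderiv ℝ f := rfl
  rw [h]
  exact (hf.fderiv (𝕜 := ℝ)).comp_left (map_zero _)

lemma gradient_mul {f g : V → ℝ} {x : V} (hf : DifferentiableAt ℝ f x)
    (hg : DifferentiableAt ℝ g x) :
    ∇ (fun y => f y * g y) x = f x • ∇ g x + g x • ∇ f x := by
  refine ext_inner_right ℝ fun e => ?_
  rw [inner_gradient_eq_fderiv, fderiv_fun_mul hf hg, inner_add_left, inner_smul_left,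
    inner_smul_left, inner_gradient_eq_fderiv, inner_gradient_eq_fderiv]
  simp

lemma gradient_comp_real {f : V → ℝ} {θ : ℝ → ℝ} {x : V} (hθ : DifferentiableAt ℝ θ (f x))
    (hf : DifferentiableAt ℝ f x) :
    ∇ (fun y => θ (f y)) x = deriv θ (f x) • ∇ f x := by
  refine ext_inner_right ℝ fun e => ?_
  have h := (hθ.hasDerivAt.comp_hasFDerivAt x hf.hasFDerivAt).fderiv
  have h' : fderiv ℝ (fun y => θ (f y)) x = deriv θ (f x) • fderiv ℝ f x := h
  rw [inner_gradient_eq_fderiv, h', inner_smul_left, inner_gradient_eq_fderiv]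
  simp

end Gradient

/-! ### Weak gradients: linearity, closedness, mollification -/

section WeakGradient

variable {n : ℕ} {v w : EuclideanSpace ℝ (Fin n) → ℝ}
  {G K : EuclideanSpace ℝ (Fin n) → EuclideanSpace ℝ (Fin n)}

lemma HasWeakGradient.congr (h : HasWeakGradient v G) (hv : v =ᵐ[volume] w)
    (hG : G =ᵐ[volume] K) : HasWeakGradient w K where
  locallyIntegrable := h.locallyIntegrable.congr hv
  locallyIntegrable_grad := h.locallyIntegrable_grad.congr hG
  integral_eq φ h1 h2 := by
    have e1 : ∫ x, w x • ∇ φ x = ∫ x, v x • ∇ φ x :=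
      integral_congr_ae (by filter_upwards [hv] with x hx; rw [hx])
    have e2 : ∫ x, φ x • K x = ∫ x, φ x • G x :=
      integral_congr_ae (by filter_upwards [hG] with x hx; rw [hx])
    rw [e1, e2, h.integral_eq φ h1 h2]

lemma HasWeakGradient.add (h : HasWeakGradient v G) (h' : HasWeakGradient w K) :
    HasWeakGradient (fun x => v x + w x) (fun x => G x + K x) where
  locallyIntegrable := h.locallyIntegrable.add h'.locallyIntegrable
  locallyIntegrable_grad := h.locallyIntegrable_grad.add h'.locallyIntegrable_grad
  integral_eq φ h1 h2 := by
    have hg := continuous_gradient h1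
    simp_rw [add_smul, smul_add]
    rw [integral_add, integral_add, h.integral_eq φ h1 h2, h'.integral_eq φ h1 h2]
    · abel
    · exact h.locallyIntegrable_grad.integrable_smul_left_of_hasCompactSupport h1.continuous h2
    · exact h'.locallyIntegrable_grad.integrable_smul_left_of_hasCompactSupport h1.continuous h2
    · exact h.locallyIntegrable.integrable_smul_right_of_hasCompactSupport hg h2.gradient
    · exact h'.locallyIntegrable.integrable_smul_right_of_hasCompactSupport hg h2.gradient

lemma HasWeakGradient.const_smul (h : HasWeakGradient v G) (c : ℝ) :
    HasWeakGradient (fun x => c * v x) (fun x => c • G x) where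
  locallyIntegrable := h.locallyIntegrable.smul c
  locallyIntegrable_grad := h.locallyIntegrable_grad.smul c
  integral_eq φ h1 h2 := by
    simp_rw [mul_smul, smul_comm _ c]
    rw [integral_smul, integral_smul, h.integral_eq φ h1 h2, smul_neg]

lemma HasWeakGradient.sub (h : HasWeakGradient v G) (h' : HasWeakGradient w K) :
    HasWeakGradient (fun x => v x - w x) (fun x => G x - K x) :=
  (h.add (h'.const_smul (-1))).congr (.of_forall fun x => by simp [sub_eq_add_neg])
    (.of_forall fun x => by simp [sub_eq_add_neg])

/-- Paired with a fixed vector `e`, the identity is integration by parts for the directional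
derivative along `e`. -/
lemma hasWeakGradient_of_contDiff (hv : ContDiff ℝ ∞ v) : HasWeakGradient v (∇ v) where
  locallyIntegrable := hv.continuous.locallyIntegrable
  locallyIntegrable_grad := (continuous_gradient hv).locallyIntegrable
  integral_eq φ h1 h2 := by
    have hi1 : Integrable (fun x => v x • ∇ φ x) volume :=
      hv.continuous.locallyIntegrable.integrable_smul_right_of_hasCompactSupport
        (continuous_gradient h1) h2.gradient
    have hi2 : Integrable (fun x => φ x • ∇ v x) volume :=
      (continuous_gradient hv).locallyIntegrable.integrable_smul_left_of_hasCompactSupport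
        h1.continuous h2
    refine ext_inner_right ℝ fun e => ?_
    rw [inner_neg_left, real_inner_comm, ← integral_inner hi1, real_inner_comm,
      ← integral_inner hi2]
    have e1 : ∀ x, inner ℝ e (v x • ∇ φ x) = v x * fderiv ℝ φ x e := fun x => by
      rw [inner_smul_right, real_inner_comm, inner_gradient_eq_fderiv]
    have e2 : ∀ x, inner ℝ e (φ x • ∇ v x) = fderiv ℝ v x e * φ x := fun x => by
      rw [inner_smul_right, real_inner_comm, inner_gradient_eq_fderiv, mul_comm]
    simp_rw [e1, e2]
    refine integral_mul_fderiv_eq_neg_fderiv_mul_of_integrable ?_ ?_ ?_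
      (fun x _ => (hv.differentiable (by simp)) x) (fun x _ => (h1.differentiable (by simp)) x)
    · simpa only [e2] using hi2.const_inner (𝕜 := ℝ) e
    · simpa only [e1] using hi1.const_inner (𝕜 := ℝ) e
    · exact hv.continuous.locallyIntegrable.integrable_smul_right_of_hasCompactSupport
        h1.continuous h2

/-- The weak gradient is a closed operator. -/
lemma HasWeakGradient.of_tendsto {p q r s : ℝ≥0∞} [ENNReal.HolderConjugate p q]
    [ENNReal.HolderConjugate r s] {v : ℕ → EuclideanSpace ℝ (Fin n) → ℝ}
    {G : ℕ → EuclideanSpace ℝ (Fin n) → EuclideanSpace ℝ (Fin n)} {v₀ G₀}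
    (hv : ∀ k, MemLp (v k) p volume) (hG : ∀ k, MemLp (G k) r volume)
    (hv₀ : MemLp v₀ p volume) (hG₀ : MemLp G₀ r volume) (h : ∀ k, HasWeakGradient (v k) (G k))
    (hlv : Tendsto (fun k => eLpNorm (fun x => v k x - v₀ x) p volume) atTop (𝓝 0))
    (hlG : Tendsto (fun k => eLpNorm (fun x => G k x - G₀ x) r volume) atTop (𝓝 0)) :
    HasWeakGradient v₀ G₀ where
  locallyIntegrable := hv₀.locallyIntegrable (ENNReal.HolderConjugate.one_le p q)
  locallyIntegrable_grad := hG₀.locallyIntegrable (ENNReal.HolderConjugate.one_le r s)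
  integral_eq φ h1 h2 := by
    have hφ : MemLp φ s volume := h1.continuous.memLp_of_hasCompactSupport h2
    have hφ' : MemLp (∇ φ) q volume :=
      (continuous_gradient h1).memLp_of_hasCompactSupport h2.gradient
    have t1 := tendsto_integral_bilin (ContinuousLinearMap.lsmul ℝ ℝ) hv hv₀ hφ' hlv
    have t2 := tendsto_integral_bilin (ContinuousLinearMap.lsmul ℝ ℝ (E := EuclideanSpace ℝ (Fin n))).flip
      hG hG₀ hφ hlG
    simp only [ContinuousLinearMap.lsmul_apply, ContinuousLinearMap.flip_apply] at t1 t2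
    exact tendsto_nhds_unique t1 (t2.neg.congr fun k => ((h k).integral_eq φ h1 h2).symm)

/-- All derivatives fall on the kernel. The right-hand side makes sense for every locally integrable
`v`, which is what makes a canonical, jointly measurable choice of weak gradient possible. -/
lemma gradient_mollify (hv : LocallyIntegrable v volume) (k : ℕ)
    (x : EuclideanSpace ℝ (Fin n)) :
    ∇ (mollify v k) x = ∫ y, v y • ∇ (mollifier (EuclideanSpace ℝ (Fin n)) k) (x - y) := by
  have hη := contDiff_mollifier (V := EuclideanSpace ℝ (Fin n)) k
  have hηc := hasCompactSupport_mollifier (V := EuclideanSpace ℝ (Fin n)) k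
  have hcg : HasCompactSupport fun y => ∇ (mollifier (EuclideanSpace ℝ (Fin n)) k) (x - y) :=
    hηc.gradient.comp_homeomorph (Homeomorph.subLeft x)
  have hcf : HasCompactSupport fun y =>
      fderiv ℝ (mollifier (EuclideanSpace ℝ (Fin n)) k) (x - y) :=
    (hηc.fderiv (𝕜 := ℝ)).comp_homeomorph (Homeomorph.subLeft x)
  have hi : Integrable (fun y => v y • ∇ (mollifier (EuclideanSpace ℝ (Fin n)) k) (x - y)) volume :=
    hv.integrable_smul_right_of_hasCompactSupport
      ((continuous_gradient hη).comp (by fun_prop)) hcg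
  have hi' : Integrable (fun y => v y • fderiv ℝ (mollifier (EuclideanSpace ℝ (Fin n)) k) (x - y))
      volume :=
    hv.integrable_smul_right_of_hasCompactSupport
      ((hη.continuous_fderiv (by simp)).comp (by fun_prop)) hcf
  have hd := (hηc.hasFDerivAt_convolution_left (ContinuousLinearMap.lsmul ℝ ℝ)
    (hη.of_le (by simp)) hv x).fderiv
  refine ext_inner_right ℝ fun e => ?_
  rw [inner_gradient_eq_fderiv, real_inner_comm, ← integral_inner hi]
  have e1 : ∀ y, inner ℝ e (v y • ∇ (mollifier (EuclideanSpace ℝ (Fin n)) k) (x - y))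
      = (v y • fderiv ℝ (mollifier (EuclideanSpace ℝ (Fin n)) k) (x - y)) e := fun y => by
    rw [inner_smul_right, real_inner_comm, inner_gradient_eq_fderiv]; rfl
  simp_rw [e1]
  rw [← ContinuousLinearMap.integral_apply hi']
  change fderiv ℝ (convolution (mollifier (EuclideanSpace ℝ (Fin n)) k) v
    (ContinuousLinearMap.lsmul ℝ ℝ) volume) x e = _
  rw [hd, convolution_eq_swap]
  congr 1
  refine integral_congr_ae (.of_forall fun y => ?_)
  ext e'
  simp [mul_comm]

/-- The weak gradient is tested with the reflected kernel `y ↦ η (x - y)`; the sign from the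
reflection cancels that of the integration by parts. -/
lemma HasWeakGradient.gradient_mollify (h : HasWeakGradient v G) (k : ℕ)
    (x : EuclideanSpace ℝ (Fin n)) : ∇ (mollify v k) x = mollify G k x := by
  have hη := contDiff_mollifier (V := EuclideanSpace ℝ (Fin n)) k
  have hηc := hasCompactSupport_mollifier (V := EuclideanSpace ℝ (Fin n)) k
  have h1 := h.integral_eq (fun y => mollifier (EuclideanSpace ℝ (Fin n)) k (x - y))
    (hη.comp (by fun_prop)) (hηc.comp_homeomorph (Homeomorph.subLeft x))
  have e1 : ∀ y, ∇ (fun y => mollifier (EuclideanSpace ℝ (Fin n)) k (x - y)) y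
      = -∇ (mollifier (EuclideanSpace ℝ (Fin n)) k) (x - y) := fun y => by
    refine ext_inner_right ℝ fun e => ?_
    have hd := (((hη.differentiable (by simp)) (x - y)).hasFDerivAt.comp y
      ((hasFDerivAt_id y).const_sub x)).fderiv
    have hd' : fderiv ℝ (fun y => mollifier (EuclideanSpace ℝ (Fin n)) k (x - y)) y
      = (fderiv ℝ (mollifier (EuclideanSpace ℝ (Fin n)) k) (x - y)).comp
        (-ContinuousLinearMap.id ℝ _) := hd
    rw [inner_neg_left, inner_gradient_eq_fderiv, inner_gradient_eq_fderiv, hd']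
    simp
  simp_rw [e1, smul_neg, integral_neg, neg_inj] at h1
  rw [_root_.gradient_mollify h.locallyIntegrable, h1, mollify_apply]

end WeakGradient

/-! ### Jointly measurable representatives in space-time -/

section JointMeasurability

/-- A strongly measurable curve in `L²` has a jointly measurable representative. -/
lemma exists_jointly_measurable_representative {V : Type*} [NormedAddCommGroup V]
    [InnerProductSpace ℝ V] [FiniteDimensional ℝ V] [MeasurableSpace V] [BorelSpace V]
    {a : ℝ → Lp ℝ 2 (volume : Measure V)} (ha : StronglyMeasurable a) :
    ∃ b : ℝ → V → ℝ, StronglyMeasurable (fun z : ℝ × V => b z.1 z.2) ∧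
      ∀ t, b t =ᵐ[volume] a t := by
  -- A mollified value is the `L²` inner product of `a t` with a translated kernel. The kernel
  -- depends continuously on `x` in `L²`, so the product is jointly measurable, and so is the limit,
  -- which recovers `a t` almost everywhere.
  refine ⟨fun t x => limUnder atTop fun k => mollify (a t) k x, ?_, fun t => ?_⟩
  · refine StronglyMeasurable.limUnder
      (f := fun (k : ℕ) (z : ℝ × V) => mollify (a z.1) k z.2) fun k => ?_
    have hη : MemLp (mollifier V k) 2 volume :=
      (continuous_mollifier k).memLp_of_hasCompactSupport (hasCompactSupport_mollifier k)
    let T : V → C(V, V) := fun x => ⟨fun y => x - y, by fun_prop⟩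
    have hT : Continuous T := ContinuousMap.continuous_of_continuous_uncurry _ (by
      change Continuous fun z : V × V => z.1 - z.2
      fun_prop)
    have hTm : ∀ x, MeasurePreserving (T x) volume volume := fun x =>
      Measure.measurePreserving_sub_left volume x
    have hc := (continuous_const (y := hη.toLp _)).compMeasurePreservingLp hT hTm (by norm_num)
    have hcs : StronglyMeasurable fun z : ℝ × V =>
        Lp.compMeasurePreserving (T z.2) (hTm z.2) (hη.toLp _) :=
      hc.stronglyMeasurable.comp_measurable measurable_snd
    have hm := hcs.inner (𝕜 := ℝ) (ha.comp_measurable measurable_fst)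
    convert! hm using 2 with z
    rw [mollify_apply, L2.inner_def]
    refine integral_congr_ae ?_
    filter_upwards [Lp.coeFn_compMeasurePreserving (hη.toLp _) (hTm z.2),
      (hTm z.2).quasiMeasurePreserving.ae_eq_comp hη.coeFn_toLp] with y h1 h2
    rw [h1, h2]
    simp [T, mul_comm]
  · filter_upwards [ae_tendsto_mollify ((Lp.memLp (a t)).locallyIntegrable (by norm_num))]
      with x hx
    exact hx.limUnder_eq

/-- A canonical representative of the weak gradient, as a limit of gradients of mollifications. -/
noncomputable def weakGrad {n : ℕ} (v : EuclideanSpace ℝ (Fin n) → ℝ)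
    (x : EuclideanSpace ℝ (Fin n)) : EuclideanSpace ℝ (Fin n) :=
  limUnder atTop fun k => ∫ y, v y • ∇ (mollifier (EuclideanSpace ℝ (Fin n)) k) (x - y)

variable {n : ℕ}

lemma stronglyMeasurable_weakGrad {u : ℝ → EuclideanSpace ℝ (Fin n) → ℝ}
    (hu : StronglyMeasurable fun z : ℝ × EuclideanSpace ℝ (Fin n) => u z.1 z.2) :
    StronglyMeasurable fun z : ℝ × EuclideanSpace ℝ (Fin n) => weakGrad (u z.1) z.2 := by
  refine StronglyMeasurable.limUnder (f := fun (k : ℕ) (z : ℝ × EuclideanSpace ℝ (Fin n)) =>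
    ∫ y, u z.1 y • ∇ (mollifier (EuclideanSpace ℝ (Fin n)) k) (z.2 - y)) fun k => ?_
  refine StronglyMeasurable.integral_prod_right'
    (f := fun w : (ℝ × EuclideanSpace ℝ (Fin n)) × EuclideanSpace ℝ (Fin n) =>
      u w.1.1 w.2 • ∇ (mollifier (EuclideanSpace ℝ (Fin n)) k) (w.1.2 - w.2)) ?_
  refine (hu.comp_measurable ((measurable_fst.comp measurable_fst).prodMk measurable_snd)).smul ?_
  exact (continuous_gradient (contDiff_mollifier k)).stronglyMeasurable.comp_measurable
    ((measurable_snd.comp measurable_fst).sub measurable_snd)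

lemma HasWeakGradient.weakGrad_ae_eq {v : EuclideanSpace ℝ (Fin n) → ℝ}
    {G : EuclideanSpace ℝ (Fin n) → EuclideanSpace ℝ (Fin n)} (h : HasWeakGradient v G) :
    weakGrad v =ᵐ[volume] G := by
  filter_upwards [ae_tendsto_mollify h.locallyIntegrable_grad] with x hx
  refine Tendsto.limUnder_eq (hx.congr fun k => ?_)
  rw [← h.gradient_mollify, _root_.gradient_mollify h.locallyIntegrable]

end JointMeasurability

/-! ### Admissible test functions in the weak formulation -/

section Testing

variable {n : ℕ} {v g w : EuclideanSpace ℝ (Fin n) → ℝ}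
  {G A : EuclideanSpace ℝ (Fin n) → EuclideanSpace ℝ (Fin n)} {p q : ℝ≥0∞} {θ : ℝ → ℝ} {C : ℝ≥0}

lemma lipschitzWith_of_abs_deriv_le (hθ : ContDiff ℝ ∞ θ) (hθ' : ∀ s, |deriv θ s| ≤ C) :
    LipschitzWith C θ :=
  lipschitzWith_of_nnnorm_deriv_le (hθ.differentiable (by simp)) fun s => by
    rw [← NNReal.coe_le_coe, coe_nnnorm]; exact hθ' s

lemma LipschitzWith.abs_le_mul_abs (hθ : LipschitzWith C θ) (hθ0 : θ 0 = 0) (s : ℝ) :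
    |θ s| ≤ C * |s| := by
  simpa [hθ0] using hθ.norm_sub_le s 0

lemma LipschitzWith.memLp_comp (hθ : LipschitzWith C θ) (hθ0 : θ 0 = 0) (hv : MemLp v p volume) :
    MemLp (fun x => θ (v x)) p volume :=
  hv.of_le_mul (hθ.continuous.comp_aestronglyMeasurable hv.1)
    (.of_forall fun x => hθ.abs_le_mul_abs hθ0 (v x))

/-- A family of smooth cutoff functions. -/
noncomputable def smoothCutoff (n : ℕ) (j : ℕ) (x : EuclideanSpace ℝ (Fin n)) : ℝ :=
  (⟨1, 2, one_pos, one_lt_two⟩ : ContDiffBump (0 : EuclideanSpace ℝ (Fin n)))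
    (((j : ℝ) + 1)⁻¹ • x)

lemma contDiff_smoothCutoff (j : ℕ) : ContDiff ℝ ∞ (smoothCutoff n j) :=
  (ContDiffBump.contDiff _).comp (contDiff_const_smul _)

lemma hasCompactSupport_smoothCutoff (j : ℕ) : HasCompactSupport (smoothCutoff n j) :=
  (ContDiffBump.hasCompactSupport _).comp_homeomorph
    (Homeomorph.smulOfNeZero ((j : ℝ) + 1)⁻¹ (by positivity))

lemma smoothCutoff_nonneg (j : ℕ) (x : EuclideanSpace ℝ (Fin n)) : 0 ≤ smoothCutoff n j x :=
  ContDiffBump.nonneg _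

lemma smoothCutoff_le_one (j : ℕ) (x : EuclideanSpace ℝ (Fin n)) : smoothCutoff n j x ≤ 1 :=
  ContDiffBump.le_one _

lemma tendsto_smoothCutoff (x : EuclideanSpace ℝ (Fin n)) :
    Tendsto (fun j => smoothCutoff n j x) atTop (𝓝 1) := by
  refine tendsto_const_nhds.congr' ?_
  filter_upwards [eventually_ge_atTop ⌈‖x‖⌉₊] with j hj
  symm
  refine ContDiffBump.one_of_mem_closedBall _ ?_
  have h1 : ‖x‖ ≤ j := (Nat.le_ceil _).trans (by exact_mod_cast hj)
  have hj0 : (0 : ℝ) < (j : ℝ) + 1 := by positivity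
  rw [mem_closedBall_zero_iff, norm_smul, norm_inv, Real.norm_eq_abs, abs_of_pos hj0,
    inv_mul_le_iff₀ hj0]
  simp only [mul_one]
  linarith

lemma exists_norm_gradient_smoothCutoff_le (n : ℕ) :
    ∃ C : ℝ, 0 ≤ C ∧ ∀ j x, ‖∇ (smoothCutoff n j) x‖ ≤ C * (1 / ((j : ℝ) + 1)) := by
  let b : ContDiffBump (0 : EuclideanSpace ℝ (Fin n)) := ⟨1, 2, one_pos, one_lt_two⟩
  have hb : ContDiff ℝ ∞ b := b.contDiff
  obtain ⟨C, hC⟩ := (b.hasCompactSupport.fderiv (𝕜 := ℝ)).exists_bound_of_continuous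
    (hb.continuous_fderiv (by simp))
  refine ⟨C, (norm_nonneg _).trans (hC 0), fun j x => ?_⟩
  have hj0 : (0 : ℝ) < (j : ℝ) + 1 := by positivity
  have h1 : ‖∇ (smoothCutoff n j) x‖ = ‖fderiv ℝ (smoothCutoff n j) x‖ :=
    LinearIsometryEquiv.norm_map _ _
  have h2 : fderiv ℝ (smoothCutoff n j) x
      = ((j : ℝ) + 1)⁻¹ • fderiv ℝ b (((j : ℝ) + 1)⁻¹ • x) :=
    fderiv_comp_smul _
  rw [h1, h2, norm_smul, norm_inv, Real.norm_eq_abs, abs_of_pos hj0, mul_comm, one_div]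
  exact mul_le_mul_of_nonneg_right (hC _) (by positivity)

/-- Extension of the weak formulation to smooth functions that need not be compactly supported. -/
lemma integral_test_smooth [ENNReal.HolderConjugate p q] (hg : MemLp g 2 volume)
    (hA : MemLp A q volume)
    (h : ∀ φ : EuclideanSpace ℝ (Fin n) → ℝ, ContDiff ℝ ∞ φ → HasCompactSupport φ →
      ∫ x, (g x * φ x + inner ℝ (A x) (∇ φ x)) = 0)
    (hw : ContDiff ℝ ∞ w) (hw2 : MemLp w 2 volume) (hwp : MemLp w p volume)
    (hdw : MemLp (∇ w) p volume) (hθ : ContDiff ℝ ∞ θ) (hθ0 : θ 0 = 0)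
    (hθ' : ∀ s, |deriv θ s| ≤ C) :
    ∫ x, (g x * θ (w x) + inner ℝ (A x) (deriv θ (w x) • ∇ w x)) = 0 := by
  have hL := lipschitzWith_of_abs_deriv_le hθ hθ'
  obtain ⟨K, hK0, hK⟩ := exists_norm_gradient_smoothCutoff_le n
  have hθw : ContDiff ℝ ∞ fun x => θ (w x) := hθ.comp hw
  have hgrad : ∀ j x, ∇ (fun y => θ (w y) * smoothCutoff n j y) x
      = θ (w x) • ∇ (smoothCutoff n j) x + smoothCutoff n j x • deriv θ (w x) • ∇ w x := by
    intro j x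
    rw [gradient_mul (hθw.differentiable (by simp) x)
      ((contDiff_smoothCutoff j).differentiable (by simp) x),
      gradient_comp_real (hθ.differentiable (by simp) _) (hw.differentiable (by simp) x)]
  have hzero : ∀ j, ∫ x, (g x * (θ (w x) * smoothCutoff n j x)
      + inner ℝ (A x) (∇ (fun y => θ (w y) * smoothCutoff n j y) x)) = 0 := fun j =>
    h _ (hθw.mul (contDiff_smoothCutoff j)) (hasCompactSupport_smoothCutoff j).mul_left
  have hlim : Tendsto (fun j => ∫ x, (g x * (θ (w x) * smoothCutoff n j x)
      + inner ℝ (A x) (∇ (fun y => θ (w y) * smoothCutoff n j y) x))) atTop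
      (𝓝 (∫ x, (g x * θ (w x) + inner ℝ (A x) (deriv θ (w x) • ∇ w x)))) := by
    -- The term with the gradient of the cutoff tends to zero pointwise and is dominated by a
    -- multiple of `‖A‖ ‖w‖`. This is integrable because `w` itself, not only its gradient, lies in
    -- `L^p`.
    refine tendsto_integral_of_dominated_convergence
      (fun x => ‖g x‖ * (C * ‖w x‖) + (‖A x‖ * (C * K * ‖w x‖) + ‖A x‖ * (C * ‖∇ w x‖))) ?_ ?_ ?_ ?_
    · intro j
      have hc : ContDiff ℝ ∞ fun y => θ (w y) * smoothCutoff n j y :=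
        hθw.mul (contDiff_smoothCutoff j)
      exact (hg.1.mul hc.continuous.aestronglyMeasurable).add
        (hA.1.inner (continuous_gradient hc).aestronglyMeasurable)
    · have : ENNReal.HolderConjugate q p := ENNReal.HolderConjugate.symm
      refine Integrable.add ?_ (Integrable.add ?_ ?_)
      · exact hg.norm.integrable_mul (hw2.norm.const_mul _)
      · exact hA.norm.integrable_mul (hwp.norm.const_mul _)
      · exact hA.norm.integrable_mul (hdw.norm.const_mul _)
    · intro j
      refine .of_forall fun x => ?_
      have h1 := hL.abs_le_mul_abs hθ0 (w x)
      have h2 := smoothCutoff_nonneg j x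
      have h3 := smoothCutoff_le_one j x
      have hj : 1 / ((j : ℝ) + 1) ≤ 1 := by
        rw [div_le_one (by positivity)]
        linarith [(Nat.cast_nonneg j : (0 : ℝ) ≤ j)]
      have h4 : ‖∇ (smoothCutoff n j) x‖ ≤ K :=
        (hK j x).trans (mul_le_of_le_one_right hK0 hj)
      have t1 : ‖g x * (θ (w x) * smoothCutoff n j x)‖ ≤ ‖g x‖ * (C * ‖w x‖) := by
        rw [norm_mul]
        refine mul_le_mul_of_nonneg_left ?_ (norm_nonneg _)
        rw [norm_mul, Real.norm_eq_abs, Real.norm_eq_abs, abs_of_nonneg h2]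
        exact (mul_le_of_le_one_right (abs_nonneg _) h3).trans h1
      have t2 : ‖inner ℝ (A x) (∇ (fun y => θ (w y) * smoothCutoff n j y) x)‖
          ≤ ‖A x‖ * (C * K * ‖w x‖) + ‖A x‖ * (C * ‖∇ w x‖) := by
        rw [hgrad, ← mul_add]
        refine (norm_inner_le_norm _ _).trans (mul_le_mul_of_nonneg_left ?_ (norm_nonneg _))
        refine (norm_add_le _ _).trans (add_le_add ?_ ?_)
        · rw [norm_smul, Real.norm_eq_abs]
          calc |θ (w x)| * ‖∇ (smoothCutoff n j) x‖ ≤ (C * |w x|) * K :=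
                mul_le_mul h1 h4 (norm_nonneg _) (by positivity)
            _ = C * K * ‖w x‖ := by rw [Real.norm_eq_abs]; ring
        · rw [norm_smul, norm_smul, Real.norm_eq_abs, Real.norm_eq_abs, abs_of_nonneg h2]
          have h5 : |deriv θ (w x)| * ‖∇ w x‖ ≤ C * ‖∇ w x‖ :=
            mul_le_mul_of_nonneg_right (hθ' _) (norm_nonneg _)
          exact (mul_le_of_le_one_left (by positivity) h3).trans h5
      exact (norm_add_le _ _).trans (add_le_add t1 t2)
    · refine .of_forall fun x => ?_
      simp_rw [hgrad]
      have h1 := tendsto_smoothCutoff x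
      have h2 : Tendsto (fun j => ∇ (smoothCutoff n j) x) atTop (𝓝 0) := by
        refine squeeze_zero_norm (fun j => hK j x) ?_
        simpa using (tendsto_one_div_add_atTop_nhds_zero_nat (𝕜 := ℝ)).const_mul K
      have h3 := ((h1.const_mul (θ (w x))).const_mul (g x)).add
        (tendsto_const_nhds (x := A x) |>.inner (𝕜 := ℝ)
          ((h2.const_smul (θ (w x))).add (h1.smul_const (deriv θ (w x) • ∇ w x))))
      simpa using h3
  simp_rw [hzero] at hlim
  exact (tendsto_nhds_unique hlim tendsto_const_nhds)

/-- Cauchy-Schwarz against the translated kernel, whose `L²` norm does not depend on `x`. With the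
next lemma it puts mollifications of `L²` functions in `L^p`, although `v` itself need not be there.
-/
lemma exists_norm_mollify_le (hv : MemLp v 2 volume) (k : ℕ) :
    ∃ M : ℝ, ∀ x, ‖mollify v k x‖ ≤ M := by
  have hη : MemLp (mollifier (EuclideanSpace ℝ (Fin n)) k) 2 volume :=
    (continuous_mollifier k).memLp_of_hasCompactSupport (hasCompactSupport_mollifier k)
  set B := eLpNorm (mollifier (EuclideanSpace ℝ (Fin n)) k) 2 volume * eLpNorm v 2 volume with hB
  have hBt : B ≠ ⊤ := ENNReal.mul_ne_top hη.2.ne hv.2.ne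
  refine ⟨B.toReal, fun x => ?_⟩
  have hm := Measure.measurePreserving_sub_left (volume : Measure (EuclideanSpace ℝ (Fin n))) x
  have hηx := hη.comp_measurePreserving hm
  have h1 : ‖mollify v k x‖ₑ ≤ B := by
    rw [mollify_apply]
    refine (enorm_integral_le_lintegral_enorm _).trans ?_
    have h2 := eLpNorm_le_eLpNorm_mul_eLpNorm_of_nnnorm (p := 2) (q := 2) (r := 1)
      hηx.1 hv.1 (fun a b => a • b) 1 (.of_forall fun y => by simp)
    rw [eLpNorm_one_eq_lintegral_enorm, eLpNorm_comp_measurePreserving hη.1 hm] at h2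
    simpa using h2
  rw [← toReal_enorm]
  exact ENNReal.toReal_mono hBt h1

/-- Interpolation: `|w|^p ≤ M^(p-2) |w|²`. -/
lemma memLp_of_memLp_two_of_bound (hp2 : 2 ≤ p) (hp : p ≠ ⊤) (hw : MemLp w 2 volume) {M : ℝ}
    (hM : ∀ x, ‖w x‖ ≤ M) : MemLp w p volume := by
  have hp0 : p ≠ 0 := (zero_lt_two.trans_le hp2).ne'
  have hpr : 2 ≤ p.toReal := by simpa using ENNReal.toReal_mono hp hp2
  rw [← integrable_norm_rpow_iff hw.1 hp0 hp]
  refine ((hw.integrable_norm_pow (by norm_num)).const_mul (M ^ (p.toReal - 2))).mono'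
    (hw.1.norm.aemeasurable.pow_const _).aestronglyMeasurable (.of_forall fun x => ?_)
  have h0 : 0 ≤ ‖w x‖ := norm_nonneg _
  rw [Real.norm_of_nonneg (Real.rpow_nonneg h0 _)]
  have e : ‖w x‖ ^ p.toReal = ‖w x‖ ^ (p.toReal - 2) * ‖w x‖ ^ 2 := by
    rw [← Real.rpow_natCast, ← Real.rpow_add_of_nonneg h0 (by linarith) (by norm_num)]
    norm_num
  rw [e]
  exact mul_le_mul_of_nonneg_right (Real.rpow_le_rpow h0 (hM x) (by linarith)) (by positivity)

/-- A weak formulation tested with all smooth compactly supported functions may be tested with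
`θ ∘ v` for every `v ∈ L²` with weak gradient in `L^p`. -/
theorem integral_test_comp [ENNReal.HolderConjugate p q] (hp2 : 2 ≤ p) (hp : p ≠ ⊤)
    (hg : MemLp g 2 volume) (hA : MemLp A q volume)
    (h : ∀ φ : EuclideanSpace ℝ (Fin n) → ℝ, ContDiff ℝ ∞ φ → HasCompactSupport φ →
      ∫ x, (g x * φ x + inner ℝ (A x) (∇ φ x)) = 0)
    (hv : MemLp v 2 volume) (hG : MemLp G p volume) (hvG : HasWeakGradient v G)
    (hθ : ContDiff ℝ ∞ θ) (hθ0 : θ 0 = 0) (hθ' : ∀ s, |deriv θ s| ≤ C) :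
    ∫ x, g x * θ (v x) = - ∫ x, deriv θ (v x) * inner ℝ (A x) (G x) := by
  have hL := lipschitzWith_of_abs_deriv_le hθ hθ'
  have hp1 : 1 ≤ p := one_le_two.trans hp2
  have hqp : ENNReal.HolderConjugate q p := ENNReal.HolderConjugate.symm
  have hvl : LocallyIntegrable v volume := hvG.locallyIntegrable
  have hdc : Continuous (deriv θ) := hθ.continuous_deriv (by simp)
  have hv2 : ∀ k, MemLp (mollify v k) 2 volume := fun k => hv.mollify (by norm_num) (by norm_num) k
  have hGk : ∀ k, MemLp (mollify G k) p volume := fun k => hG.mollify hp1 hp k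
  have hθv : ∀ k, MemLp (fun x => θ (mollify v k x)) 2 volume := fun k =>
    hL.memLp_comp hθ0 (hv2 k)
  have hAG : Integrable (fun x => ‖A x‖ * ‖G x‖) volume := hA.norm.integrable_mul hG.norm
  have hmk : ∀ k, AEStronglyMeasurable (fun x => deriv θ (mollify v k x)) volume := fun k =>
    (hdc.comp (contDiff_mollify hvl k).continuous).aestronglyMeasurable
  have hint1 : ∀ k, Integrable (fun x => g x * θ (mollify v k x)) volume := fun k =>
    hg.integrable_mul (hθv k)
  have hbd : ∀ (s : ℝ) (a b : EuclideanSpace ℝ (Fin n)),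
      ‖deriv θ s * inner ℝ a b‖ ≤ C * (‖a‖ * ‖b‖) := fun s a b => by
    rw [norm_mul]
    exact mul_le_mul (hθ' s) (norm_inner_le_norm a b) (norm_nonneg _) C.coe_nonneg
  have hint2 : ∀ k (K : EuclideanSpace ℝ (Fin n) → EuclideanSpace ℝ (Fin n)), MemLp K p volume →
      Integrable (fun x => deriv θ (mollify v k x) * inner ℝ (A x) (K x)) volume := fun k K hK =>
    ((hA.norm.integrable_mul hK.norm).const_mul (C : ℝ)).mono' ((hmk k).mul (hA.1.inner hK.1))
      (.of_forall fun x => hbd _ _ _)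
  -- The smooth version is applied to the mollification of `v`, and its gradient is split as
  -- `(mollify G k - G) + G`. The first part vanishes in `L^p` against a bounded factor; in the
  -- second only the factor `deriv θ` varies.
  have hk : ∀ k, ∫ x, g x * θ (mollify v k x)
      = - ((∫ x, deriv θ (mollify v k x) * inner ℝ (A x) (mollify G k x - G x))
        + ∫ x, deriv θ (mollify v k x) * inner ℝ (A x) (G x)) := by
    intro k
    obtain ⟨M, hM⟩ := exists_norm_mollify_le hv k
    have hgr : ∇ (mollify v k) = mollify G k := funext fun x => hvG.gradient_mollify k x
    have h1 := integral_test_smooth (p := p) (q := q) hg hA h (contDiff_mollify hvl k) (hv2 k)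
      (memLp_of_memLp_two_of_bound hp2 hp (hv2 k) hM) (by rw [hgr]; exact hGk k) hθ hθ0 hθ'
    rw [hgr] at h1
    simp_rw [inner_smul_right] at h1
    rw [integral_add (hint1 k) (hint2 k _ (hGk k))] at h1
    rw [← integral_add (hint2 k (fun x => mollify G k x - G x) ((hGk k).sub hG)) (hint2 k _ hG)]
    simp_rw [← mul_add, ← inner_add_right, sub_add_cancel]
    linarith
  have t1 : Tendsto (fun k => ∫ x, g x * θ (mollify v k x)) atTop (𝓝 (∫ x, g x * θ (v x))) := by
    have := tendsto_integral_bilin (ContinuousLinearMap.mul ℝ ℝ) (p := 2) (q := 2) hθv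
      (hL.memLp_comp hθ0 hv) hg (by
        have h0 := tendsto_eLpNorm_mollify_sub (by norm_num) (by norm_num) hv
        have h1 := ENNReal.Tendsto.const_mul (a := (C : ℝ≥0∞)) h0 (Or.inr ENNReal.coe_ne_top)
        rw [mul_zero] at h1
        refine tendsto_of_tendsto_of_tendsto_of_le_of_le tendsto_const_nhds h1
          (fun _ => zero_le) fun k => ?_
        refine eLpNorm_le_nnreal_smul_eLpNorm_of_ae_le_mul (c := C) (.of_forall fun x => ?_) 2
        rw [← NNReal.coe_le_coe]
        exact hL.norm_sub_le _ _)
    simpa [mul_comm] using this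
  have t2 : Tendsto (fun k => ∫ x, deriv θ (mollify v k x) * inner ℝ (A x) (mollify G k x - G x))
      atTop (𝓝 0) := by
    have h1 := tendsto_integral_bilin (ContinuousLinearMap.mul ℝ ℝ) (p := p) (q := q)
      (f := fun k x => ‖mollify G k x - G x‖) (f₀ := fun _ => 0)
      (fun k => ((hGk k).sub hG).norm) MemLp.zero' hA.norm (by
        simpa using tendsto_eLpNorm_mollify_sub hp1 hp hG)
    have h2 := h1.const_mul (C : ℝ)
    simp only [ContinuousLinearMap.mul_apply', zero_mul, integral_zero, mul_zero] at h2
    refine squeeze_zero_norm (fun k => ?_) h2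
    rw [← integral_const_mul]
    refine norm_integral_le_of_norm_le ?_ (.of_forall fun x => (hbd _ _ _).trans_eq (by ring))
    exact (((hGk k).sub hG).norm.integrable_mul hA.norm).const_mul _
  -- Almost everywhere convergence of the mollifications is enough here, with the fixed majorant `C
  -- ‖A‖ ‖G‖`.
  have t3 : Tendsto (fun k => ∫ x, deriv θ (mollify v k x) * inner ℝ (A x) (G x))
      atTop (𝓝 (∫ x, deriv θ (v x) * inner ℝ (A x) (G x))) := by
    refine tendsto_integral_of_dominated_convergence (fun x => C * (‖A x‖ * ‖G x‖))
      (fun k => (hint2 k G hG).1) (hAG.const_mul _) (fun k => .of_forall fun x => hbd _ _ _) ?_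
    filter_upwards [ae_tendsto_mollify hvl] with x hx
    exact ((hdc.tendsto _).comp hx).mul_const _
  have t4 := (t2.add t3).neg
  rw [zero_add] at t4
  exact tendsto_nhds_unique t1 (t4.congr fun k => (hk k).symm)

end Testing

/-! ### Pointwise inequalities for `|·|^p` and its gradient -/

section PLaplaceFlux

variable {V : Type*} [NormedAddCommGroup V] [InnerProductSpace ℝ V] {p : ℝ}

/-- The nonlinearity `a ↦ |a|^(p-2) a` of the `p`-Laplacian. -/
noncomputable def pFlux (p : ℝ) (a : V) : V := ‖a‖ ^ (p - 2) • a

lemma inner_pFlux (p : ℝ) (a b : V) : inner ℝ (pFlux p a) b = ‖a‖ ^ (p - 2) * inner ℝ a b := by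
  rw [pFlux, inner_smul_left]; rfl

lemma continuous_pFlux (hp : 2 < p) : Continuous (pFlux p : V → V) :=
  (continuous_norm.rpow_const fun _ => Or.inr (by linarith)).smul continuous_id

lemma norm_pFlux (hp : 2 < p) (a : V) : ‖pFlux p a‖ = ‖a‖ ^ (p - 1) := by
  have h : p - 1 = (p - 2) + 1 := by ring
  rw [pFlux, norm_smul, Real.norm_of_nonneg (by positivity), h,
    Real.rpow_add_of_nonneg (norm_nonneg a) (by linarith) zero_le_one, Real.rpow_one]

lemma inner_pFlux_self (hp : 2 < p) (a : V) : inner ℝ (pFlux p a) a = ‖a‖ ^ p := by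
  have h : p = (p - 2) + 2 := by ring
  rw [inner_pFlux, real_inner_self_eq_norm_sq]
  conv_rhs => rw [h, Real.rpow_add_of_nonneg (norm_nonneg a) (by linarith) zero_le_two]
  norm_num

/-- Convexity of `|·|^p`, in the form of the subgradient inequality. -/
lemma norm_rpow_add_inner_pFlux_le (hp : 2 < p) (a b : V) :
    ‖a‖ ^ p + p * inner ℝ (pFlux p a) (b - a) ≤ ‖b‖ ^ p := by
  rw [inner_sub_right, inner_pFlux_self hp]
  have h1 : inner ℝ (pFlux p a) b ≤ ‖a‖ ^ (p - 1) * ‖b‖ := by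
    rw [← norm_pFlux hp]; exact real_inner_le_norm _ _
  -- Young's inequality with the conjugate exponent `q = p / (p - 1)`, chosen so that `(‖a‖^(p-1))^q
  -- = ‖a‖^p`.
  have hpq : (p.conjExponent).HolderConjugate p :=
    (Real.HolderConjugate.conjExponent (by linarith)).symm
  have h2 := Real.young_inequality_of_nonneg (a := ‖a‖ ^ (p - 1)) (b := ‖b‖) (by positivity)
    (norm_nonneg b) hpq
  have e : (‖a‖ ^ (p - 1)) ^ p.conjExponent = ‖a‖ ^ p := by
    rw [← Real.rpow_mul (norm_nonneg a), Real.conjExponent, mul_div_cancel₀ _ (by linarith)]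
  rw [e] at h2
  have e2 : ‖a‖ ^ p / p.conjExponent = ‖a‖ ^ p - ‖a‖ ^ p / p := by
    rw [Real.conjExponent]
    have : p ≠ 0 := by linarith
    have : p - 1 ≠ 0 := by linarith
    field_simp
  rw [e2] at h2
  have h3 : p * inner ℝ (pFlux p a) b ≤ p * (‖a‖ ^ p - ‖a‖ ^ p / p + ‖b‖ ^ p / p) :=
    mul_le_mul_of_nonneg_left (h1.trans h2) (by linarith)
  have h4 : p * (‖a‖ ^ p - ‖a‖ ^ p / p + ‖b‖ ^ p / p) = p * ‖a‖ ^ p - ‖a‖ ^ p + ‖b‖ ^ p := by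
    have : p ≠ 0 := by linarith
    field_simp
  linarith

/-- Add the subgradient inequalities at `a` and at `b`. This monotonicity is the source of
uniqueness. -/
lemma inner_pFlux_sub_nonneg (hp : 2 < p) (a b : V) :
    0 ≤ inner ℝ (pFlux p a - pFlux p b) (a - b) := by
  have h1 := norm_rpow_add_inner_pFlux_le hp a b
  have h2 := norm_rpow_add_inner_pFlux_le hp b a
  have e : inner ℝ (pFlux p a) (b - a) = - inner ℝ (pFlux p a) (a - b) := by
    rw [← inner_neg_right, neg_sub]
  rw [e] at h1
  rw [inner_sub_left]
  have h3 : 0 ≤ p * (inner ℝ (pFlux p a) (a - b) - inner ℝ (pFlux p b) (a - b)) := by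
    linarith
  exact nonneg_of_mul_nonneg_right h3 (by linarith)

/-- Clarkson's inequality for the `p`-th power of a Hilbert space norm, `p ≥ 2`. -/
lemma norm_rpow_midpoint_add_le (hp : 2 < p) (a b : V) :
    ‖(1 / 2 : ℝ) • (a + b)‖ ^ p + ‖(1 / 2 : ℝ) • (a - b)‖ ^ p ≤ (‖a‖ ^ p + ‖b‖ ^ p) / 2 := by
  -- With `r = p / 2`, the map `s ↦ s^r` is superadditive and convex. Superadditivity is applied to
  -- the squared norms on the left, the parallelogram law evaluates their sum, and convexity bounds
  -- the power of the resulting mean.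
  have hp2 : 1 ≤ p / 2 := by linarith
  have hpow : ∀ c : V, ‖c‖ ^ p = (‖c‖ ^ 2) ^ (p / 2) := fun c => by
    rw [← Real.rpow_natCast, ← Real.rpow_mul (norm_nonneg c)]
    congr 1
    push_cast
    ring
  have hsum : ‖(1 / 2 : ℝ) • (a + b)‖ ^ 2 + ‖(1 / 2 : ℝ) • (a - b)‖ ^ 2
      = (1 / 2) * ‖a‖ ^ 2 + (1 / 2) * ‖b‖ ^ 2 := by
    have := parallelogram_law_with_norm ℝ a b
    rw [norm_smul, norm_smul, mul_pow, mul_pow]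
    norm_num
    linarith [sq (‖a + b‖), sq (‖a - b‖), sq ‖a‖, sq ‖b‖]
  have h1 := Real.add_rpow_le_rpow_add (sq_nonneg ‖(1 / 2 : ℝ) • (a + b)‖)
    (sq_nonneg ‖(1 / 2 : ℝ) • (a - b)‖) hp2
  have h2 := (convexOn_rpow hp2).2 (mem_Ici.2 (sq_nonneg ‖a‖)) (mem_Ici.2 (sq_nonneg ‖b‖))
    (by norm_num : (0 : ℝ) ≤ 1 / 2) (by norm_num : (0 : ℝ) ≤ 1 / 2) (by norm_num)
  simp only [smul_eq_mul] at h2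
  rw [hsum] at h1
  rw [hpow, hpow, hpow a, hpow b]
  linarith

lemma norm_rpow_convex (hp : 2 < p) (a b : V) {s t : ℝ} (hs : 0 ≤ s) (ht : 0 ≤ t)
    (hst : s + t = 1) : ‖s • a + t • b‖ ^ p ≤ s * ‖a‖ ^ p + t * ‖b‖ ^ p := by
  have h1 : ‖s • a + t • b‖ ≤ s * ‖a‖ + t * ‖b‖ := by
    refine (norm_add_le _ _).trans_eq ?_
    rw [norm_smul, norm_smul, Real.norm_of_nonneg hs, Real.norm_of_nonneg ht]
  have h2 := (convexOn_rpow (by linarith : 1 ≤ p)).2 (mem_Ici.2 (norm_nonneg a))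
    (mem_Ici.2 (norm_nonneg b)) hs ht hst
  exact (Real.rpow_le_rpow (norm_nonneg _) h1 (by linarith)).trans h2

end PLaplaceFlux

/-! ### Powers of `L^p` norms and integrability of the flux -/

section LpPower

variable {α : Type*} [MeasurableSpace α] {μ : Measure α} {F : Type*} [NormedAddCommGroup F]
  {p : ℝ} {f : α → F}

lemma memLp_ofReal_iff_integrable_rpow (hp : 2 < p) (hf : AEStronglyMeasurable f μ) :
    MemLp f (ENNReal.ofReal p) μ ↔ Integrable (fun x => ‖f x‖ ^ p) μ := by
  have := integrable_norm_rpow_iff (p := ENNReal.ofReal p) hf (by simp; linarith) (by simp)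
  rw [ENNReal.toReal_ofReal (by linarith)] at this
  exact this.symm

lemma MeasureTheory.MemLp.integrable_norm_rpow_ofReal (hp : 2 < p)
    (hf : MemLp f (ENNReal.ofReal p) μ) : Integrable (fun x => ‖f x‖ ^ p) μ :=
  (memLp_ofReal_iff_integrable_rpow hp hf.1).1 hf

lemma MeasureTheory.MemLp.eLpNorm_rpow_ofReal (hp : 2 < p) (hf : MemLp f (ENNReal.ofReal p) μ) :
    eLpNorm f (ENNReal.ofReal p) μ ^ p = ENNReal.ofReal (∫ x, ‖f x‖ ^ p ∂μ) := by
  have hp0 : 0 < p := by linarith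
  rw [hf.eLpNorm_eq_integral_rpow_norm (by simp; linarith) (by simp),
    ENNReal.toReal_ofReal hp0.le, ENNReal.ofReal_rpow_of_nonneg (by positivity) hp0.le,
    ← Real.rpow_mul (by positivity), inv_mul_cancel₀ hp0.ne', Real.rpow_one]

lemma MeasureTheory.MemLp.norm_toLp_rpow_ofReal (hp : 2 < p)
    (hf : MemLp f (ENNReal.ofReal p) μ) : ‖hf.toLp f‖ ^ p = ∫ x, ‖f x‖ ^ p ∂μ := by
  rw [Lp.norm_toLp, ENNReal.toReal_rpow, hf.eLpNorm_rpow_ofReal hp, ENNReal.toReal_ofReal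
    (by positivity)]

lemma MeasureTheory.MemLp.pFlux {V : Type*} [NormedAddCommGroup V] [InnerProductSpace ℝ V]
    {f : α → V} (hp : 2 < p) (hf : MemLp f (ENNReal.ofReal p) μ) :
    MemLp (fun x => _root_.pFlux p (f x)) (ENNReal.ofReal p.conjExponent) μ := by
  have hm : AEStronglyMeasurable (fun x => _root_.pFlux p (f x)) μ :=
    (continuous_pFlux hp).comp_aestronglyMeasurable hf.1
  have hq : 0 < p.conjExponent := (Real.HolderConjugate.conjExponent (by linarith)).symm.pos
  rw [← integrable_norm_rpow_iff hm (by simpa using hq) (by simp), ENNReal.toReal_ofReal hq.le]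
  refine (hf.integrable_norm_rpow_ofReal hp).congr (.of_forall fun x => ?_)
  simp only
  rw [norm_pFlux hp, ← Real.rpow_mul (norm_nonneg _), Real.conjExponent,
    mul_div_cancel₀ _ (by linarith)]

lemma holderConjugate_ofReal_conjExponent (hp : 2 < p) :
    ENNReal.HolderConjugate (ENNReal.ofReal p) (ENNReal.ofReal p.conjExponent) :=
  (Real.HolderConjugate.conjExponent (by linarith)).ennrealOfReal

end LpPower

/-! ### The `p`-Dirichlet energy is convex and lower semicontinuous -/

section DirichletEnergy

variable {n : ℕ} {p : ℝ}

/-- The domain of the `p`-Dirichlet energy: `L²` functions with weak gradient in `L^p`. -/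
def dirichletDomain (n : ℕ) (p : ℝ) : Set (Lp ℝ 2 (volume : Measure (EuclideanSpace ℝ (Fin n)))) :=
  {v | HasWeakGradient v (weakGrad v) ∧ MemLp (weakGrad v) (ENNReal.ofReal p) volume}

/-- The `p`-Dirichlet energy. -/
noncomputable def dirichletEnergy (p : ℝ)
    (v : Lp ℝ 2 (volume : Measure (EuclideanSpace ℝ (Fin n)))) : ℝ :=
  1 / p * ∫ x, ‖weakGrad v x‖ ^ p

variable {v w : Lp ℝ 2 (volume : Measure (EuclideanSpace ℝ (Fin n)))}
  {f : EuclideanSpace ℝ (Fin n) → ℝ}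
  {G K : EuclideanSpace ℝ (Fin n) → EuclideanSpace ℝ (Fin n)}

/-- Domain and energy refer to the canonical representative `weakGrad`; this allows any
representative of the function and of its gradient to be used instead. -/
lemma mem_dirichletDomain_of_hasWeakGradient (hvf : v =ᵐ[volume] f) (h : HasWeakGradient f G)
    (hG : MemLp G (ENNReal.ofReal p) volume) :
    v ∈ dirichletDomain n p ∧ weakGrad v =ᵐ[volume] G := by
  have h1 : HasWeakGradient v G := h.congr hvf.symm .rfl
  have h2 := h1.weakGrad_ae_eq
  exact ⟨⟨h1.congr .rfl h2.symm, hG.ae_eq h2.symm⟩, h2⟩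

lemma dirichletEnergy_eq (h : weakGrad v =ᵐ[volume] G) :
    dirichletEnergy p v = 1 / p * ∫ x, ‖G x‖ ^ p := by
  unfold dirichletEnergy
  congr 1
  refine integral_congr_ae ?_
  filter_upwards [h] with x hx
  rw [hx]

lemma weakGrad_combination (hv : v ∈ dirichletDomain n p) (hw : w ∈ dirichletDomain n p)
    (s t : ℝ) :
    s • v + t • w ∈ dirichletDomain n p ∧
      weakGrad (s • v + t • w : Lp ℝ 2 _) =ᵐ[volume]
        fun x => s • weakGrad v x + t • weakGrad w x := by
  refine mem_dirichletDomain_of_hasWeakGradient (f := fun x => s * v x + t * w x) ?_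
    ((hv.1.const_smul s).add (hw.1.const_smul t)) ((hv.2.const_smul s).add (hw.2.const_smul t))
  filter_upwards [Lp.coeFn_add (s • v) (t • w), Lp.coeFn_smul s v, Lp.coeFn_smul t w]
    with x h1 h2 h3
  rw [h1, Pi.add_apply, h2, h3]
  simp

lemma integral_norm_rpow_midpoint_add_le (hp : 2 < p) (hG : MemLp G (ENNReal.ofReal p) volume)
    (hK : MemLp K (ENNReal.ofReal p) volume) :
    (∫ x, ‖(1 / 2 : ℝ) • G x + (1 / 2 : ℝ) • K x‖ ^ p)
      + (∫ x, ‖(1 / 2 : ℝ) • (G x - K x)‖ ^ p)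
      ≤ ((∫ x, ‖G x‖ ^ p) + ∫ x, ‖K x‖ ^ p) / 2 := by
  have hi1 : Integrable (fun x => ‖(1 / 2 : ℝ) • G x + (1 / 2 : ℝ) • K x‖ ^ p) volume :=
    ((hG.const_smul (1 / 2 : ℝ)).add (hK.const_smul (1 / 2 : ℝ))).integrable_norm_rpow_ofReal hp
  have hi2 : Integrable (fun x => ‖(1 / 2 : ℝ) • (G x - K x)‖ ^ p) volume :=
    ((hG.sub hK).const_smul (1 / 2 : ℝ)).integrable_norm_rpow_ofReal hp
  have hi3 := hG.integrable_norm_rpow_ofReal hp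
  have hi4 := hK.integrable_norm_rpow_ofReal hp
  rw [← integral_add hi1 hi2, ← integral_add hi3 hi4, ← integral_div]
  refine integral_mono (hi1.add hi2) ((hi3.add hi4).div_const 2) fun x => ?_
  have := norm_rpow_midpoint_add_le hp (G x) (K x)
  rw [smul_add] at this
  exact this

/-- Clarkson's inequality for the Dirichlet energy. -/
lemma dirichletEnergy_midpoint (hp : 2 < p) (hv : v ∈ dirichletDomain n p)
    (hw : w ∈ dirichletDomain n p) :
    dirichletEnergy p ((1 / 2 : ℝ) • v + (1 / 2 : ℝ) • w)
      + 1 / p * ∫ x, ‖(1 / 2 : ℝ) • (weakGrad v x - weakGrad w x)‖ ^ p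
      ≤ (dirichletEnergy p v + dirichletEnergy p w) / 2 := by
  have hp0 : 0 < p := by linarith
  have key := mul_le_mul_of_nonneg_left (integral_norm_rpow_midpoint_add_le hp hv.2 hw.2)
    (by positivity : 0 ≤ 1 / p)
  rw [dirichletEnergy_eq (weakGrad_combination hv hw (1 / 2) (1 / 2)).2]
  unfold dirichletEnergy
  calc _ = _ := (mul_add _ _ _).symm
    _ ≤ _ := key
    _ = _ := by ring

lemma convexOn_dirichletEnergy (hp : 2 < p) :
    ConvexOn ℝ (dirichletDomain n p) (dirichletEnergy p) := by
  refine ⟨fun v hv w hw s t _ _ _ => (weakGrad_combination hv hw s t).1,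
    fun v hv w hw s t hs ht hst => ?_⟩
  have hp0 : 0 < p := by linarith
  rw [dirichletEnergy_eq (weakGrad_combination hv hw _ _).2]
  unfold dirichletEnergy
  have hi3 := hv.2.integrable_norm_rpow_ofReal hp
  have hi4 := hw.2.integrable_norm_rpow_ofReal hp
  have key : (∫ x, ‖s • weakGrad v x + t • weakGrad w x‖ ^ p)
      ≤ s * (∫ x, ‖weakGrad v x‖ ^ p) + t * ∫ x, ‖weakGrad w x‖ ^ p := by
    rw [← integral_const_mul, ← integral_const_mul,
      ← integral_add (hi3.const_mul _) (hi4.const_mul _)]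
    exact integral_mono
      (((hv.2.const_smul s).add (hw.2.const_smul t)).integrable_norm_rpow_ofReal hp)
      ((hi3.const_mul _).add (hi4.const_mul _)) fun x => norm_rpow_convex hp _ _ hs ht hst
  have := mul_le_mul_of_nonneg_left key (by positivity : 0 ≤ 1 / p)
  simp only [smul_eq_mul]
  linarith

lemma dirichletEnergy_nonneg (hp : 2 < p)
    (v : Lp ℝ 2 (volume : Measure (EuclideanSpace ℝ (Fin n)))) : 0 ≤ dirichletEnergy p v := by
  have : 0 < p := by linarith
  unfold dirichletEnergy
  positivity

/-- A sequence in the domain which converges in `L²` and whose gradients are Cauchy in the sense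
that `∫ |(∇v_i - ∇v_j)/2|^p` is small has its limit in the domain, with convergence of energies. -/
lemma dirichletEnergy_of_cauchy (hp : 2 < p)
    {z : ℕ → Lp ℝ 2 (volume : Measure (EuclideanSpace ℝ (Fin n)))}
    (hz : ∀ k, z k ∈ dirichletDomain n p) (hzv : Tendsto z atTop (𝓝 v)) {b : ℕ → ℝ}
    (hb : Tendsto b atTop (𝓝 0))
    (hcau : ∀ i j, i ≤ j →
      1 / p * ∫ x, ‖(1 / 2 : ℝ) • (weakGrad (z i) x - weakGrad (z j) x)‖ ^ p ≤ b i) :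
    v ∈ dirichletDomain n p ∧
      Tendsto (fun k => dirichletEnergy p (z k)) atTop (𝓝 (dirichletEnergy p v)) := by
  have hp0 : 0 < p := by linarith
  have : Fact (1 ≤ ENNReal.ofReal p) := ⟨by
    rw [← ENNReal.ofReal_one]; exact ENNReal.ofReal_le_ofReal (by linarith)⟩
  -- The hypothesis says that the gradients are Cauchy in the complete space `L^p`. Their limit is
  -- the weak gradient of `v` because the weak gradient is closed.
  let g : ℕ → Lp (EuclideanSpace ℝ (Fin n)) (ENNReal.ofReal p) volume := fun k => (hz k).2.toLp _
  have hdist : ∀ i j, i ≤ j → ‖g i - g j‖ ≤ 2 * (p * b i) ^ p⁻¹ := by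
    intro i j hij
    have h1 := hcau i j hij
    have hm := ((hz i).2.sub (hz j).2)
    have h2 : g i - g j = hm.toLp _ := (MemLp.toLp_sub _ _).symm
    have h3 := hm.norm_toLp_rpow_ofReal hp
    rw [← h2] at h3
    have h4 : ∀ x, ‖(1 / 2 : ℝ) • (weakGrad (z i) x - weakGrad (z j) x)‖ ^ p
        = (1 / 2) ^ p * ‖(weakGrad (z i) - weakGrad (z j)) x‖ ^ p := fun x => by
      rw [norm_smul, Real.mul_rpow (norm_nonneg _) (norm_nonneg _)]
      norm_num
    simp_rw [h4] at h1
    rw [integral_const_mul, ← h3, ← Real.mul_rpow (by norm_num) (norm_nonneg _),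
      one_div_mul_eq_div, div_le_iff₀ hp0] at h1
    have h5 : (1 / 2 * ‖g i - g j‖) ≤ (p * b i) ^ p⁻¹ := by
      rw [Real.le_rpow_inv_iff_of_pos (by positivity) (le_trans (by positivity)
        (h1.trans_eq (mul_comm _ _))) hp0]
      linarith
    linarith
  have hgc : CauchySeq g := by
    rw [Metric.cauchySeq_iff']
    intro ε hε
    have h1 : Tendsto (fun i => 2 * (p * b i) ^ p⁻¹) atTop (𝓝 (2 * (p * 0) ^ p⁻¹)) :=
      ((hb.const_mul p).rpow_const (Or.inr (by positivity))).const_mul 2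
    rw [mul_zero, Real.zero_rpow (by positivity), mul_zero] at h1
    obtain ⟨N, hN⟩ := (h1.eventually_lt_const hε).exists
    refine ⟨N, fun k hk => ?_⟩
    rw [dist_comm, dist_eq_norm]
    exact (hdist N k hk).trans_lt hN
  obtain ⟨g₀, hg₀⟩ := cauchySeq_tendsto_of_complete hgc
  have := holderConjugate_ofReal_conjExponent hp
  have hlv : Tendsto (fun k => eLpNorm (fun x => z k x - v x) 2 volume) atTop (𝓝 0) :=
    (Lp.tendsto_Lp_iff_tendsto_eLpNorm' z v).1 hzv
  have hlG : Tendsto (fun k => eLpNorm (fun x => weakGrad (z k) x - g₀ x) (ENNReal.ofReal p)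
      volume) atTop (𝓝 0) := by
    refine ((Lp.tendsto_Lp_iff_tendsto_eLpNorm' g g₀).1 hg₀).congr fun k => ?_
    refine eLpNorm_congr_ae ?_
    filter_upwards [(hz k).2.coeFn_toLp] with x hx
    simp only [Pi.sub_apply, g, hx]
  have hwg : HasWeakGradient v g₀ := HasWeakGradient.of_tendsto (p := 2) (q := 2)
    (r := ENNReal.ofReal p) (s := ENNReal.ofReal p.conjExponent) (fun k => Lp.memLp (z k))
    (fun k => (hz k).2) (Lp.memLp v) (Lp.memLp g₀) (fun k => (hz k).1) hlv hlG
  obtain ⟨hvD, hvg⟩ := mem_dirichletDomain_of_hasWeakGradient .rfl hwg (Lp.memLp g₀)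
  refine ⟨hvD, ?_⟩
  have e1 : ∀ k, dirichletEnergy p (z k) = 1 / p * ‖g k‖ ^ p := fun k => by
    rw [(hz k).2.norm_toLp_rpow_ofReal hp]; rfl
  have e2 : dirichletEnergy p v = 1 / p * ‖g₀‖ ^ p := by
    rw [dirichletEnergy_eq hvg, ← (Lp.memLp g₀).norm_toLp_rpow_ofReal hp, Lp.toLp_coeFn]
  rw [e2]
  simp_rw [e1]
  exact (hg₀.norm.rpow_const (Or.inr hp0.le)).const_mul _

/-- Lower semicontinuity uses convexity in place of weak compactness. Let `I m` be the infimum of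
the energy over the part of the domain within `1 / (m + 1)` of `x₀`; these infima increase and stay
below `c₀`. Almost minimisers converge to `x₀`, and their midpoints are again competitors, so
Clarkson's inequality forces their gradients to be Cauchy. The energies then converge to that of
`x₀`. -/
theorem isConvexEnergy_dirichletEnergy (hp : 2 < p) :
    IsConvexEnergy (dirichletDomain n p) (dirichletEnergy p) where
  convexOn := convexOn_dirichletEnergy hp
  nonneg v _ := dirichletEnergy_nonneg hp v
  nonempty := ⟨0, (mem_dirichletDomain_of_hasWeakGradient (f := 0) (G := ∇ 0)
    (Lp.coeFn_zero _ _ _) (hasWeakGradient_of_contDiff contDiff_const) (by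
      have : ∇ (0 : EuclideanSpace ℝ (Fin n) → ℝ) = 0 := by
        ext1 x
        exact gradient_const x 0
      rw [this]
      exact MemLp.zero)).1⟩
  lsc x c x₀ c₀ hxc hx hc := by
    have hp0 : 0 < p := by linarith
    let r : ℕ → ℝ := fun m => 1 / ((m : ℝ) + 1)
    have hr0 : Tendsto r atTop (𝓝 0) := tendsto_one_div_add_atTop_nhds_zero_nat
    have hr : ∀ m, 0 < r m := fun m => Nat.one_div_pos_of_nat
    have hranti : ∀ {i j}, i ≤ j → r j ≤ r i := fun h => Nat.one_div_le_one_div h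
    let S : ℕ → Set (Lp ℝ 2 (volume : Measure (EuclideanSpace ℝ (Fin n)))) := fun m =>
      dirichletDomain n p ∩ Metric.closedBall x₀ (r m)
    have hSconv : ∀ m, Convex ℝ (S m) := fun m =>
      (convexOn_dirichletEnergy hp).1.inter (convex_closedBall _ _)
    have hSmono : ∀ {i j}, i ≤ j → S j ⊆ S i := fun h =>
      inter_subset_inter_right _ (Metric.closedBall_subset_closedBall (hranti h))
    have hxS : ∀ m, ∀ᶠ k in atTop, x k ∈ S m := fun m => by
      filter_upwards [hx (Metric.closedBall_mem_nhds x₀ (hr m))] with k hk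
      exact ⟨(hxc k).1, hk⟩
    let I : ℕ → ℝ := fun m => sInf (dirichletEnergy p '' S m)
    have hbdd : ∀ m, BddBelow (dirichletEnergy p '' S m) := fun m =>
      ⟨0, by rintro _ ⟨z, _, rfl⟩; exact dirichletEnergy_nonneg hp z⟩
    have hne : ∀ m, (S m).Nonempty := fun m => (hxS m).exists.elim fun k hk => ⟨x k, hk⟩
    have hI_le : ∀ m, ∀ z ∈ S m, I m ≤ dirichletEnergy p z := fun m z hz =>
      csInf_le (hbdd m) ⟨z, hz, rfl⟩
    have hI_mono : Monotone I := fun i j hij =>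
      csInf_le_csInf (hbdd i) ((hne j).image _) (image_mono (hSmono hij))
    have hI_c : ∀ m, I m ≤ c₀ := fun m => by
      refine ge_of_tendsto hc ?_
      filter_upwards [hxS m] with k hk
      exact (hI_le m _ hk).trans (hxc k).2
    have hIbdd : BddAbove (range I) := ⟨c₀, by rintro _ ⟨m, rfl⟩; exact hI_c m⟩
    have hIlim := tendsto_atTop_ciSup hI_mono hIbdd
    have hex : ∀ m, ∃ z ∈ S m, dirichletEnergy p z < I m + r m := fun m => by
      obtain ⟨_, ⟨z, hz, rfl⟩, h2⟩ := exists_lt_of_csInf_lt ((hne m).image (dirichletEnergy p))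
        (lt_add_of_pos_right (I m) (hr m))
      exact ⟨z, hz, h2⟩
    choose z hzS hzE using hex
    have hzlim : Tendsto z atTop (𝓝 x₀) :=
      tendsto_iff_dist_tendsto_zero.2 (squeeze_zero (fun _ => dist_nonneg) (fun m => (hzS m).2) hr0)
    -- For `i ≤ j`, Clarkson bounds the gradient difference by `(I i + r i + I j + r j) / 2 - I i`,
    -- hence by `(I j - I i) / 2 + r i`.
    have hb0 : Tendsto (fun m => ((⨆ i, I i) - I m) / 2 + r m) atTop (𝓝 0) := by
      simpa using ((hIlim.const_sub (⨆ i, I i)).div_const 2).add hr0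
    obtain ⟨hD, hE⟩ := dirichletEnergy_of_cauchy hp (fun m => (hzS m).1) hzlim hb0
      fun i j hij => by
        have h1 := dirichletEnergy_midpoint hp (hzS i).1 (hzS j).1
        have h2 := hI_le i _ (hSconv i (hzS i) (hSmono hij (hzS j))
          (by norm_num : (0 : ℝ) ≤ 1 / 2) (by norm_num : (0 : ℝ) ≤ 1 / 2) (by norm_num))
        have h3 := hzE i
        have h4 := hzE j
        have h5 := hranti hij
        have h6 : I j ≤ ⨆ i, I i := le_ciSup hIbdd j
        linarith
    refine ⟨hD, le_of_tendsto_of_tendsto hE (hr0.const_add c₀) (.of_forall fun m => ?_) |>.trans_eq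
      (add_zero _)⟩
    exact (hzE m).le.trans (by simpa using hI_c m)

end DirichletEnergy

/-! ### The first variation of the Dirichlet energy -/

section EulerLagrange

variable {n : ℕ} {p : ℝ}

lemma tendsto_integral_inner_pFlux_add_smul (hp : 2 < p)
    {G Γ : EuclideanSpace ℝ (Fin n) → EuclideanSpace ℝ (Fin n)}
    (hG : MemLp G (ENNReal.ofReal p) volume) (hΓ : MemLp Γ (ENNReal.ofReal p) volume) :
    Tendsto (fun k : ℕ => ∫ x, inner ℝ (pFlux p (G x + (1 / ((k : ℝ) + 1)) • Γ x)) (Γ x))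
      atTop (𝓝 (∫ x, inner ℝ (pFlux p (G x)) (Γ x))) := by
  have hs1 : ∀ k : ℕ, (1 / ((k : ℝ) + 1)) ≤ 1 := fun k => by
    rw [div_le_one (by positivity)]; linarith [k.cast_nonneg (α := ℝ)]
  have hi : Integrable (fun x => (‖G x‖ + ‖Γ x‖) ^ p) volume := by
    have := (hG.norm.add hΓ.norm).integrable_norm_rpow_ofReal hp
    refine this.congr (.of_forall fun x => ?_)
    simp only [Pi.add_apply]
    rw [Real.norm_of_nonneg (by positivity)]
  refine tendsto_integral_of_dominated_convergence (fun x => (‖G x‖ + ‖Γ x‖) ^ p)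
    (fun k => ?_) hi (fun k => ?_) ?_
  · exact ((continuous_pFlux hp).comp_aestronglyMeasurable
      (hG.1.add (hΓ.1.const_smul (1 / ((k : ℝ) + 1))))).inner hΓ.1
  · refine .of_forall fun x => ?_
    have h1 : ‖G x + (1 / ((k : ℝ) + 1)) • Γ x‖ ≤ ‖G x‖ + ‖Γ x‖ := by
      refine (norm_add_le _ _).trans (by gcongr; rw [norm_smul, Real.norm_of_nonneg (by positivity)]
                                         exact mul_le_of_le_one_left (norm_nonneg _) (hs1 k))
    have h0 : 0 ≤ ‖G x‖ + ‖Γ x‖ := by positivity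
    refine (norm_inner_le_norm _ _).trans ?_
    rw [norm_pFlux hp]
    calc _ ≤ (‖G x‖ + ‖Γ x‖) ^ (p - 1) * (‖G x‖ + ‖Γ x‖) := by
          gcongr
          · linarith
          · linarith [norm_nonneg (G x)]
      _ = (‖G x‖ + ‖Γ x‖) ^ p := by
          rw [← Real.rpow_add_one' h0 (by linarith), sub_add_cancel]
  · refine .of_forall fun x => ?_
    have h1 : Tendsto (fun k : ℕ => G x + (1 / ((k : ℝ) + 1)) • Γ x) atTop
        (𝓝 (G x + (0 : ℝ) • Γ x)) :=
      (tendsto_one_div_add_atTop_nhds_zero_nat.smul_const _).const_add _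
    rw [zero_smul, add_zero] at h1
    exact (((continuous_pFlux hp).tendsto _).comp h1).inner tendsto_const_nhds

lemma MeasureTheory.MemLp.integrable_inner_pFlux (hp : 2 < p)
    {G Γ : EuclideanSpace ℝ (Fin n) → EuclideanSpace ℝ (Fin n)}
    (hG : MemLp G (ENNReal.ofReal p) volume) (hΓ : MemLp Γ (ENNReal.ofReal p) volume) :
    Integrable (fun x => inner ℝ (_root_.pFlux p (G x)) (Γ x)) volume := by
  have := holderConjugate_ofReal_conjExponent hp
  have : ENNReal.HolderConjugate (ENNReal.ofReal p.conjExponent) (ENNReal.ofReal p) :=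
    ENNReal.HolderConjugate.symm
  exact integrable_bilin (innerSL ℝ) (hG.pFlux hp) hΓ

/-- Convexity of `|·|^p` is used at the perturbed point, which bounds the energy increment from
above without differentiating under the integral. Continuity of the flux then suffices for the limit
`s → 0`. -/
lemma integral_norm_rpow_add_smul_le (hp : 2 < p)
    {G Γ : EuclideanSpace ℝ (Fin n) → EuclideanSpace ℝ (Fin n)}
    (hG : MemLp G (ENNReal.ofReal p) volume) (hΓ : MemLp Γ (ENNReal.ofReal p) volume) (s : ℝ) :
    ∫ x, ‖G x + s • Γ x‖ ^ p
      ≤ (∫ x, ‖G x‖ ^ p) + p * s * ∫ x, inner ℝ (pFlux p (G x + s • Γ x)) (Γ x) := by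
  have hGs : MemLp (fun x => G x + s • Γ x) (ENNReal.ofReal p) volume := hG.add (hΓ.const_smul s)
  have hi := hGs.integrable_inner_pFlux hp hΓ
  have hi' := hG.integrable_norm_rpow_ofReal hp
  rw [← integral_const_mul, ← integral_add hi' (hi.const_mul _)]
  refine integral_mono (hGs.integrable_norm_rpow_ofReal hp) (hi'.add (hi.const_mul _)) fun x => ?_
  have := norm_rpow_add_inner_pFlux_le hp (G x + s • Γ x) (G x)
  have e : G x - (G x + s • Γ x) = -(s • Γ x) := by abel
  rw [e, inner_neg_right, inner_smul_right] at this
  simp only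
  linarith

variable {v a : Lp ℝ 2 (volume : Measure (EuclideanSpace ℝ (Fin n)))}

/-- The subgradient inequality is tested with `v + s φ` and divided by `s = 1 / (k + 1)`, which
tends to zero. This is one half of the equation; replacing `φ` by `-φ` gives the other. -/
lemma neg_inner_le_of_subgradient (hp : 2 < p) (hv : v ∈ dirichletDomain n p)
    (h : ∀ y ∈ dirichletDomain n p,
      dirichletEnergy p v + inner ℝ (-a) (y - v) ≤ dirichletEnergy p y)
    {φ : EuclideanSpace ℝ (Fin n) → ℝ} (hφ : ContDiff ℝ ∞ φ) (hφc : HasCompactSupport φ) :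
    0 ≤ (∫ x, a x * φ x) + ∫ x, inner ℝ (pFlux p (weakGrad v x)) (∇ φ x) := by
  have hp0 : 0 < p := by linarith
  have hφ2 : MemLp φ 2 volume := hφ.continuous.memLp_of_hasCompactSupport hφc
  have hΓ : MemLp (∇ φ) (ENNReal.ofReal p) volume :=
    (continuous_gradient hφ).memLp_of_hasCompactSupport hφc.gradient
  have hφD := mem_dirichletDomain_of_hasWeakGradient (p := p) hφ2.coeFn_toLp
    (hasWeakGradient_of_contDiff hφ) hΓ
  have hin : inner ℝ a (hφ2.toLp φ) = ∫ x, a x * φ x := by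
    rw [L2.inner_def]
    refine integral_congr_ae ?_
    filter_upwards [hφ2.coeFn_toLp] with x hx
    rw [hx, real_inner_eq_re_inner, RCLike.inner_apply]
    simp [mul_comm]
  have key : ∀ k : ℕ, -(∫ x, a x * φ x)
      ≤ ∫ x, inner ℝ (pFlux p (weakGrad v x + (1 / ((k : ℝ) + 1)) • ∇ φ x)) (∇ φ x) := by
    intro k
    have hs : 0 < 1 / ((k : ℝ) + 1) := by positivity
    generalize 1 / ((k : ℝ) + 1) = s at hs
    obtain ⟨h1, h2⟩ := weakGrad_combination hv hφD.1 1 s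
    have h3 := h _ h1
    have e1 : (1 : ℝ) • v + s • hφ2.toLp φ - v = s • hφ2.toLp φ := by
      rw [one_smul]; abel
    rw [e1, inner_neg_left, inner_smul_right, hin] at h3
    have h4 : weakGrad ((1 : ℝ) • v + s • hφ2.toLp φ : Lp ℝ 2 _) =ᵐ[volume]
        fun x => weakGrad v x + s • ∇ φ x := by
      filter_upwards [h2, hφD.2] with x hx hx'
      rw [hx, hx', one_smul]
    rw [dirichletEnergy_eq h4] at h3
    have h5 := mul_le_mul_of_nonneg_left (integral_norm_rpow_add_smul_le hp hv.2 hΓ s)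
      (by positivity : 0 ≤ 1 / p)
    have h6 := h3.trans h5
    rw [mul_add, ← dirichletEnergy, mul_assoc p s, ← mul_assoc (1 / p) p,
      one_div_mul_cancel hp0.ne', one_mul] at h6
    have h7 : s * -(∫ x, a x * φ x)
        ≤ s * ∫ x, inner ℝ (pFlux p (weakGrad v x + s • ∇ φ x)) (∇ φ x) := by
      linarith
    exact le_of_mul_le_mul_left h7 hs
  have := ge_of_tendsto' (tendsto_integral_inner_pFlux_add_smul hp hv.2 hΓ) key
  linarith

/-- The Euler-Lagrange equation for subgradients of the Dirichlet energy. -/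
theorem euler_lagrange_of_subgradient (hp : 2 < p) (hv : v ∈ dirichletDomain n p)
    (h : ∀ y ∈ dirichletDomain n p,
      dirichletEnergy p v + inner ℝ (-a) (y - v) ≤ dirichletEnergy p y)
    {φ : EuclideanSpace ℝ (Fin n) → ℝ} (hφ : ContDiff ℝ ∞ φ) (hφc : HasCompactSupport φ) :
    ∫ x, (a x * φ x + inner ℝ (pFlux p (weakGrad v x)) (∇ φ x)) = 0 := by
  have hφ2 : MemLp φ 2 volume := hφ.continuous.memLp_of_hasCompactSupport hφc
  have hΓ : MemLp (∇ φ) (ENNReal.ofReal p) volume :=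
    (continuous_gradient hφ).memLp_of_hasCompactSupport hφc.gradient
  have hi : Integrable (fun x => a x * φ x) volume := (Lp.memLp a).integrable_mul hφ2
  rw [integral_add hi (hv.2.integrable_inner_pFlux hp hΓ)]
  refine le_antisymm ?_ (neg_inner_le_of_subgradient hp hv h hφ hφc)
  have h1 := neg_inner_le_of_subgradient hp hv h hφ.neg hφc.neg
  have h2 : ∀ x, ∇ (fun y => -φ y) x = - ∇ φ x := fun x => by
    simp [gradient, fderiv_fun_neg]
  simp only [h2, mul_neg, inner_neg_right, integral_neg] at h1
  linarith

end EulerLagrange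

/-! ### Primitives and weak derivatives in time -/

section AbsolutelyContinuous

lemma LipschitzOnWith.comp_absolutelyContinuousOnInterval {Θ V : ℝ → ℝ} {K : ℝ≥0} {S : Set ℝ}
    {a b : ℝ} (hΘ : LipschitzOnWith K Θ S) (hV : AbsolutelyContinuousOnInterval V a b)
    (hS : MapsTo V (uIcc a b) S) : AbsolutelyContinuousOnInterval (fun t => Θ (V t)) a b := by
  refine squeeze_zero' (.of_forall fun t => Finset.sum_nonneg fun i _ => dist_nonneg)
    (g := fun E => (K : ℝ) * ∑ i ∈ Finset.range E.1, dist (V (E.2 i).1) (V (E.2 i).2)) ?_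
    (by simpa using Tendsto.const_mul (K : ℝ) hV)
  refine eventually_inf_principal.2 (.of_forall fun E hE => ?_)
  rw [Finset.mul_sum]
  refine Finset.sum_le_sum fun i hi => ?_
  have := hE.1 i hi
  exact hΘ.dist_le_mul _ (hS this.1) _ (hS this.2)

lemma ae_hasDerivAt_const_add_integral {g : ℝ → ℝ} {t : ℝ}
    (hg : IntervalIntegrable g volume 0 t) (c : ℝ) :
    ∀ᵐ s : ℝ, s ∈ uIcc 0 t → HasDerivAt (fun r => c + ∫ r' in (0 : ℝ)..r, g r') (g s) s := by
  filter_upwards [hg.ae_hasDerivAt_integral] with s hs hst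
  exact (hs hst 0 left_mem_uIcc).const_add c

/-- The chain rule for absolutely continuous functions in integrated form. -/
lemma comp_const_add_integral_eq {Θ θ g : ℝ → ℝ} {t c : ℝ}
    (hΘ : ∀ s, HasDerivAt Θ (θ s) s) (hθ : Continuous θ)
    (hg : IntervalIntegrable g volume 0 t) :
    Θ (c + ∫ s in (0 : ℝ)..t, g s)
      = Θ c + ∫ s in (0 : ℝ)..t, θ (c + ∫ r in (0 : ℝ)..s, g r) * g s := by
  have hV : AbsolutelyContinuousOnInterval (fun s => c + ∫ r in (0 : ℝ)..s, g r) 0 t :=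
    (LipschitzOnWith.absolutelyContinuousOnInterval
      (LipschitzWith.const c).lipschitzOnWith).add
      (hg.absolutelyContinuousOnInterval_intervalIntegral left_mem_uIcc)
  -- On the bounded range of the inner function, `Θ` is Lipschitz, so the composition is absolutely
  -- continuous and the fundamental theorem of calculus applies.
  obtain ⟨M, hM⟩ := hV.exists_bound
  have hΘ1 : ContDiff ℝ 1 Θ := by
    rw [contDiff_one_iff_deriv]
    exact ⟨fun s => (hΘ s).differentiableAt, by rwa [show deriv Θ = θ from deriv_eq hΘ]⟩
  obtain ⟨K, hK⟩ := (hΘ1.contDiffOn (s := Icc (-M) M)).exists_lipschitzOnWith (by decide)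
    (convex_Icc _ _) isCompact_Icc
  have hΘV := hK.comp_absolutelyContinuousOnInterval hV fun s hs => abs_le.1 (hM s hs)
  have h1 := hΘV.integral_deriv_eq_sub
  simp only [intervalIntegral.integral_same, add_zero] at h1
  rw [← sub_eq_iff_eq_add', ← h1]
  refine intervalIntegral.integral_congr_ae ?_
  filter_upwards [ae_hasDerivAt_const_add_integral hg c] with s hs hst
  exact ((hΘ _).comp s (hs (uIoc_subset_uIcc hst))).deriv

variable {φ : ℝ → ℝ}

/-- The endpoint `M` lies beyond the support, so boundary terms vanish there. One `M` serves both
the test function and its derivative. -/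
lemma exists_setIntegral_Ioi_eq_intervalIntegral (hφc : HasCompactSupport φ) :
    ∃ M : ℝ, 0 < M ∧ φ M = 0 ∧ ∀ ψ : ℝ → ℝ, tsupport ψ ⊆ tsupport φ → ∀ h : ℝ → ℝ,
      ∫ t in Ioi (0 : ℝ), ψ t * h t = ∫ t in (0 : ℝ)..M, ψ t * h t := by
  obtain ⟨M, hM⟩ := hφc.isBounded.bddAbove
  refine ⟨max M 0 + 1, by positivity, ?_, fun ψ hψ h => ?_⟩
  · by_contra hne
    have := hM (subset_tsupport _ hne)
    linarith [le_max_left M 0]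
  · rw [intervalIntegral.integral_of_le (by positivity)]
    refine setIntegral_eq_of_subset_of_forall_sdiff_eq_zero measurableSet_Ioi
      (fun t ht => ht.1) fun t ht => ?_
    have : ψ t = 0 := by
      by_contra hne
      have h1 := hM (hψ (subset_tsupport _ hne))
      exact ht.2 ⟨ht.1, by linarith [le_max_left M 0]⟩
    rw [this, zero_mul]

lemma tsupport_deriv_subset' (φ : ℝ → ℝ) : tsupport (deriv φ) ⊆ tsupport φ :=
  closure_minimal (support_deriv_subset) (isClosed_tsupport φ)

/-- Integration by parts against a test function on `(0, ∞)`. -/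
lemma integral_deriv_mul_const_add_integral {g : ℝ → ℝ} (hφ : ContDiff ℝ ∞ φ)
    (hφc : HasCompactSupport φ) (hφ0 : tsupport φ ⊆ Ioi 0)
    (hg : ∀ T, 0 < T → IntervalIntegrable g volume 0 T) (c : ℝ) :
    ∫ t in Ioi (0 : ℝ), deriv φ t * (c + ∫ s in (0 : ℝ)..t, g s)
      = - ∫ t in Ioi (0 : ℝ), φ t * g t := by
  obtain ⟨M, hM0, hM, hM'⟩ := exists_setIntegral_Ioi_eq_intervalIntegral hφc
  rw [hM' _ (tsupport_deriv_subset' φ), hM' _ subset_rfl]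
  have hφ0' : φ 0 = 0 := by
    by_contra hne
    exact lt_irrefl (0 : ℝ) (hφ0 (subset_tsupport _ hne))
  have hV : AbsolutelyContinuousOnInterval (fun s => c + ∫ r in (0 : ℝ)..s, g r) 0 M :=
    (LipschitzOnWith.absolutelyContinuousOnInterval
      (LipschitzWith.const c).lipschitzOnWith).add
      ((hg M hM0).absolutelyContinuousOnInterval_intervalIntegral left_mem_uIcc)
  have hφa : AbsolutelyContinuousOnInterval φ 0 M :=
    (hφ.of_le (by simp)).contDiffOn.absolutelyContinuousOnInterval
  have h1 := hφa.integral_mul_deriv_eq_deriv_mul hV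
  rw [hM, hφ0', zero_mul, zero_mul, sub_zero, zero_sub] at h1
  rw [eq_neg_iff_add_eq_zero, add_comm, ← eq_neg_iff_add_eq_zero, ← h1]
  refine intervalIntegral.integral_congr_ae ?_
  filter_upwards [ae_hasDerivAt_const_add_integral (hg M hM0) c] with s hs hst
  rw [(hs (uIoc_subset_uIcc hst)).deriv]

/-- The lemma of du Bois-Reymond on the half-line. -/
lemma exists_ae_eq_const_of_integral_deriv_mul_eq_zero {d : ℝ → ℝ}
    (hd : LocallyIntegrableOn d (Ioi 0))
    (h : ∀ φ : ℝ → ℝ, ContDiff ℝ ∞ φ → HasCompactSupport φ → tsupport φ ⊆ Ioi 0 →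
      ∫ t in Ioi (0 : ℝ), deriv φ t * d t = 0) :
    ∃ c : ℝ, ∀ᵐ t : ℝ, t ∈ Ioi (0 : ℝ) → d t = c := by
  -- A bump of unit mass supported in `[1, 3]`, away from the origin; the constant is the mean of
  -- `d` against it.
  let b : ContDiffBump (2 : ℝ) := ⟨1 / 2, 1, by norm_num, by norm_num⟩
  let η : ℝ → ℝ := b.normed volume
  have hη : ContDiff ℝ ∞ η := b.contDiff_normed
  have hηc : HasCompactSupport η := b.hasCompactSupport_normed
  have hηs : tsupport η = Icc 1 3 := by
    rw [show η = b.normed volume from rfl, b.tsupport_normed_eq, Real.closedBall_eq_Icc]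
    norm_num [b]
  have hη1 : ∫ t, η t = 1 := b.integral_normed
  refine ⟨∫ t in Ioi (0 : ℝ), η t * d t, ?_⟩
  set c := ∫ t in Ioi (0 : ℝ), η t * d t with hc
  have key : ∀ ψ : ℝ → ℝ, ContDiff ℝ ∞ ψ → HasCompactSupport ψ → tsupport ψ ⊆ Ioi 0 →
      ∫ t, ψ t • (d t - c) = 0 := by
    intro ψ hψ hψc hψ0
    have hint : ∀ {χ : ℝ → ℝ}, ContDiff ℝ ∞ χ → HasCompactSupport χ → tsupport χ ⊆ Ioi 0 →
        IntegrableOn (fun t => χ t * d t) (Ioi 0) := fun {χ} h1 h2 h3 => by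
      have h4 : IntegrableOn (fun t => χ t • d t) (tsupport χ) :=
        (hd.integrableOn_compact_subset h3 h2).continuousOn_smul h1.continuous.continuousOn h2
      have h5 := h4.integrable_of_forall_notMem_eq_zero (fun t ht => by
        rw [image_eq_zero_of_notMem_tsupport ht, zero_smul])
      exact h5.integrableOn
    let I := ∫ t, ψ t
    -- Subtracting the mass of `ψ` gives mean zero, so the primitive of `χ` has compact support in
    -- `(0, ∞)` and is itself admissible.
    let χ : ℝ → ℝ := fun t => ψ t - I * η t
    have hχ : ContDiff ℝ ∞ χ := hψ.sub (contDiff_const.mul hη)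
    have hχi : Integrable χ := (hψ.continuous.integrable_of_hasCompactSupport hψc).sub
      ((hη.continuous.integrable_of_hasCompactSupport hηc).const_mul I)
    have hχ0 : ∫ t, χ t = 0 := by
      rw [integral_sub (hψ.continuous.integrable_of_hasCompactSupport hψc)
        ((hη.continuous.integrable_of_hasCompactSupport hηc).const_mul I), integral_const_mul, hη1]
      simp [I]
    obtain ⟨m, M, hm0, hmM, hsub⟩ : ∃ m M : ℝ, 0 < m ∧ m ≤ M ∧ ∀ t, t ∉ Icc m M → χ t = 0 := by
      have hcomp : IsCompact (tsupport ψ ∪ Icc 1 3) := hψc.isCompact.union isCompact_Icc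
      have hne : (tsupport ψ ∪ Icc (1 : ℝ) 3).Nonempty := ⟨1, Or.inr (by norm_num)⟩
      obtain ⟨m, hm, hm'⟩ := hcomp.exists_isLeast hne
      obtain ⟨M, hM, hM'⟩ := hcomp.exists_isGreatest hne
      refine ⟨m, M, ?_, hm' hM, fun t ht => ?_⟩
      · rcases hm with hm | hm
        · exact hψ0 hm
        · linarith [hm.1]
      · have h1 : t ∉ tsupport ψ ∪ Icc (1 : ℝ) 3 := fun h => ht ⟨hm' h, hM' h⟩
        rw [← hηs] at h1
        simp only [mem_union, not_or] at h1
        simp [χ, image_eq_zero_of_notMem_tsupport h1.1, image_eq_zero_of_notMem_tsupport h1.2]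
    let φ : ℝ → ℝ := fun t => ∫ s in (0 : ℝ)..t, χ s
    have hφd : ∀ t, HasDerivAt φ (χ t) t := fun t =>
      hχ.continuous.integral_hasStrictDerivAt 0 t |>.hasDerivAt
    have hφ : ContDiff ℝ ∞ φ := by
      rw [contDiff_infty_iff_deriv]
      refine ⟨fun t => (hφd t).differentiableAt, ?_⟩
      rwa [show deriv φ = χ from deriv_eq hφd]
    have hφs : ∀ t, t ∉ Icc m M → φ t = 0 := fun t ht => by
      rw [mem_Icc, not_and_or, not_le, not_le] at ht
      rcases ht with ht | ht
      · refine (intervalIntegral.integral_congr (g := fun _ => 0) fun s hs => ?_).trans (by simp)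
        refine hsub s fun hs' => ?_
        rcases mem_uIcc.1 hs with h | h <;> linarith [h.1, h.2, hs'.1]
      · have h1 : ∫ s in (0 : ℝ)..t, χ s = ∫ s, χ s := by
          rw [intervalIntegral.integral_of_le (by linarith)]
          refine setIntegral_eq_integral_of_forall_compl_eq_zero fun s hs => hsub s fun hs' => hs ?_
          exact ⟨by linarith [hs'.1], by linarith [hs'.2]⟩
        exact h1.trans hχ0
    have hφsupp : tsupport φ ⊆ Icc m M :=
      closure_minimal (fun t ht => by_contra fun h => ht (hφs t h)) isClosed_Icc
    have h1 := h φ hφ (isCompact_Icc.of_isClosed_subset (isClosed_tsupport _) hφsupp)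
      (hφsupp.trans fun t ht => hm0.trans_le ht.1)
    have h2 : ∫ t in Ioi (0 : ℝ), deriv φ t * d t
        = (∫ t in Ioi (0 : ℝ), ψ t * d t) - I * c := by
      have h3 : IntegrableOn (fun t => I * (η t * d t)) (Ioi 0) :=
        (hint hη hηc (by rw [hηs]; intro t ht; exact one_pos.trans_le ht.1)).const_mul I
      rw [hc, ← integral_const_mul, ← integral_sub (hint hψ hψc hψ0) h3]
      refine integral_congr_ae (.of_forall fun t => ?_)
      simp only [(hφd t).deriv, χ]
      ring
    rw [h1] at h2
    have h4 : ∫ t, ψ t • (d t - c) = ∫ t in Ioi (0 : ℝ), ψ t • (d t - c) := by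
      refine (setIntegral_eq_integral_of_forall_compl_eq_zero fun t ht => ?_).symm
      rw [image_eq_zero_of_notMem_tsupport fun h => ht (hψ0 h), zero_smul]
    have h5 : ∫ t in Ioi (0 : ℝ), ψ t = I :=
      setIntegral_eq_integral_of_forall_compl_eq_zero fun t ht =>
        image_eq_zero_of_notMem_tsupport fun h => ht (hψ0 h)
    rw [h4]
    simp only [smul_eq_mul, mul_sub]
    rw [integral_sub (hint hψ hψc hψ0)
      ((hψ.continuous.integrable_of_hasCompactSupport hψc).mul_const c).integrableOn,
      integral_mul_const, h5]
    linarith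
  have hloc : LocallyIntegrableOn (fun t => d t - c) (Ioi 0) :=
    hd.sub ((locallyIntegrable_const c).locallyIntegrableOn _)
  filter_upwards [isOpen_Ioi.ae_eq_zero_of_integral_contDiff_smul_eq_zero hloc key] with t ht ht0
  linarith [ht ht0]

/-- A locally integrable function on the half-line with a locally integrable weak derivative is
a primitive of that derivative. -/
lemma exists_ae_eq_const_add_integral {b g : ℝ → ℝ}
    (hb : ∀ T, 0 < T → IntervalIntegrable b volume 0 T)
    (hg : ∀ T, 0 < T → IntervalIntegrable g volume 0 T)
    (h : ∀ φ : ℝ → ℝ, ContDiff ℝ ∞ φ → HasCompactSupport φ → tsupport φ ⊆ Ioi 0 →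
      ∫ t in Ioi (0 : ℝ), deriv φ t * b t = - ∫ t in Ioi (0 : ℝ), φ t * g t) :
    ∃ c : ℝ, ∀ᵐ t : ℝ, t ∈ Ioi (0 : ℝ) → b t = c + ∫ s in (0 : ℝ)..t, g s := by
  have hloc : ∀ {k : ℝ → ℝ}, (∀ T, 0 < T → IntervalIntegrable k volume 0 T) →
      LocallyIntegrableOn k (Ioi 0) := fun {k} hk => by
    refine (locallyIntegrableOn_iff (isOpen_Ioi.isLocallyClosed)).2 fun K hK hKc => ?_
    obtain ⟨M, hM⟩ := hKc.isBounded.bddAbove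
    refine ((intervalIntegrable_iff_integrableOn_Ioc_of_le (by positivity)).1
      (hk (max M 0 + 1) (by positivity))).mono_set fun t ht => ⟨hK ht, ?_⟩
    linarith [le_max_left M 0, hM ht]
  have hW : ∀ T, 0 < T → IntervalIntegrable (fun t => ∫ s in (0 : ℝ)..t, g s) volume 0 T :=
    fun T hT => ((hg T hT).absolutelyContinuousOnInterval_intervalIntegral
      left_mem_uIcc).continuousOn.intervalIntegrable
  obtain ⟨c, hc⟩ := exists_ae_eq_const_of_integral_deriv_mul_eq_zero
    (d := fun t => b t - ∫ s in (0 : ℝ)..t, g s) ((hloc hb).sub (hloc hW)) fun φ h1 h2 h3 => by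
      obtain ⟨M, hM0, hM, hM'⟩ := exists_setIntegral_Ioi_eq_intervalIntegral h2
      have e1 := h φ h1 h2 h3
      have e2 := integral_deriv_mul_const_add_integral h1 h2 h3 hg 0
      have hdc : ContinuousOn (deriv φ) (uIcc 0 M) := (h1.continuous_deriv (by simp)).continuousOn
      simp only [zero_add] at e2
      rw [← e2, hM' _ (tsupport_deriv_subset' φ), hM' _ (tsupport_deriv_subset' φ)] at e1
      rw [hM' _ (tsupport_deriv_subset' φ)]
      simp only [mul_sub]
      rw [intervalIntegral.integral_sub ((hb M hM0).continuousOn_mul hdc)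
        ((hW M hM0).continuousOn_mul hdc), e1, sub_self]
  refine ⟨c, ?_⟩
  filter_upwards [hc] with t ht ht0
  linarith [ht ht0]

end AbsolutelyContinuous

/-! ### Primitives in time of square integrable functions on space-time -/

section TimePrimitive

variable {X : Type*} [MeasurableSpace X]

lemma ae_ae_of_ae_prod_symm {Y : Type*} [MeasurableSpace Y] {ρ : Measure Y} {μ : Measure X}
    [SFinite ρ] [SFinite μ] {P : Y × X → Prop} (h : ∀ᵐ z ∂(ρ.prod μ), P z) :
    ∀ᵐ x ∂μ, ∀ᵐ t ∂ρ, P (t, x) :=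
  Measure.ae_ae_of_ae_prod (p := fun w => P (w.2, w.1))
    (Measure.measurePreserving_swap.quasiMeasurePreserving.ae h)

lemma ae_Ioi_of_forall_Ioo {P : ℝ → Prop}
    (h : ∀ T : ℝ, 0 < T → ∀ᵐ t ∂(volume.restrict (Ioo 0 T)), P t) :
    ∀ᵐ t ∂(volume.restrict (Ioi (0 : ℝ))), P t := by
  have e : Ioi (0 : ℝ) = ⋃ k : ℕ, Ioo (0 : ℝ) (k + 1) := by
    ext t
    simp only [mem_Ioi, mem_iUnion, mem_Ioo, exists_and_left]
    refine ⟨fun ht => ⟨ht, ?_⟩, fun ht => ht.1⟩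
    obtain ⟨k, hk⟩ := exists_nat_gt t
    exact ⟨k, by linarith⟩
  rw [e, ae_restrict_iUnion_iff]
  exact fun k => h _ (by positivity)

lemma ae_prod_Ioi_of_forall_Ioo {μ : Measure X} [SFinite μ] {P : ℝ × X → Prop}
    (h : ∀ T : ℝ, 0 < T → ∀ᵐ z ∂((volume.restrict (Ioo 0 T)).prod μ), P z) :
    ∀ᵐ z ∂((volume.restrict (Ioi (0 : ℝ))).prod μ), P z := by
  have e : Ioi (0 : ℝ) ×ˢ (univ : Set X) = ⋃ k : ℕ, Ioo (0 : ℝ) (k + 1) ×ˢ (univ : Set X) := by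
    ext ⟨t, x⟩
    simp only [mem_prod, mem_univ, and_true, mem_Ioi, mem_iUnion, mem_Ioo, exists_and_left]
    refine ⟨fun ht => ⟨ht, ?_⟩, fun ht => ht.1⟩
    obtain ⟨k, hk⟩ := exists_nat_gt t
    exact ⟨k, by linarith⟩
  have e2 : ∀ s : Set ℝ, (volume.restrict s).prod μ
      = ((volume : Measure ℝ).prod μ).restrict (s ×ˢ univ) := fun s => by
    rw [← Measure.prod_restrict, Measure.restrict_univ]
  rw [e2, e, ae_restrict_iUnion_iff]
  intro k
  rw [← e2]
  exact h _ (by positivity)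

/-- An integrable function on a product space vanishes if its integrals over all measurable
rectangles do. -/
lemma MeasureTheory.Integrable.ae_eq_zero_of_forall_setIntegral_prod_eq_zero {Y : Type*}
    [MeasurableSpace Y] {κ : Measure (Y × X)} {w : Y × X → ℝ} (hw : Integrable w κ)
    (h : ∀ A B, MeasurableSet A → MeasurableSet B → ∫ z in A ×ˢ B, w z ∂κ = 0) :
    w =ᵐ[κ] 0 := by
  refine hw.ae_eq_zero_of_forall_setIntegral_eq_zero fun s hs hs' => ?_
  clear hs'
  induction s, hs using MeasurableSpace.induction_on_inter generateFrom_prod.symm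
    isPiSystem_prod with
  | empty => simp
  | basic t ht =>
    obtain ⟨A, hA, B, hB, rfl⟩ := ht
    exact h A B hA hB
  | compl t ht ih =>
    have h1 := integral_add_compl ht hw
    have h2 := h univ univ .univ .univ
    rw [univ_prod_univ, Measure.restrict_univ] at h2
    rw [ih, h2, zero_add] at h1
    exact h1
  | iUnion f hd hm ih =>
    have h1 := hasSum_integral_iUnion hm hd hw.integrableOn
    simp only [ih] at h1
    exact h1.unique hasSum_zero

section Integrable

variable {ν : Measure X} [SFinite ν] {g : ℝ → X → ℝ}

lemma integral_Ioo_eq_intervalIntegral {t : ℝ} (ht : 0 ≤ t) (h : ℝ → ℝ) :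
    ∫ s in (0 : ℝ)..t, h s = ∫ s in Ioo 0 t, h s := by
  rw [intervalIntegral.integral_of_le ht, integral_Ioc_eq_integral_Ioo]

lemma ae_forall_intervalIntegrable
    (hg : ∀ T : ℝ, 0 < T →
      Integrable (fun z : ℝ × X => g z.1 z.2) ((volume.restrict (Ioo 0 T)).prod ν)) :
    ∀ᵐ x ∂ν, ∀ T : ℝ, 0 < T → IntervalIntegrable (fun s => g s x) volume 0 T := by
  have h1 : ∀ᵐ x ∂ν, ∀ k : ℕ, IntegrableOn (fun s => g s x) (Ioo 0 ((k : ℝ) + 1)) :=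
    ae_all_iff.2 fun k => (hg (k + 1) (by positivity)).prod_left_ae
  filter_upwards [h1] with x hx T hT
  rw [intervalIntegrable_iff_integrableOn_Ioo_of_le hT.le]
  obtain ⟨k, hk⟩ := exists_nat_gt T
  exact (hx k).mono_set (Ioo_subset_Ioo_right (by linarith))

lemma integral_intervalIntegral_swap
    (hg : ∀ T : ℝ, 0 < T →
      Integrable (fun z : ℝ × X => g z.1 z.2) ((volume.restrict (Ioo 0 T)).prod ν))
    {t : ℝ} (ht : 0 < t) :
    Integrable (fun x => ∫ s in (0 : ℝ)..t, g s x) ν ∧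
      IntervalIntegrable (fun s => ∫ x, g s x ∂ν) volume 0 t ∧
      ∫ x, (∫ s in (0 : ℝ)..t, g s x) ∂ν = ∫ s in (0 : ℝ)..t, (∫ x, g s x ∂ν) := by
  simp_rw [integral_Ioo_eq_intervalIntegral ht.le]
  rw [intervalIntegrable_iff_integrableOn_Ioo_of_le ht.le]
  exact ⟨(hg t ht).integral_prod_right, (hg t ht).integral_prod_left,
    (integral_integral_swap (f := g) (hg t ht)).symm⟩

/-- The primitive is the integral in `s` of `g s x` times the indicator of `s < t`, on a triple
product whose extra time interval has finite measure. Fubini gives its integrability. -/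
lemma integrable_intervalIntegral
    (hg : ∀ T : ℝ, 0 < T →
      Integrable (fun z : ℝ × X => g z.1 z.2) ((volume.restrict (Ioo 0 T)).prod ν))
    {T : ℝ} (hT : 0 < T) :
    Integrable (fun z : ℝ × X => ∫ s in (0 : ℝ)..z.1, g s z.2)
      ((volume.restrict (Ioo 0 T)).prod ν) := by
  let ρ : Measure ℝ := volume.restrict (Ioo 0 T)
  have h1 : Integrable (fun q : ℝ × (ℝ × X) => g q.2.1 q.2.2) (ρ.prod (ρ.prod ν)) :=
    (hg T hT).comp_snd ρ
  have hmp : MeasurePreserving (fun q : (ℝ × X) × ℝ => (q.1.1, (q.2, q.1.2)))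
      ((ρ.prod ν).prod ρ) (ρ.prod (ρ.prod ν)) :=
    ((MeasurePreserving.id ρ).prod Measure.measurePreserving_swap).comp
      (measurePreserving_prodAssoc ρ ν ρ)
  have h2 : Integrable (fun q : (ℝ × X) × ℝ => g q.2 q.1.2) ((ρ.prod ν).prod ρ) :=
    (hmp.integrable_comp h1.1).2 h1
  have hS : MeasurableSet {q : (ℝ × X) × ℝ | q.2 < q.1.1} :=
    measurableSet_lt measurable_snd (measurable_fst.comp measurable_fst)
  have h3 := (h2.indicator hS).integral_prod_left
  refine h3.congr ?_
  have h4 : ∀ᵐ z ∂(ρ.prod ν), z.1 ∈ Ioo 0 T :=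
    Measure.quasiMeasurePreserving_fst.ae (ae_restrict_mem measurableSet_Ioo)
  filter_upwards [h4] with z hz
  rw [integral_Ioo_eq_intervalIntegral hz.1.le]
  have e : Ioo 0 z.1 = Iio z.1 ∩ Ioo 0 T := by
    ext s
    simp only [mem_Ioo, mem_inter_iff, mem_Iio]
    exact ⟨fun h => ⟨h.2, h.1, h.2.trans hz.2⟩, fun h => ⟨h.2.1, h.1⟩⟩
  rw [e, ← Measure.restrict_restrict measurableSet_Iio, ← integral_indicator measurableSet_Iio]
  rfl

end Integrable

variable {μ : Measure X} [SigmaFinite μ] {f : X → ℝ} {g v v' : ℝ → X → ℝ}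

lemma MeasureTheory.MemLp.integrable_prod_restrict {T : ℝ}
    (hg : MemLp (fun z : ℝ × X => g z.1 z.2) 2 ((volume.restrict (Ioo 0 T)).prod μ)) {B : Set X}
    (hB : μ B ≠ ⊤) :
    Integrable (fun z : ℝ × X => g z.1 z.2) ((volume.restrict (Ioo 0 T)).prod (μ.restrict B)) := by
  have : IsFiniteMeasure (μ.restrict B) := ⟨by simpa using hB.lt_top⟩
  have e : (volume.restrict (Ioo 0 T)).prod (μ.restrict B)
      ≤ (volume.restrict (Ioo 0 T)).prod μ := by
    conv_lhs => rw [← Measure.restrict_univ (μ := volume.restrict (Ioo 0 T)), Measure.prod_restrict]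
    exact Measure.restrict_le_self
  exact (hg.mono_measure e).integrable one_le_two

lemma ae_of_forall_ae_restrict_spanningSets {Y : Type*} [MeasurableSpace Y] {ρ : Measure Y}
    [SFinite ρ] {P : Y × X → Prop}
    (h : ∀ k, ∀ᵐ z ∂(ρ.prod (μ.restrict (spanningSets μ k))), P z) : ∀ᵐ z ∂(ρ.prod μ), P z := by
  have e2 : ∀ s : Set X, ρ.prod (μ.restrict s) = (ρ.prod μ).restrict (univ ×ˢ s) := fun s => by
    rw [← Measure.prod_restrict, Measure.restrict_univ]
  have e : (univ : Set (Y × X)) = ⋃ k, univ ×ˢ spanningSets μ k := by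
    rw [← prod_iUnion, iUnion_spanningSets, univ_prod_univ]
  rw [← Measure.restrict_univ (μ := ρ.prod μ), e, ae_restrict_iUnion_iff]
  intro k
  rw [← e2]
  exact h k

lemma ae_forall_intervalIntegrable_of_memLp
    (hg : ∀ T : ℝ, 0 < T →
      MemLp (fun z : ℝ × X => g z.1 z.2) 2 ((volume.restrict (Ioo 0 T)).prod μ)) :
    ∀ᵐ x ∂μ, ∀ T : ℝ, 0 < T → IntervalIntegrable (fun s => g s x) volume 0 T := by
  rw [← Measure.restrict_univ (μ := μ), ← iUnion_spanningSets μ, ae_restrict_iUnion_iff]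
  exact fun k => ae_forall_intervalIntegrable fun T hT =>
    (hg T hT).integrable_prod_restrict (measure_spanningSets_lt_top μ k).ne

lemma ae_memLp_of_memLp_prod
    (hg : ∀ T : ℝ, 0 < T →
      MemLp (fun z : ℝ × X => g z.1 z.2) 2 ((volume.restrict (Ioo 0 T)).prod μ)) :
    ∀ᵐ t ∂(volume.restrict (Ioi (0 : ℝ))), MemLp (g t) 2 μ := by
  refine ae_Ioi_of_forall_Ioo fun T hT => ?_
  filter_upwards [(hg T hT).1.prodMk_left, (hg T hT).integrable_sq.prod_right_ae] with t h1 h2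
  exact (memLp_two_iff_integrable_sq h1).2 h2

/-- `v(t) = f + ∫₀ᵗ v'(s) ds` in `L²`, where `v'` is locally square integrable in time. -/
structure IsTimePrimitive (μ : Measure X) (f : X → ℝ) (v v' : ℝ → X → ℝ) : Prop where
  memLp_init : MemLp f 2 μ
  memLp : ∀ T : ℝ, 0 < T →
    MemLp (fun z : ℝ × X => v z.1 z.2) 2 ((volume.restrict (Ioo 0 T)).prod μ)
  memLp_deriv : ∀ T : ℝ, 0 < T →
    MemLp (fun z : ℝ × X => v' z.1 z.2) 2 ((volume.restrict (Ioo 0 T)).prod μ)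
  ae_eq : ∀ᵐ z ∂((volume.restrict (Ioi (0 : ℝ))).prod μ),
    v z.1 z.2 = f z.2 + ∫ s in (0 : ℝ)..z.1, v' s z.2

lemma IsTimePrimitive.sub {f₂ : X → ℝ} {w w' : ℝ → X → ℝ} (hv : IsTimePrimitive μ f v v')
    (hw : IsTimePrimitive μ f₂ w w') :
    IsTimePrimitive μ (fun x => f x - f₂ x) (fun t x => v t x - w t x)
      (fun t x => v' t x - w' t x) where
  memLp_init := hv.memLp_init.sub hw.memLp_init
  memLp T hT := (hv.memLp T hT).sub (hw.memLp T hT)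
  memLp_deriv T hT := (hv.memLp_deriv T hT).sub (hw.memLp_deriv T hT)
  ae_eq := by
    have h4 : ∀ᵐ z ∂((volume.restrict (Ioi (0 : ℝ))).prod μ), z.1 ∈ Ioi (0 : ℝ) :=
      Measure.quasiMeasurePreserving_fst.ae (ae_restrict_mem measurableSet_Ioi)
    filter_upwards [hv.ae_eq, hw.ae_eq, h4, Measure.quasiMeasurePreserving_snd.ae
      (ae_forall_intervalIntegrable_of_memLp hv.memLp_deriv),
      Measure.quasiMeasurePreserving_snd.ae
      (ae_forall_intervalIntegrable_of_memLp hw.memLp_deriv)] with z h1 h2 h3 h5 h6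
    rw [h1, h2, intervalIntegral.integral_sub (h5 _ h3) (h6 _ h3)]
    ring

/-- The chain rule in integrated form. -/
theorem IsTimePrimitive.integral_comp (hv : IsTimePrimitive μ f v v') {Θ θ : ℝ → ℝ} {C : ℝ}
    (hΘ : ∀ s, HasDerivAt Θ (θ s) s) (hθ : Continuous θ) (hθC : ∀ s, |θ s| ≤ C * |s|)
    (hΘf : Integrable (fun x => Θ (f x)) μ) :
    ∀ᵐ t ∂(volume.restrict (Ioi (0 : ℝ))), Integrable (fun x => Θ (v t x)) μ ∧
      ∫ x, Θ (v t x) ∂μ = (∫ x, Θ (f x) ∂μ)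
        + ∫ s in (0 : ℝ)..t, (∫ x, v' s x * θ (v s x) ∂μ) := by
  have hk : ∀ T : ℝ, 0 < T → Integrable (fun z : ℝ × X => v' z.1 z.2 * θ (v z.1 z.2))
      ((volume.restrict (Ioo 0 T)).prod μ) := fun T hT => by
    have h1 : MemLp (fun z : ℝ × X => θ (v z.1 z.2)) 2 ((volume.restrict (Ioo 0 T)).prod μ) :=
      (hv.memLp T hT).of_le_mul (hθ.comp_aestronglyMeasurable (hv.memLp T hT).1)
        (.of_forall fun z => hθC _)
    exact (hv.memLp_deriv T hT).integrable_mul h1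
  -- For almost every fixed `x` this is the scalar chain rule for an absolutely continuous function
  -- of time; integration in `x` and Fubini follow.
  have h1 : ∀ᵐ x ∂μ, ∀ t, 0 < t →
      Θ (f x + ∫ s in (0 : ℝ)..t, v' s x)
        = Θ (f x) + ∫ s in (0 : ℝ)..t, v' s x * θ (v s x) := by
    filter_upwards [ae_ae_of_ae_prod_symm hv.ae_eq,
      ae_forall_intervalIntegrable_of_memLp hv.memLp_deriv] with x h1 h2 t ht
    rw [comp_const_add_integral_eq hΘ hθ (h2 t ht), integral_Ioo_eq_intervalIntegral ht.le,
      integral_Ioo_eq_intervalIntegral ht.le]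
    congr 1
    refine integral_congr_ae ?_
    filter_upwards [ae_restrict_of_ae_restrict_of_subset Ioo_subset_Ioi_self h1] with s hs
    rw [hs, mul_comm]
  filter_upwards [Measure.ae_ae_of_ae_prod hv.ae_eq, ae_restrict_mem measurableSet_Ioi]
    with t ht ht0
  obtain ⟨i1, -, i3⟩ := integral_intervalIntegral_swap (g := fun s x => v' s x * θ (v s x)) hk ht0
  have e : (fun x => Θ (v t x)) =ᵐ[μ]
      fun x => Θ (f x) + ∫ s in (0 : ℝ)..t, v' s x * θ (v s x) := by
    filter_upwards [ht, h1] with x hx h1x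
    rw [hx, h1x t ht0]
  exact ⟨(hΘf.add i1).congr e.symm, by rw [integral_congr_ae e, integral_add hΘf i1, i3]⟩

end TimePrimitive

/-! ### From weak time derivatives to primitives -/

section WeakTimeDerivative

/-- Right neighbourhoods have positive measure. Hence limits along the filter used in the initial
condition are unique. -/
lemma neBot_nhdsGT_inf_ae (r : ℝ) : (𝓝[>] r ⊓ ae volume).NeBot := by
  rw [inf_neBot_iff]
  intro s hs t ht
  obtain ⟨ε, hε, hs'⟩ := mem_nhdsGT_iff_exists_Ioo_subset.1 hs
  by_contra h
  rw [not_nonempty_iff_eq_empty, ← disjoint_iff_inter_eq_empty] at h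
  have h1 : volume (Ioo r ε) = 0 := measure_mono_null
    (hs'.trans (subset_compl_iff_disjoint_right.2 h)) ht
  rw [Real.volume_Ioo, ENNReal.ofReal_eq_zero] at h1
  have : r < ε := hε
  linarith

variable {X : Type*} [MeasurableSpace X] {μ : Measure X} [SigmaFinite μ] {f : X → ℝ}
  {v v' : ℝ → X → ℝ}

/-- On a set of finite measure, Cauchy-Schwarz bounds the `L¹` distance by the `L²` distance. -/
lemma tendsto_setIntegral_of_tendsto_lintegral_enorm_sub {ι : Type*} {l : Filter ι}
    {u : ι → X → ℝ} (hu : ∀ᶠ i in l, MemLp (u i) 2 μ) (hf : MemLp f 2 μ)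
    (h : Tendsto (fun i => ∫⁻ x, ‖u i x - f x‖ₑ ^ 2 ∂μ) l (𝓝 0)) {B : Set X} (hB : μ B ≠ ⊤) :
    Tendsto (fun i => ∫ x in B, u i x ∂μ) l (𝓝 (∫ x in B, f x ∂μ)) := by
  have : IsFiniteMeasure (μ.restrict B) := ⟨by simpa using hB.lt_top⟩
  rw [tendsto_iff_edist_tendsto_0]
  have hlim : Tendsto (fun i => (∫⁻ x, ‖u i x - f x‖ₑ ^ 2 ∂μ) ^ (1 / 2 : ℝ)
      * μ B ^ (1 / 2 : ℝ)) l (𝓝 0) := by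
    have h1 := (ENNReal.continuous_rpow_const (y := 1 / 2)).tendsto (0 : ℝ≥0∞) |>.comp h
    rw [ENNReal.zero_rpow_of_pos (by norm_num)] at h1
    have h2 := ENNReal.Tendsto.mul_const h1 (b := μ B ^ (1 / 2 : ℝ))
      (Or.inr (ENNReal.rpow_ne_top_of_nonneg (by norm_num) hB))
    rwa [zero_mul] at h2
  refine tendsto_of_tendsto_of_tendsto_of_le_of_le' tendsto_const_nhds hlim
    (.of_forall fun _ => zero_le) ?_
  filter_upwards [hu] with i hi
  have hiB := (hi.mono_measure Measure.restrict_le_self : MemLp (u i) 2 (μ.restrict B))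
  have hfB := (hf.mono_measure Measure.restrict_le_self : MemLp f 2 (μ.restrict B))
  rw [edist_eq_enorm_sub, ← integral_sub (hiB.integrable one_le_two) (hfB.integrable one_le_two)]
  refine (enorm_integral_le_lintegral_enorm _).trans ?_
  have h1 := eLpNorm_le_eLpNorm_mul_rpow_measure_univ (μ := μ.restrict B) (p := 1) (q := 2)
    one_le_two (hiB.sub hfB).1
  rw [eLpNorm_one_eq_lintegral_enorm, eLpNorm_eq_lintegral_rpow_enorm_toReal (by norm_num)
    (by norm_num)] at h1
  refine h1.trans ?_
  norm_num
  gcongr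
  exact Measure.restrict_le_self

lemma integrable_intervalIntegral_mul_and_swap {ψ : ℝ → ℝ} (hψ : Continuous ψ)
    (hψc : HasCompactSupport ψ) {ν : Measure X} [SFinite ν] {w : ℝ → X → ℝ}
    (hw : ∀ T : ℝ, 0 < T →
      Integrable (fun z : ℝ × X => w z.1 z.2) ((volume.restrict (Ioo 0 T)).prod ν))
    {M : ℝ} (hM : 0 < M) :
    Integrable (fun x => ∫ t in (0 : ℝ)..M, ψ t * w t x) ν ∧
      ∫ t in (0 : ℝ)..M, ψ t * ∫ x, w t x ∂ν = ∫ x, (∫ t in (0 : ℝ)..M, ψ t * w t x) ∂ν := by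
  obtain ⟨C, hC⟩ := hψ.bounded_above_of_compact_support hψc
  obtain ⟨h1, -, h3⟩ := integral_intervalIntegral_swap (g := fun t x => ψ t * w t x) (fun T hT =>
    (hw T hT).bdd_mul (hψ.measurable.comp measurable_fst).aestronglyMeasurable
      (.of_forall fun z => hC _)) hM
  refine ⟨h1, ?_⟩
  rw [h3]
  simp_rw [integral_const_mul]

/-- Integration over `B` reduces the matter to a scalar function of time, which equals a primitive
up to a constant. The initial condition identifies the constant as the integral of `f` over `B`. -/
lemma ae_setIntegral_eq_of_weakTimeDeriv (hf : MemLp f 2 μ)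
    (hv : ∀ T : ℝ, 0 < T →
      MemLp (fun z : ℝ × X => v z.1 z.2) 2 ((volume.restrict (Ioo 0 T)).prod μ))
    (hv' : ∀ T : ℝ, 0 < T →
      MemLp (fun z : ℝ × X => v' z.1 z.2) 2 ((volume.restrict (Ioo 0 T)).prod μ))
    (hweak : ∀ φ : ℝ → ℝ, ContDiff ℝ ∞ φ → HasCompactSupport φ → tsupport φ ⊆ Ioi 0 →
      ∀ᵐ x ∂μ, ∫ t in Ioi (0 : ℝ), deriv φ t * v t x = - ∫ t in Ioi (0 : ℝ), φ t * v' t x)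
    (hinit : Tendsto (fun t => ∫⁻ x, ‖v t x - f x‖ₑ ^ 2 ∂μ) (𝓝[>] (0 : ℝ) ⊓ ae volume) (𝓝 0))
    {B : Set X} (hB : μ B ≠ ⊤) :
    ∀ᵐ t ∂(volume.restrict (Ioi (0 : ℝ))),
      ∫ x in B, v t x ∂μ = (∫ x in B, f x ∂μ) + ∫ s in (0 : ℝ)..t, ∫ x in B, v' s x ∂μ := by
  have hvB := fun T hT => (hv T hT).integrable_prod_restrict hB
  have hvB' := fun T hT => (hv' T hT).integrable_prod_restrict hB
  have hgi : ∀ T, 0 < T → IntervalIntegrable (fun s => ∫ x in B, v' s x ∂μ) volume 0 T :=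
    fun T hT => (integral_intervalIntegral_swap hvB' hT).2.1
  obtain ⟨c, hc⟩ := exists_ae_eq_const_add_integral (b := fun t => ∫ x in B, v t x ∂μ)
    (g := fun t => ∫ x in B, v' t x ∂μ)
    (fun T hT => (integral_intervalIntegral_swap hvB hT).2.1) hgi fun φ h1 h2 h3 => by
      obtain ⟨M, hM0, -, hM⟩ := exists_setIntegral_Ioi_eq_intervalIntegral h2
      have hd := tsupport_deriv_subset' φ
      rw [hM _ hd, hM _ subset_rfl,
        (integrable_intervalIntegral_mul_and_swap (h1.continuous_deriv (by simp)) h2.deriv hvB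
          hM0).2,
        (integrable_intervalIntegral_mul_and_swap h1.continuous h2 hvB' hM0).2, ← integral_neg]
      refine integral_congr_ae (ae_restrict_of_ae ?_)
      filter_upwards [hweak φ h1 h2 h3] with x hx
      rwa [hM _ hd, hM _ subset_rfl] at hx
  have := neBot_nhdsGT_inf_ae 0
  have hl1 : Tendsto (fun t => ∫ x in B, v t x ∂μ) (𝓝[>] (0 : ℝ) ⊓ ae volume) (𝓝 c) := by
    have h1 : ContinuousWithinAt (fun t => ∫ s in (0 : ℝ)..t, ∫ x in B, v' s x ∂μ) (uIcc 0 1) 0 :=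
      ((hgi 1 one_pos).absolutelyContinuousOnInterval_intervalIntegral
        left_mem_uIcc).continuousOn 0 left_mem_uIcc
    have h2 : Tendsto (fun t => c + ∫ s in (0 : ℝ)..t, ∫ x in B, v' s x ∂μ)
        (𝓝[>] (0 : ℝ) ⊓ ae volume) (𝓝 (c + 0)) := by
      refine tendsto_const_nhds.add ?_
      have h3 : Tendsto (fun t => ∫ s in (0 : ℝ)..t, ∫ x in B, v' s x ∂μ)
          (𝓝[uIcc 0 1] 0) (𝓝 0) := by simpa using h1.tendsto
      refine h3.mono_left (inf_le_left.trans ?_)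
      rw [nhdsWithin_le_iff, uIcc_of_le zero_le_one]
      exact mem_of_superset (Ioo_mem_nhdsGT one_pos) Ioo_subset_Icc_self
    rw [add_zero] at h2
    refine h2.congr' ?_
    filter_upwards [mem_inf_of_left self_mem_nhdsWithin, mem_inf_of_right hc] with t h3 h4
    exact (h4 h3).symm
  have hl2 : Tendsto (fun t => ∫ x in B, v t x ∂μ) (𝓝[>] (0 : ℝ) ⊓ ae volume)
      (𝓝 (∫ x in B, f x ∂μ)) := by
    refine tendsto_setIntegral_of_tendsto_lintegral_enorm_sub ?_ hf hinit hB
    filter_upwards [mem_inf_of_left self_mem_nhdsWithin,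
      mem_inf_of_right ((ae_restrict_iff' measurableSet_Ioi).1 (ae_memLp_of_memLp_prod hv))]
      with t h3 h4
    exact h4 h3
  rw [ae_restrict_iff' measurableSet_Ioi, ← tendsto_nhds_unique hl1 hl2]
  exact hc

/-- A square integrable function with square integrable weak time derivative which attains the
initial value `f` is a primitive of its derivative. -/
theorem isTimePrimitive_of_weakTimeDeriv (hf : MemLp f 2 μ)
    (hv : ∀ T : ℝ, 0 < T →
      MemLp (fun z : ℝ × X => v z.1 z.2) 2 ((volume.restrict (Ioo 0 T)).prod μ))
    (hv' : ∀ T : ℝ, 0 < T →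
      MemLp (fun z : ℝ × X => v' z.1 z.2) 2 ((volume.restrict (Ioo 0 T)).prod μ))
    (hweak : ∀ φ : ℝ → ℝ, ContDiff ℝ ∞ φ → HasCompactSupport φ → tsupport φ ⊆ Ioi 0 →
      ∀ᵐ x ∂μ, ∫ t in Ioi (0 : ℝ), deriv φ t * v t x = - ∫ t in Ioi (0 : ℝ), φ t * v' t x)
    (hinit : Tendsto (fun t => ∫⁻ x, ‖v t x - f x‖ₑ ^ 2 ∂μ) (𝓝[>] (0 : ℝ) ⊓ ae volume) (𝓝 0)) :
    IsTimePrimitive μ f v v' := by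
  refine ⟨hf, hv, hv', ae_prod_Ioi_of_forall_Ioo fun T hT =>
    ae_of_forall_ae_restrict_spanningSets fun k => ?_⟩
  have hint : ∀ {B : Set X}, μ B ≠ ⊤ → Integrable f (μ.restrict B) := fun {B} hB => by
    have : IsFiniteMeasure (μ.restrict B) := ⟨by simpa using hB.lt_top⟩
    exact (hf.mono_measure Measure.restrict_le_self).integrable one_le_two
  have hS : μ (spanningSets μ k) ≠ ⊤ := (measure_spanningSets_lt_top μ k).ne
  have hw : Integrable (fun z : ℝ × X => v z.1 z.2 - (f z.2 + ∫ s in (0 : ℝ)..z.1, v' s z.2))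
      ((volume.restrict (Ioo 0 T)).prod (μ.restrict (spanningSets μ k))) :=
    ((hv T hT).integrable_prod_restrict hS).sub (((hint hS).comp_snd _).add
      (integrable_intervalIntegral (fun T hT => (hv' T hT).integrable_prod_restrict hS) hT))
  -- The exceptional set of times depends on `B`. Integrating over rectangles `A ×ˢ B` avoids having
  -- to choose one common to all `B`.
  have h0 := hw.ae_eq_zero_of_forall_setIntegral_prod_eq_zero fun A B hA hB => by
    rw [setIntegral_prod _ hw.integrableOn, Measure.restrict_restrict hB]
    have hBS : μ (B ∩ spanningSets μ k) ≠ ⊤ := measure_ne_top_of_subset inter_subset_right hS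
    have hvB' := fun T hT => (hv' T hT).integrable_prod_restrict hBS
    have key : ∀ᵐ t ∂(volume.restrict (Ioo 0 T)),
        ∫ x in B ∩ spanningSets μ k, (v t x - (f x + ∫ s in (0 : ℝ)..t, v' s x)) ∂μ = 0 := by
      filter_upwards [((hv T hT).integrable_prod_restrict hBS).prod_right_ae,
        ae_restrict_of_ae_restrict_of_subset Ioo_subset_Ioi_self
          (ae_setIntegral_eq_of_weakTimeDeriv hf hv hv' hweak hinit hBS),
        ae_restrict_mem measurableSet_Ioo] with t h1 h2 h3
      obtain ⟨i1, -, i3⟩ := integral_intervalIntegral_swap hvB' h3.1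
      have i2 : Integrable (fun x => f x + ∫ s in (0 : ℝ)..t, v' s x)
          (μ.restrict (B ∩ spanningSets μ k)) := (hint hBS).add i1
      rw [integral_sub h1 i2, integral_add (hint hBS) i1, i3, h2, sub_self]
    rw [integral_congr_ae (ae_restrict_of_ae key)]
    simp
  filter_upwards [h0] with z hz
  exact sub_eq_zero.1 hz

end WeakTimeDerivative

/-! ### Functionals `∫ Θ(v)` that do not increase -/

section Comparison

variable {X : Type*} [MeasurableSpace X] {μ : Measure X} [SigmaFinite μ] {f : X → ℝ}
  {v v' : ℝ → X → ℝ}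

lemma ae_prod_eq_zero_of_ae_ae {Y : Type*} [MeasurableSpace Y] {ρ : Measure Y} [SFinite ρ]
    {w : Y × X → ℝ} (hw : AEStronglyMeasurable w (ρ.prod μ))
    (h : ∀ᵐ t ∂ρ, ∀ᵐ x ∂μ, w (t, x) = 0) : ∀ᵐ z ∂(ρ.prod μ), w z = 0 := by
  have h1 : ∫⁻ z, ‖w z‖ₑ ∂(ρ.prod μ) = 0 := by
    rw [lintegral_prod _ hw.enorm, ← lintegral_zero (μ := ρ)]
    refine lintegral_congr_ae ?_
    filter_upwards [h] with t ht
    rw [← lintegral_zero (μ := μ)]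
    refine lintegral_congr_ae ?_
    filter_upwards [ht] with x hx
    rw [hx, enorm_zero]
  filter_upwards [(lintegral_eq_zero_iff' hw.enorm).1 h1] with z hz
  exact enorm_eq_zero.1 hz

/-- If a nonnegative functional `∫ Θ(v)` vanishes initially and does not increase, then it vanishes
for all times. -/
theorem IsTimePrimitive.ae_comp_eq_zero (hv : IsTimePrimitive μ f v v') {Θ θ : ℝ → ℝ} {C : ℝ}
    (hΘ : ∀ s, HasDerivAt Θ (θ s) s) (hθ : Continuous θ) (hθC : ∀ s, |θ s| ≤ C * |s|)
    (hΘ0 : ∀ s, 0 ≤ Θ s) (hΘf : ∀ᵐ x ∂μ, Θ (f x) = 0)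
    (h : ∀ᵐ s ∂(volume.restrict (Ioi (0 : ℝ))), ∫ x, v' s x * θ (v s x) ∂μ ≤ 0) :
    ∀ᵐ z ∂((volume.restrict (Ioi (0 : ℝ))).prod μ), Θ (v z.1 z.2) = 0 := by
  have hΘc : Continuous Θ := continuous_iff_continuousAt.2 fun s => (hΘ s).continuousAt
  have hfi : Integrable (fun x => Θ (f x)) μ := (integrable_zero X ℝ μ).congr (by
    filter_upwards [hΘf] with x hx
    exact hx.symm)
  have key : ∀ᵐ t ∂(volume.restrict (Ioi (0 : ℝ))), ∀ᵐ x ∂μ, Θ (v t x) = 0 := by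
    filter_upwards [hv.integral_comp hΘ hθ hθC hfi, ae_restrict_mem measurableSet_Ioi]
      with t ht ht0
    obtain ⟨h1, h2⟩ := ht
    rw [integral_congr_ae (g := fun _ => 0) hΘf, integral_zero, zero_add,
      integral_Ioo_eq_intervalIntegral (mem_Ioi.1 ht0).le] at h2
    have h3 : ∫ s in Ioo 0 t, (∫ x, v' s x * θ (v s x) ∂μ) ≤ 0 :=
      integral_nonpos_of_ae (ae_restrict_of_ae_restrict_of_subset Ioo_subset_Ioi_self h)
    have h4 : ∫ x, Θ (v t x) ∂μ = 0 :=
      le_antisymm (h2.trans_le h3) (integral_nonneg fun x => hΘ0 _)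
    exact (integral_eq_zero_iff_of_nonneg (fun x => hΘ0 _) h1).1 h4
  refine ae_prod_Ioi_of_forall_Ioo fun T hT => ae_prod_eq_zero_of_ae_ae
    (w := fun z : ℝ × X => Θ (v z.1 z.2)) (hΘc.comp_aestronglyMeasurable (hv.memLp T hT).1)
    (ae_restrict_of_ae_restrict_of_subset Ioo_subset_Ioi_self key)

lemma neg_integral_pos_iff_neg {g : ℝ → ℝ} (hg : Continuous g) (h0 : ∀ s, 0 ≤ s → g s = 0)
    (h1 : ∀ s, s < 0 → 0 < g s) :
    (∀ s, 0 ≤ s → -∫ r in (0 : ℝ)..s, g r = 0) ∧ ∀ s, s < 0 → 0 < -∫ r in (0 : ℝ)..s, g r := by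
  refine ⟨fun s hs => ?_, fun s hs => ?_⟩
  · rw [neg_eq_zero]
    refine (intervalIntegral.integral_congr (g := fun _ => 0) fun r hr => ?_).trans (by simp)
    rw [uIcc_of_le hs] at hr
    exact h0 r hr.1
  · rw [← intervalIntegral.integral_symm]
    exact intervalIntegral.intervalIntegral_pos_of_pos_on (hg.intervalIntegrable _ _)
      (fun r hr => h1 r hr.2) hs

lemma expNegInvGlue_le_one (s : ℝ) : expNegInvGlue s ≤ 1 := by
  unfold expNegInvGlue
  split_ifs with h
  · exact zero_le_one
  · rw [Real.exp_le_one_iff]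
    simp only [Left.neg_nonpos_iff, inv_nonneg]
    linarith

/-- A smooth convex function which vanishes exactly on `[0, ∞)`, with bounded second derivative. -/
lemma exists_smooth_convex_vanishing_on_nonneg : ∃ Θ θ : ℝ → ℝ, (∀ s, HasDerivAt Θ (θ s) s) ∧
    ContDiff ℝ ∞ θ ∧ θ 0 = 0 ∧ (∀ s, 0 ≤ deriv θ s ∧ deriv θ s ≤ 1) ∧ (∀ s, 0 ≤ s → Θ s = 0) ∧
    ∀ s, s < 0 → 0 < Θ s := by
  -- The prescribed second derivative: smooth, with values in `[0, 1]`, and positive exactly on the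
  -- negative axis. Integrating twice from `0` gives `Θ`, with `θ = Θ'` and `θ' = g`.
  let g : ℝ → ℝ := fun s => expNegInvGlue (-s)
  have hgs : ContDiff ℝ ∞ g := expNegInvGlue.contDiff.comp contDiff_neg
  let k : ℝ → ℝ := fun s => -∫ r in (0 : ℝ)..s, g r
  have hk := neg_integral_pos_iff_neg hgs.continuous
    (fun s hs => expNegInvGlue.zero_of_nonpos (by linarith))
    (fun s hs => expNegInvGlue.pos_of_pos (by linarith))
  have hkd : ∀ s, HasDerivAt k (-g s) s := fun s =>
    (hgs.continuous.integral_hasStrictDerivAt 0 s).hasDerivAt.neg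
  have hks : ContDiff ℝ ∞ k := by
    rw [contDiff_infty_iff_deriv]
    refine ⟨fun s => (hkd s).differentiableAt, ?_⟩
    rw [show deriv k = fun s => -g s from deriv_eq hkd]
    exact hgs.neg
  have hK := neg_integral_pos_iff_neg hks.continuous hk.1 hk.2
  have hd : ∀ s, deriv (fun s => -k s) s = g s := fun s => by
    rw [(hkd s).fun_neg.deriv, neg_neg]
  refine ⟨fun s => -∫ r in (0 : ℝ)..s, k r, fun s => -k s, fun s =>
    (hks.continuous.integral_hasStrictDerivAt 0 s).hasDerivAt.neg, hks.neg, ?_, fun s => ?_,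
    hK.1, hK.2⟩
  · rw [neg_eq_zero]; exact hk.1 0 le_rfl
  · rw [hd]
    exact ⟨expNegInvGlue.nonneg _, expNegInvGlue_le_one _⟩

end Comparison

/-! ### Uniqueness, non-negativity and the energy identity -/

section EnergySolution

variable {n : ℕ} {p : ℝ} {f : EuclideanSpace ℝ (Fin n) → ℝ}
  {u u' v v' : ℝ → EuclideanSpace ℝ (Fin n) → ℝ}
  {Du Dv : ℝ → EuclideanSpace ℝ (Fin n) → EuclideanSpace ℝ (Fin n)} {θ : ℝ → ℝ} {C : ℝ≥0}

lemma IsEnergySolution.isTimePrimitive (h : IsEnergySolution p f u u' Du) (hf : MemLp f 2 volume) :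
    IsTimePrimitive volume f u u' :=
  isTimePrimitive_of_weakTimeDeriv hf h.memLp h.memLp_deriv h.hasWeakTimeDeriv h.initial

lemma IsEnergySolution.ae_memLp_grad (h : IsEnergySolution p f u u' Du) :
    ∀ᵐ t ∂(volume.restrict (Ioi (0 : ℝ))), MemLp (Du t) (ENNReal.ofReal p) volume := by
  refine ae_Ioi_of_forall_Ioo fun T hT => ?_
  obtain ⟨C, hC⟩ := h.bounded_grad T hT
  filter_upwards [hC, ae_restrict_of_ae_restrict_of_subset Ioo_subset_Ioi_self
    h.aestronglyMeasurable_grad.prodMk_left] with t h1 h2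
  exact ⟨h2, h1.trans_lt ENNReal.coe_lt_top⟩

lemma two_le_ofReal (hp : 2 < p) : 2 ≤ ENNReal.ofReal p := by
  rw [← ENNReal.ofReal_ofNat]
  exact ENNReal.ofReal_le_ofReal hp.le

/-- Testing the equation with `θ(u)`. -/
lemma IsEnergySolution.ae_integral_deriv_mul_comp (h : IsEnergySolution p f u u' Du) (hp : 2 < p)
    (hθ : ContDiff ℝ ∞ θ) (hθ0 : θ 0 = 0) (hθ' : ∀ s, |deriv θ s| ≤ C) :
    ∀ᵐ t ∂(volume.restrict (Ioi (0 : ℝ))),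
      ∫ x, u' t x * θ (u t x) = - ∫ x, deriv θ (u t x) * ‖Du t x‖ ^ p := by
  have := holderConjugate_ofReal_conjExponent hp
  filter_upwards [h.equation, h.ae_memLp_grad, ae_memLp_of_memLp_prod h.memLp,
    ae_memLp_of_memLp_prod h.memLp_deriv, h.hasWeakGradient] with t h1 h2 h3 h4 h5
  rw [integral_test_comp (two_le_ofReal hp) ENNReal.ofReal_ne_top h4 (h2.pFlux hp)
    (fun φ hφ hφc => by simpa only [inner_pFlux] using h1 φ hφ hφc) h3 h2 h5 hθ hθ0 hθ']
  simp_rw [inner_pFlux_self hp]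

/-- Testing the difference of the equations for `v` and `u` with `v - u`. -/
lemma IsEnergySolution.ae_integral_deriv_sub_mul_sub_nonpos (h : IsEnergySolution p f u u' Du)
    (h' : IsEnergySolution p f v v' Dv) (hp : 2 < p) :
    ∀ᵐ t ∂(volume.restrict (Ioi (0 : ℝ))),
      ∫ x, (v' t x - u' t x) * (v t x - u t x) ≤ 0 := by
  have := holderConjugate_ofReal_conjExponent hp
  filter_upwards [h.equation, h.ae_memLp_grad, ae_memLp_of_memLp_prod h.memLp,
    ae_memLp_of_memLp_prod h.memLp_deriv, h.hasWeakGradient, h'.equation, h'.ae_memLp_grad,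
    ae_memLp_of_memLp_prod h'.memLp, ae_memLp_of_memLp_prod h'.memLp_deriv, h'.hasWeakGradient]
    with t h1 h2 h3 h4 h5 k1 k2 k3 k4 k5
  have hint : ∀ {g : EuclideanSpace ℝ (Fin n) → ℝ}
      {G : EuclideanSpace ℝ (Fin n) → EuclideanSpace ℝ (Fin n)}, MemLp g 2 volume →
      MemLp G (ENNReal.ofReal p) volume → ∀ φ : EuclideanSpace ℝ (Fin n) → ℝ, ContDiff ℝ ∞ φ →
      HasCompactSupport φ →
      Integrable (fun x => g x * φ x + inner ℝ (pFlux p (G x)) (∇ φ x)) volume :=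
    fun hg hG φ hφ hφc =>
      (hg.integrable_mul
        (hφ.continuous.memLp_of_hasCompactSupport hφc : MemLp φ 2 volume)).add
        (hG.integrable_inner_pFlux hp
          ((continuous_gradient hφ).memLp_of_hasCompactSupport hφc.gradient))
  -- The equations are first subtracted, which gives a weak formulation with time derivative `v' -
  -- u'` and flux the difference of the fluxes. Testing it with `v - u` produces the monotone
  -- pairing.
  have key := integral_test_comp (θ := id) (C := 1) (two_le_ofReal hp) ENNReal.ofReal_ne_top
    (k4.sub h4) ((k2.pFlux hp).sub (h2.pFlux hp)) (fun φ hφ hφc => by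
      have e1 := h1 φ hφ hφc
      have e2 := k1 φ hφ hφc
      simp only [← inner_pFlux] at e1 e2
      have e3 := integral_sub (hint k4 k2 φ hφ hφc) (hint h4 h2 φ hφ hφc)
      rw [e1, e2, sub_zero] at e3
      rw [← e3]
      refine integral_congr_ae (.of_forall fun x => ?_)
      simp only [Pi.sub_apply, inner_sub_left]
      ring) (k3.sub h3) (k2.sub h2) (k5.sub h5) contDiff_id rfl (fun s => by simp)
  simp only [Pi.sub_apply, id, deriv_id, one_mul] at key
  rw [key, neg_nonpos]
  exact integral_nonneg fun x => inner_pFlux_sub_nonneg hp _ _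

/-- Energy solutions are unique. -/
theorem IsEnergySolution.ae_eq (h : IsEnergySolution p f u u' Du)
    (h' : IsEnergySolution p f v v' Dv) (hp : 2 < p) (hf : MemLp f 2 volume) :
    ∀ᵐ z ∂((volume.restrict (Ioi (0 : ℝ))).prod
      (volume : Measure (EuclideanSpace ℝ (Fin n)))), v z.1 z.2 = u z.1 z.2 := by
  have h1 := ((h'.isTimePrimitive hf).sub (h.isTimePrimitive hf)).ae_comp_eq_zero
    (Θ := fun s => s ^ 2 / 2) (θ := fun s => s) (C := 1)
    (fun s => by simpa using (hasDerivAt_pow 2 s).div_const 2) continuous_id (fun s => by simp)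
    (fun s => by positivity) (.of_forall fun x => by simp)
    (h.ae_integral_deriv_sub_mul_sub_nonpos h' hp)
  filter_upwards [h1] with z hz
  have : v z.1 z.2 - u z.1 z.2 = 0 := by simpa using hz
  linarith

/-- Energy solutions with nonnegative initial values are nonnegative. -/
theorem IsEnergySolution.ae_nonneg (h : IsEnergySolution p f u u' Du) (hp : 2 < p)
    (hf : MemLp f 2 volume) (hf0 : ∀ᵐ x, 0 ≤ f x) :
    ∀ᵐ z ∂((volume.restrict (Ioi (0 : ℝ))).prod
      (volume : Measure (EuclideanSpace ℝ (Fin n)))), 0 ≤ u z.1 z.2 := by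
  obtain ⟨Θ, θ, hΘ, hθ, hθ0, hθ', hΘ0, hΘ1⟩ := exists_smooth_convex_vanishing_on_nonneg
  have hθ'' : ∀ s, |deriv θ s| ≤ (1 : ℝ≥0) := fun s => abs_le.2 ⟨by
    have := (hθ' s).1
    push_cast
    linarith, (hθ' s).2⟩
  -- The functional vanishes initially because `f ≥ 0`, and testing with `θ(u)` gives the rate `-∫
  -- θ'(u) |Du|^p ≤ 0` because `Θ` is convex.
  have h1 := (h.isTimePrimitive hf).ae_comp_eq_zero (C := (1 : ℝ≥0)) hΘ hθ.continuous
    (fun s => (lipschitzWith_of_abs_deriv_le hθ hθ'').abs_le_mul_abs hθ0 s) (fun s => by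
      rcases lt_or_ge s 0 with hs | hs
      · exact (hΘ1 s hs).le
      · exact (hΘ0 s hs).ge) (by filter_upwards [hf0] with x hx using hΘ0 _ hx) (by
      filter_upwards [h.ae_integral_deriv_mul_comp hp hθ hθ0 hθ''] with t ht
      rw [ht, neg_nonpos]
      exact integral_nonneg fun x => mul_nonneg (hθ' _).1 (by positivity))
  filter_upwards [h1] with z hz
  by_contra hneg
  exact (hΘ1 _ (not_le.1 hneg)).ne' hz

/-- The energy identity in `L²` for almost every time. -/
theorem IsEnergySolution.ae_eLpNorm_sq_add (h : IsEnergySolution p f u u' Du) (hp : 2 < p)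
    (hf : MemLp f 2 volume) : ∀ᵐ t ∂(volume.restrict (Ioi (0 : ℝ))),
    eLpNorm (u t) 2 volume ^ 2
      + 2 * (∫⁻ s in Ioo 0 t, eLpNorm (Du s) (ENNReal.ofReal p) volume ^ p)
      = eLpNorm f 2 volume ^ 2 := by
  have hsq : ∀ {g : EuclideanSpace ℝ (Fin n) → ℝ}, MemLp g 2 volume →
      eLpNorm g 2 volume ^ 2 = ENNReal.ofReal (2 * ∫ x, g x ^ 2 / 2) := fun {g} hg => by
    have h1 : ∀ x, g x ^ 2 / 2 = 1 / 2 * ‖g x‖ ^ 2 := fun x => by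
      rw [Real.norm_eq_abs, sq_abs]; ring
    simp_rw [h1]
    rw [integral_const_mul, ← mul_assoc, mul_one_div_cancel two_ne_zero, one_mul,
      hg.eLpNorm_eq_integral_rpow_norm two_ne_zero (by simp), ← ENNReal.ofReal_pow (by positivity),
      ENNReal.toReal_ofNat, ← Real.rpow_natCast, ← Real.rpow_mul (by positivity)]
    norm_num
  have hprim := h.isTimePrimitive hf
  have hk : ∀ T : ℝ, 0 < T → Integrable (fun z : ℝ × EuclideanSpace ℝ (Fin n) =>
      u' z.1 z.2 * u z.1 z.2) ((volume.restrict (Ioo 0 T)).prod volume) := fun T hT =>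
    (h.memLp_deriv T hT).integrable_mul (h.memLp T hT)
  have htest := h.ae_integral_deriv_mul_comp (θ := fun s => s) (C := 1) hp contDiff_id rfl
    (fun s => by simp)
  filter_upwards [hprim.integral_comp (Θ := fun s => s ^ 2 / 2) (θ := fun s => s) (C := 1)
    (fun s => by simpa using (hasDerivAt_pow 2 s).div_const 2) continuous_id (fun s => by simp)
    (hf.integrable_sq.div_const 2), ae_restrict_mem measurableSet_Ioi,
    ae_memLp_of_memLp_prod h.memLp] with t ht ht0 hut
  have ht0' : 0 < t := ht0
  obtain ⟨-, i2, -⟩ := integral_intervalIntegral_swap (g := fun s x => u' s x * u s x) hk ht0'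
  rw [intervalIntegrable_iff_integrableOn_Ioo_of_le ht0'.le] at i2
  have htest' : ∀ᵐ s ∂(volume.restrict (Ioo 0 t)),
      ∫ x, u' s x * u s x = - ∫ x, ‖Du s x‖ ^ p := by
    filter_upwards [ae_restrict_of_ae_restrict_of_subset Ioo_subset_Ioi_self htest] with s hs
    simpa using hs
  -- Integrability in time of the `p`-energy is inherited from the pairing of `u'` and `u`, with
  -- which it agrees up to sign almost everywhere.
  have i3 : IntegrableOn (fun s => ∫ x, ‖Du s x‖ ^ p) (Ioo 0 t) := by
    refine i2.neg.congr ?_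
    filter_upwards [htest'] with s hs
    rw [Pi.neg_apply, hs, neg_neg]
  have e1 : ∫⁻ s in Ioo 0 t, eLpNorm (Du s) (ENNReal.ofReal p) volume ^ p
      = ENNReal.ofReal (∫ s in Ioo 0 t, ∫ x, ‖Du s x‖ ^ p) := by
    rw [ofReal_integral_eq_lintegral_ofReal i3 (.of_forall fun s => by positivity)]
    refine lintegral_congr_ae ?_
    filter_upwards [ae_restrict_of_ae_restrict_of_subset Ioo_subset_Ioi_self h.ae_memLp_grad]
      with s hs
    exact hs.eLpNorm_rpow_ofReal hp
  have e2 := ht.2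
  rw [integral_Ioo_eq_intervalIntegral ht0'.le, integral_congr_ae htest', integral_neg] at e2
  have aux : ∀ A B : ℝ, 0 ≤ A → 0 ≤ B + -A →
      ENNReal.ofReal (2 * (B + -A)) + 2 * ENNReal.ofReal A = ENNReal.ofReal (2 * B) := by
    intro A B hA hB
    rw [← ENNReal.ofReal_ofNat 2, ← ENNReal.ofReal_mul zero_le_two,
      ← ENNReal.ofReal_add (by positivity) (by positivity)]
    congr 1
    ring
  rw [e1, hsq hut, hsq hf, e2]
  exact aux _ _ (by positivity) (by rw [← e2]; positivity)

end EnergySolution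

/-! ### From curves in `L²` to functions on space-time -/

section Representative

variable {X : Type*} [MeasurableSpace X] {μ : Measure X} [SigmaFinite μ]

lemma MeasureTheory.Lp.norm_sq_eq_integral_sq (v : Lp ℝ 2 μ) : ‖v‖ ^ 2 = ∫ x, v x ^ 2 ∂μ := by
  rw [← real_inner_self_eq_norm_sq, L2.inner_def]
  refine integral_congr_ae (.of_forall fun x => ?_)
  simp only [real_inner_self_eq_norm_sq, Real.norm_eq_abs, sq_abs]

variable {U a : ℝ → Lp ℝ 2 μ} {u u' : ℝ → X → ℝ}

lemma memLp_prod_of_representative (hu : StronglyMeasurable fun z : ℝ × X => u z.1 z.2)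
    (huU : ∀ t, u t =ᵐ[μ] U t) {T : ℝ} (hU : IntegrableOn (fun t => ‖U t‖ ^ 2) (Ioo 0 T)) :
    MemLp (fun z : ℝ × X => u z.1 z.2) 2 ((volume.restrict (Ioo 0 T)).prod μ) := by
  have hsq : ∀ t, (fun x => u t x ^ 2) =ᵐ[μ] fun x => U t x ^ 2 := fun t => by
    filter_upwards [huU t] with x hx
    rw [hx]
  rw [memLp_two_iff_integrable_sq hu.aestronglyMeasurable,
    integrable_prod_iff (f := fun z : ℝ × X => u z.1 z.2 ^ 2) (hu.pow 2).aestronglyMeasurable]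
  refine ⟨.of_forall fun t => (Lp.memLp (U t)).integrable_sq.congr (hsq t).symm,
    hU.congr (.of_forall fun t => ?_)⟩
  simp only [norm_pow, Real.norm_eq_abs, sq_abs]
  rw [Lp.norm_sq_eq_integral_sq, integral_congr_ae (hsq t)]

/-- A Bochner primitive in `L²` has the expected weak time derivative. -/
lemma ae_weakTimeDeriv_of_eq_add_integral {F : Lp ℝ 2 μ}
    (hu : ∀ T : ℝ, 0 < T →
      MemLp (fun z : ℝ × X => u z.1 z.2) 2 ((volume.restrict (Ioo 0 T)).prod μ))
    (hu' : ∀ T : ℝ, 0 < T →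
      MemLp (fun z : ℝ × X => u' z.1 z.2) 2 ((volume.restrict (Ioo 0 T)).prod μ))
    (huU : ∀ t, u t =ᵐ[μ] U t) (hua : ∀ t, u' t =ᵐ[μ] a t)
    (ha : ∀ T : ℝ, 0 < T → IntervalIntegrable a volume 0 T)
    (hU : ∀ t, 0 ≤ t → U t = F + ∫ s in (0 : ℝ)..t, a s) {φ : ℝ → ℝ} (hφ : ContDiff ℝ ∞ φ)
    (hφc : HasCompactSupport φ) (hφ0 : tsupport φ ⊆ Ioi 0) :
    ∀ᵐ x ∂μ, ∫ t in Ioi (0 : ℝ), deriv φ t * u t x = - ∫ t in Ioi (0 : ℝ), φ t * u' t x := by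
  obtain ⟨M, hM0, -, hM⟩ := exists_setIntegral_Ioi_eq_intervalIntegral hφc
  have hd := tsupport_deriv_subset' φ
  have key1 : ∀ B : Set X, μ B < ⊤ → _ := fun B hB =>
    integrable_intervalIntegral_mul_and_swap (hφ.continuous_deriv (by simp)) hφc.deriv
      (fun T hT => (hu T hT).integrable_prod_restrict hB.ne) hM0
  have key2 : ∀ B : Set X, μ B < ⊤ → _ := fun B hB =>
    integrable_intervalIntegral_mul_and_swap hφ.continuous hφc
      (fun T hT => (hu' T hT).integrable_prod_restrict hB.ne) hM0
  simp_rw [hM _ hd, hM _ subset_rfl]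
  refine ae_eq_of_forall_setIntegral_eq_of_sigmaFinite (fun B _ hB => (key1 B hB).1)
    (fun B _ hB => (key2 B hB).1.neg) fun B hBm hB => ?_
  rw [integral_neg, ← (key1 B hB).2, ← (key2 B hB).2, ← hM _ hd, ← hM _ subset_rfl]
  -- Pairing with the indicator of a set of finite measure turns the Bochner primitive into a scalar
  -- one, for which integration by parts in time is available.
  let e : Lp ℝ 2 μ →L[ℝ] ℝ := innerSL ℝ (indicatorConstLp 2 hBm hB.ne (1 : ℝ))
  have he : ∀ w : Lp ℝ 2 μ, e w = ∫ x in B, w x ∂μ := fun w =>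
    L2.inner_indicatorConstLp_one hBm hB.ne w
  have e1 : ∀ t, ∫ x in B, u' t x ∂μ = e (a t) := fun t => by
    rw [he]; exact integral_congr_ae (ae_restrict_of_ae (hua t))
  have e2 : ∀ t, 0 ≤ t → ∫ x in B, u t x ∂μ = e F + ∫ s in (0 : ℝ)..t, e (a s) := fun t ht => by
    rcases ht.eq_or_lt with rfl | ht'
    · rw [intervalIntegral.integral_same, add_zero, he]
      have h0 := hU 0 le_rfl
      rw [intervalIntegral.integral_same, add_zero] at h0
      rw [← h0]
      exact integral_congr_ae (ae_restrict_of_ae (huU 0))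
    · rw [e.intervalIntegral_comp_comm (ha t ht'), ← map_add, ← hU t ht, he]
      exact integral_congr_ae (ae_restrict_of_ae (huU t))
  have he' : ∀ T, 0 < T → IntervalIntegrable (fun s => e (a s)) volume 0 T := fun T hT => by
    have h := ha T hT
    rw [intervalIntegrable_iff] at h ⊢
    exact e.integrable_comp h
  simp_rw [e1]
  rw [← integral_deriv_mul_const_add_integral hφ hφc hφ0 he' (e F)]
  refine setIntegral_congr_fun measurableSet_Ioi fun t ht => ?_
  rw [e2 t (mem_Ioi.1 ht).le]

end Representative

/-! ### Construction of the energy solution and the estimates at every time -/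

section Existence

variable {n : ℕ} {p : ℝ}

lemma weakGrad_of_ae_eq {v : Lp ℝ 2 (volume : Measure (EuclideanSpace ℝ (Fin n)))}
    {g : EuclideanSpace ℝ (Fin n) → ℝ} (hv : v ∈ dirichletDomain n p) (hg : g =ᵐ[volume] v) :
    HasWeakGradient g (weakGrad g) ∧ weakGrad g =ᵐ[volume] weakGrad v := by
  have h := hv.1.congr hg.symm .rfl
  exact ⟨h.congr .rfl h.weakGrad_ae_eq.symm, h.weakGrad_ae_eq⟩

lemma ofReal_mul_eLpNorm_rpow_eq_dirichletEnergy (hp : 2 < p)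
    {v : Lp ℝ 2 (volume : Measure (EuclideanSpace ℝ (Fin n)))}
    {G : EuclideanSpace ℝ (Fin n) → EuclideanSpace ℝ (Fin n)} (hv : v ∈ dirichletDomain n p)
    (hG : G =ᵐ[volume] weakGrad v) :
    ENNReal.ofReal (1 / p) * eLpNorm G (ENNReal.ofReal p) volume ^ p
      = ENNReal.ofReal (dirichletEnergy p v) := by
  have hp0 : 0 < p := by linarith
  rw [eLpNorm_congr_ae hG, hv.2.eLpNorm_rpow_ofReal hp, ← ENNReal.ofReal_mul (by positivity)]
  rfl

lemma tendsto_eLpNorm_sub_of_representative {X : Type*} [MeasurableSpace X] {μ : Measure X}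
    {U : ℝ → Lp ℝ 2 μ} {u : ℝ → X → ℝ} (hU : Continuous U) (huU : ∀ t, u t =ᵐ[μ] U t) (t : ℝ) :
    Tendsto (fun s => eLpNorm (u s - u t) 2 μ) (𝓝 t) (𝓝 0) := by
  have h1 : ∀ s, eLpNorm (u s - u t) 2 μ = edist (U s) (U t) := fun s => by
    rw [Lp.edist_def]
    exact eLpNorm_congr_ae ((huU s).sub (huU t))
  simp_rw [h1]
  exact tendsto_iff_edist_tendsto_0.1 (hU.tendsto t)

variable {f : EuclideanSpace ℝ (Fin n) → ℝ}
  {Df : EuclideanSpace ℝ (Fin n) → EuclideanSpace ℝ (Fin n)}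

/-- Existence of energy solutions which are continuous with values in `L²`, together with the
second energy estimate. -/
theorem exists_isEnergySolution (hp : 2 < p) (hf : MemLp f 2 volume) (hDf : HasWeakGradient f Df)
    (hDfp : MemLp Df (ENNReal.ofReal p) volume) :
    ∃ u u' : ℝ → EuclideanSpace ℝ (Fin n) → ℝ,
      IsEnergySolution p f u u' (fun t => weakGrad (u t)) ∧ IsContinuousL2 u ∧ u 0 =ᵐ[volume] f ∧
      Continuous (fun t => eLpNorm (u t) 2 volume) ∧
      ∀ t : ℝ, 0 < t → HasWeakGradient (u t) (weakGrad (u t)) ∧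
        (∫⁻ s in Ioo 0 t, eLpNorm (u' s) 2 volume ^ 2)
            + ENNReal.ofReal (1 / p) * eLpNorm (weakGrad (u t)) (ENNReal.ofReal p) volume ^ p
          ≤ ENNReal.ofReal (1 / p) * eLpNorm Df (ENNReal.ofReal p) volume ^ p := by
  have hp0 : 0 < p := by linarith
  obtain ⟨hFD, hFDf⟩ := mem_dirichletDomain_of_hasWeakGradient hf.coeFn_toLp hDf hDfp
  obtain ⟨U, a, hU0, hUc, ham, ha2, hUa, hUD, hUE, hUEL⟩ :=
    (isConvexEnergy_dirichletEnergy hp).exists_gradientFlow hFD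
  obtain ⟨u, hum, huU⟩ := exists_jointly_measurable_representative hUc.stronglyMeasurable
  obtain ⟨u', hum', hua⟩ := exists_jointly_measurable_representative ham
  have ha2i : Integrable (fun t => ‖a t‖ ^ 2) := ha2.integrable_norm_pow (by norm_num)
  have hmem : ∀ T : ℝ, 0 < T → MemLp (fun z : ℝ × EuclideanSpace ℝ (Fin n) => u z.1 z.2) 2
      ((volume.restrict (Ioo 0 T)).prod volume) := fun T _ =>
    memLp_prod_of_representative hum huU
      (((hUc.norm.pow 2).integrableOn_Icc (a := 0) (b := T)).mono_set Ioo_subset_Icc_self)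
  have hmem' : ∀ T : ℝ, 0 < T → MemLp (fun z : ℝ × EuclideanSpace ℝ (Fin n) => u' z.1 z.2) 2
      ((volume.restrict (Ioo 0 T)).prod volume) := fun T _ =>
    memLp_prod_of_representative hum' hua ha2i.integrableOn
  have haI : ∀ T : ℝ, 0 < T → IntervalIntegrable a volume 0 T := fun T hT => by
    rw [intervalIntegrable_iff_integrableOn_Ioo_of_le hT.le]
    exact (ha2.restrict _).integrable one_le_two
  have hgrad : ∀ t : ℝ, 0 ≤ t → _ := fun t ht => weakGrad_of_ae_eq (hUD t ht) (huU t)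
  have hE : ∀ t : ℝ, 0 ≤ t → ENNReal.ofReal (1 / p)
      * eLpNorm (weakGrad (u t)) (ENNReal.ofReal p) volume ^ p
      = ENNReal.ofReal (dirichletEnergy p (U t)) := fun t ht =>
    ofReal_mul_eLpNorm_rpow_eq_dirichletEnergy hp (hUD t ht) (hgrad t ht).2
  have hEf := ofReal_mul_eLpNorm_rpow_eq_dirichletEnergy hp hFD hFDf.symm
  have hEest : ∀ t : ℝ, 0 < t → (∫⁻ s in Ioo 0 t, eLpNorm (u' s) 2 volume ^ 2)
      + ENNReal.ofReal (1 / p) * eLpNorm (weakGrad (u t)) (ENNReal.ofReal p) volume ^ p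
      ≤ ENNReal.ofReal (1 / p) * eLpNorm Df (ENNReal.ofReal p) volume ^ p := fun t ht => by
    have h1 : ∫⁻ s in Ioo 0 t, eLpNorm (u' s) 2 volume ^ 2
        = ENNReal.ofReal (∫ s in (0 : ℝ)..t, ‖a s‖ ^ 2) := by
      rw [integral_Ioo_eq_intervalIntegral ht.le,
        ofReal_integral_eq_lintegral_ofReal ha2i.integrableOn (.of_forall fun s => by positivity)]
      refine lintegral_congr fun s => ?_
      rw [eLpNorm_congr_ae (hua s), ← Lp.enorm_def, ENNReal.ofReal_pow (norm_nonneg _),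
        ofReal_norm]
    rw [h1, hE t ht.le, hEf, ← ENNReal.ofReal_add
      (intervalIntegral.integral_nonneg ht.le fun s _ => by positivity) (dirichletEnergy_nonneg hp _)]
    exact ENNReal.ofReal_le_ofReal (hUE t ht.le)
  have hu0 : u 0 =ᵐ[volume] f := by
    have := huU 0
    rw [hU0] at this
    exact this.trans hf.coeFn_toLp
  refine ⟨u, u', ⟨hmem, hmem', ?_, ?_, ?_, ?_, ?_, ?_⟩, ?_, hu0, ?_, fun t ht =>
    ⟨(hgrad t ht.le).1, hEest t ht⟩⟩
  · exact fun φ h1 h2 h3 => ae_weakTimeDeriv_of_eq_add_integral hmem hmem' huU hua haI hUa h1 h2 h3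
  · exact (stronglyMeasurable_weakGrad hum).aestronglyMeasurable
  · filter_upwards [ae_restrict_mem measurableSet_Ioi] with t ht
    exact (hgrad t (mem_Ioi.1 ht).le).1
  · intro T hT
    -- By the second energy estimate the gradient norm never exceeds its initial value, so this
    -- bound is independent of `T`.
    refine ⟨(eLpNorm Df (ENNReal.ofReal p) volume).toNNReal, ?_⟩
    filter_upwards [ae_restrict_mem measurableSet_Ioo] with t ht
    have h1 := le_add_self.trans (hEest t ht.1)
    rw [ENNReal.mul_le_mul_iff_right (by simpa using hp0) ENNReal.ofReal_ne_top,
      ENNReal.rpow_le_rpow_iff hp0] at h1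
    rwa [ENNReal.coe_toNNReal hDfp.2.ne]
  -- Minus the velocity is a subgradient at almost every time, and the first variation turns this
  -- into the equation.
  · filter_upwards [hUEL, ae_restrict_mem measurableSet_Ioi] with t ht ht0 φ hφ hφc
    rw [← euler_lagrange_of_subgradient hp (hUD t (mem_Ioi.1 ht0).le) ht hφ hφc]
    refine integral_congr_ae ?_
    filter_upwards [hua t, (hgrad t (mem_Ioi.1 ht0).le).2] with x h1 h2
    rw [h1, h2, inner_pFlux]
  · have h1 := ENNReal.Tendsto.pow (n := 2) (tendsto_eLpNorm_sub_of_representative hUc huU 0)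
    rw [zero_pow two_ne_zero] at h1
    refine (h1.mono_left (inf_le_left.trans nhdsWithin_le_nhds)).congr fun t => ?_
    have h2 : eLpNorm (u t - u 0) 2 volume = eLpNorm (fun x => u t x - f x) 2 volume :=
      eLpNorm_congr_ae (EventuallyEq.rfl.sub hu0)
    rw [h2, eLpNorm_eq_lintegral_rpow_enorm_toReal (by norm_num) (by norm_num),
      ← ENNReal.rpow_natCast, ← ENNReal.rpow_mul]
    norm_num
  · exact fun t _ => ⟨(memLp_congr_ae (huU t)).2 (Lp.memLp _),
      (tendsto_eLpNorm_sub_of_representative hUc huU t).mono_left nhdsWithin_le_nhds⟩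
  · have h1 : ∀ t, eLpNorm (u t) 2 volume = ‖U t‖ₑ := fun t => by
      rw [Lp.enorm_def]
      exact eLpNorm_congr_ae (huU t)
    simp_rw [h1]
    exact continuous_enorm.comp hUc

/-- The first energy estimate. -/
lemma IsEnergySolution.eLpNorm_sq_add_le {u u' : ℝ → EuclideanSpace ℝ (Fin n) → ℝ}
    {Du : ℝ → EuclideanSpace ℝ (Fin n) → EuclideanSpace ℝ (Fin n)}
    (h : IsEnergySolution p f u u' Du) (hp : 2 < p) (hf : MemLp f 2 volume)
    {t : ℝ} (ht : 0 < t)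
    (hu : Tendsto (fun s => eLpNorm (u s) 2 volume) (𝓝 t) (𝓝 (eLpNorm (u t) 2 volume))) :
    eLpNorm (u t) 2 volume ^ 2
      + 2 * (∫⁻ s in Ioo 0 t, eLpNorm (Du s) (ENNReal.ofReal p) volume ^ p)
      ≤ eLpNorm f 2 volume ^ 2 := by
  have := neBot_nhdsGT_inf_ae t
  -- The identity is known at almost every `s > t`. As `s` decreases to `t` the `L²` norm is
  -- continuous, while the integral up to `t` is bounded by the one up to `s`.
  refine le_of_tendsto (x := 𝓝[>] t ⊓ ae volume)
    (((ENNReal.Tendsto.pow hu).mono_left (inf_le_left.trans nhdsWithin_le_nhds)).add_const _) ?_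
  filter_upwards [mem_inf_of_left self_mem_nhdsWithin,
    mem_inf_of_right ((ae_restrict_iff' measurableSet_Ioi).1 (h.ae_eLpNorm_sq_add hp hf))]
    with s hs1 hs2
  have hts : t < s := hs1
  rw [← hs2 (ht.trans hts)]
  gcongr

end Existence

theorem proposition3p2 (n : ℕ) (hn : 1 ≤ n) (p : ℝ) (hp : 2 < p)
    (f : EuclideanSpace ℝ (Fin n) → ℝ)
    (Df : EuclideanSpace ℝ (Fin n) → EuclideanSpace ℝ (Fin n))
    (hf : MemLp f 2 volume) (hDf : HasWeakGradient f Df)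
    (hDfp : MemLp Df (ENNReal.ofReal p) volume) :
    ∃ (u u' : ℝ → EuclideanSpace ℝ (Fin n) → ℝ)
      (Du : ℝ → EuclideanSpace ℝ (Fin n) → EuclideanSpace ℝ (Fin n)),
      -- existence
      IsEnergySolution p f u u' Du ∧
      -- uniqueness, as functions modulo null sets of space-time
      (∀ (v v' : ℝ → EuclideanSpace ℝ (Fin n) → ℝ)
        (Dv : ℝ → EuclideanSpace ℝ (Fin n) → EuclideanSpace ℝ (Fin n)),
        IsEnergySolution p f v v' Dv →
          ∀ᵐ z ∂((volume.restrict (Ioi (0 : ℝ))).prod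
            (volume : Measure (EuclideanSpace ℝ (Fin n)))), v z.1 z.2 = u z.1 z.2) ∧
      -- `u` is the representative that is continuous in time, starting at `f`
      IsContinuousL2 u ∧ u 0 =ᵐ[volume] f ∧
      -- the energy estimates, for every positive time
      (∀ t : ℝ, 0 < t → HasWeakGradient (u t) (Du t) ∧
        eLpNorm (u t) 2 volume ^ 2
            + 2 * (∫⁻ s in Ioo 0 t, eLpNorm (Du s) (ENNReal.ofReal p) volume ^ p)
          ≤ eLpNorm f 2 volume ^ 2 ∧
        (∫⁻ s in Ioo 0 t, eLpNorm (u' s) 2 volume ^ 2)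
            + ENNReal.ofReal (1 / p) * eLpNorm (Du t) (ENNReal.ofReal p) volume ^ p
          ≤ ENNReal.ofReal (1 / p) * eLpNorm Df (ENNReal.ofReal p) volume ^ p) ∧
      -- non-negativity
      ((∀ᵐ x, 0 ≤ f x) →
        ∀ᵐ z ∂((volume.restrict (Ioi (0 : ℝ))).prod
          (volume : Measure (EuclideanSpace ℝ (Fin n)))), 0 ≤ u z.1 z.2) := by
  obtain ⟨u, u', hu, hc, hu0, hcn, hest⟩ := exists_isEnergySolution hp hf hDf hDfp
  exact ⟨u, u', fun t => weakGrad (u t), hu, fun v v' Dv hv => hu.ae_eq hv hp hf, hc, hu0,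
    fun t ht => ⟨(hest t ht).1, hu.eLpNorm_sq_add_le hp hf ht (hcn.tendsto t), (hest t ht).2⟩,
    hu.ae_nonneg hp hf⟩
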